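/- **Conventions.** Fix a Grothendieck universe; "small" refers to it, and $\mathfrak{Cat}$ is the 2-category of small categories. A *category of diagrams* $\mathfrak{Dia}$ is a small full sub-2-category of $\mathfrak{Cat}$ which contains (up to isomorphism) the empty category, the terminal category $e$ and $\mathbb 2=\{0<1\}$, and is closed under finite coproducts, pullbacks, opposites and, for every $u:C\to D$ in $\mathfrak{Dia}$ and $d\in D$, under the undercategory $d\backslash C$ (objects $(c,\,d\to u(c))$) and the overcategory $C/d$. Let $\mathfrak{Dia}^{coop}$ be $\mathfrak{Dia}$ with 1-cells and 2-cells reversed. A *prederivator* is a strict 2-functor $\mathbb D:\mathfrak{Dia}^{coop}\to\mathfrak{Cat}$; write $u^*=\mathbb D(u)$. It is a *right derivator* if 1. $\mathbb D(C_0\amalg C_1)\to\mathbb D(C_0)\times\mathbb D(C_1)$ is an equivalence for all $C_0,C_1$, and $\mathbb D(\varnothing)\simeq e$; 2. a morphism $f$ of $\mathbb D(C)$ is invertible if and only if $c^*f$ is invertible in $\mathbb D(e)$ for every object $c:e\to C$; 3. every $u^*$ has a left adjoint $u_!$; 4. for every $u:C\to D$ and $d\in D$, let $f:d\backslash C\to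 C$ and $t:d\backslash C\to e$ be the canonical functors and $\alpha:d\,t\Rightarrow u f$ the canonical 2-cell; then the Beck–Chevalley transform $t_!f^*\Rightarrow t_!f^*u^*u_!\Rightarrow t_!t^*d^*u_!\Rightarrow d^*u_!$ of $\alpha^*$ is invertible. A pseudo-natural transformation $\theta:\mathbb D_1\to\mathbb D_2$ is *cocontinuous* if for every $u:C\to D$ in $\mathfrak{Dia}$ the Beck–Chevalley transform $u_!\theta_C\Rightarrow\theta_D u_!$ of its structural 2-isomorphism at $u$ is invertible. $\mathfrak{Der}^r$ is the 2-category of right derivators, cocontinuous pseudo-natural transformations and modifications. A *weighted limit 2-sketch* $S=(\mathcal G,\mathcal P)$ is a small 2-category $\mathcal G$ with a set $\mathcal P$ of weighted cones $(\mathcal E,F,W,L,\gamma)$: $\mathcal E$ is a small 2-category, $F:\mathcal E\to\mathcal G$ and $W:\mathcal E\to\mathfrak{Cat}$ are 2-functors, $L\in\mathcal G$, and $\gamma:W\Rightarrow\mathcal G(L,F-)$ is 2-natural. It is a *weighted homotopy limit 2-sketch* if all the weights $W$ are cofibrant in the projective model structure on $[\mathcal E,\mathfrak{Cat}]$. A *homotopy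 model* of $S$ is a 2-functor $M:\mathcal G\to\mathfrak{Cat}$ such that for each cone in $\mathcal P$ and each small category $X$ the functor $\mathfrak{Cat}(X,ML)\to[\mathcal E,\mathfrak{Cat}](W,\mathfrak{Cat}(X,MF-))$ induced by $M\gamma$ is an equivalence. $\mathfrak{hMod}^{ps}_S$ is the 2-category of homotopy models, pseudo-natural transformations and modifications. A *biequivalence* is a pseudofunctor which is surjective on objects up to equivalence and induces equivalences of hom-categories. **The sketch.** For a category of diagrams $\mathfrak{Dia}$, let $\mathcal G$ be the 2-category with the objects of $\mathfrak{Dia}$ obtained from $\mathfrak{Dia}^{coop}$ by freely adjoining * a left adjoint $u_!$, with unit and counit 2-cells subject to the triangle identities, for every 1-cell $u$ which does not already have a left adjoint in $\mathfrak{Dia}^{coop}$ (otherwise $u_!$ denotes a chosen left adjoint in $\mathfrak{Dia}^{coop}$), and * an inverse of the Beck–Chevalley 2-cell $t_!f\Rightarrow d\,u_!$ ($t$, $f$, $d$, $u$ being viewed as 1-cells of $\mathfrak{Dia}^{coop}$), formed as in axiom 4 from $\alpha$ and these adjunctions, for every $u:C\to D$ in $\mathfrak{Dia}$ and $d\in D$.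 Let $\mathcal P$ consist of the following cones, all of whose components $W(x)\to\mathcal G(L,Fx)$ are constant functors: * for all $C_0,C_1$: the cone with shape the discrete category $\{0,1\}$, diagram $i\mapsto C_i$, weight constant at $e$, vertex $C_0\amalg C_1$ and legs the canonical inclusions (as 1-cells of $\mathfrak{Dia}^{coop}$); * the empty cone with vertex $\varnothing$; * for each $C$: the cone with shape the set of objects of $C$ with an initial object $*$ adjoined, diagram $*\mapsto C$, $c\mapsto e$, $(*\to c)\mapsto (c:e\to C)$, vertex $C$, leg $1_C$ at $*$ and leg $c:e\to C$ at $c$, and as weight the cofibrant replacement (pseudomorphism classifier) of the weight $*\mapsto\mathbb 2$, $c\mapsto e$; explicitly, $*\mapsto\mathbb 2$, each $c$ is sent to the indiscrete category on three objects $\{0,1,\bullet\}$, and $*\to c$ to the inclusion of $\mathbb 2$ which is the identity on the objects $0,1$. **Theorem.** For every category of diagrams $\mathfrak{Dia}$, $S=(\mathcal G,\mathcal P)$ is a weighted homotopy limit 2-sketch, and there is a biequivalence $$\Phi:\mathfrak{hMod}^{ps}_S\longrightarrow\mathfrak{Der}^r$$ which on objects is given by restriction along the canonical 2-functor $\mathfrak{Dia}^{coop}\to\mathcal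 G$. -/

import Mathlib

open CategoryTheory Bicategory
open scoped Pseudofunctor.StrongTrans

universe u w₁ v₁ u₁ w₂ v₂ u₂ u₃

namespace DerivatorSketch

section TwoNatural

variable {E : Type u₁} [Bicategory.{w₁, v₁} E] {K : Type u₂} [Bicategory.{w₂, v₂} K]

/-- A pseudo-natural transformation is 2-natural if its naturality squares commute strictly,
i.e. if its structural 2-isomorphisms are identities. -/
def IsTwoNatural {F G : Pseudofunctor E K} (θ : F ⟶ G) : Prop :=
  ∀ ⦃a b : E⦄ (f : a ⟶ b),
    ∃ h : F.map f ≫ θ.app b = θ.app a ≫ G.map f, θ.naturality f = eqToIso h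

/-- The category of 2-natural transformations between two 2-functors and modifications. -/
abbrev TwoNat (F G : StrictPseudofunctor E K) : Type _ :=
  ObjectProperty.FullSubcategory
    (fun θ : F.toPseudofunctor ⟶ G.toPseudofunctor => IsTwoNatural θ)

theorem paste_eqToHom [Strict K] {a b a' b' a'' b'' : K} {m : a ⟶ b} {m' : a' ⟶ b'}
    {m'' : a'' ⟶ b''} {s : a ⟶ a'} {t : b ⟶ b'} {s' : a' ⟶ a''} {t' : b' ⟶ b''}
    (h : m ≫ t = s ≫ m') (h' : m' ≫ t' = s' ≫ m'') (h'' : m ≫ t ≫ t' = (s ≫ s') ≫ m'') :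
    (α_ m t t').inv ≫ eqToHom h ▷ t' ≫ (α_ s m' t').hom ≫ s ◁ eqToHom h' ≫ (α_ s s' m'').inv =
      eqToHom h'' := by
  simp [Strict.associator_eqToIso]

theorem IsTwoNatural.comp [Strict K] {F G H : Pseudofunctor E K} {θ : F ⟶ G} {κ : G ⟶ H}
    (hθ : IsTwoNatural θ) (hκ : IsTwoNatural κ) : IsTwoNatural (θ ≫ κ) := by
  intro a b f
  obtain ⟨h, e⟩ := hθ f
  obtain ⟨h', e'⟩ := hκ f
  have h'' : F.map f ≫ θ.app b ≫ κ.app b = (θ.app a ≫ κ.app a) ≫ H.map f := by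
    rw [← Strict.assoc, h, Strict.assoc, h', Strict.assoc]
  refine ⟨h'', ?_⟩
  ext
  rw [Pseudofunctor.StrongTrans.categoryStruct_comp_naturality_hom, e, e']
  exact paste_eqToHom h h' h''

/-- Composition of 2-natural transformations. -/
def TwoNat.comp [Strict K] {F G H : StrictPseudofunctor E K} (θ : TwoNat F G) (κ : TwoNat G H) :
    TwoNat F H :=
  ⟨θ.obj ≫ κ.obj, θ.property.comp κ.property⟩

/-- Constructor for 2-natural transformations between 2-functors with values in a 2-category. -/
def TwoNat.ofApp [Strict K] {F G : StrictPseudofunctor E K} (app : ∀ a, F.obj a ⟶ G.obj a)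
    (nat : ∀ {a b : E} (f : a ⟶ b), F.map f ≫ app b = app a ≫ G.map f)
    (nat₂ : ∀ {a b : E} {f g : a ⟶ b} (η : f ⟶ g),
      F.map₂ η ▷ app b ≫ eqToHom (nat g) = eqToHom (nat f) ≫ app a ◁ G.map₂ η) :
    TwoNat F G :=
  ⟨{ app := app
     naturality := fun f => eqToIso (nat f)
     naturality_naturality := nat₂
     naturality_id := fun a => by
       rw [F.mapId_eq_eqToIso, G.mapId_eq_eqToIso]
       simp only [Strict.leftUnitor_eqToIso, Strict.rightUnitor_eqToIso, eqToIso.hom,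
         eqToIso.inv, whiskerLeft_eqToHom, eqToHom_whiskerRight, eqToHom_trans]
     naturality_comp := fun f g => by
       rw [F.mapComp_eq_eqToIso, G.mapComp_eq_eqToIso]
       simp only [Strict.associator_eqToIso, eqToIso.hom,
         eqToIso.inv, whiskerLeft_eqToHom, eqToHom_whiskerRight, eqToHom_trans] },
   fun _ _ f => ⟨nat f, rfl⟩⟩

end TwoNatural

section Strict

variable {G : Type u₁} [Bicategory.{w₁, v₁} G] {K : Type u₂} [Bicategory.{w₂, v₂} K]

theorem map₂_whiskerRight_strict (M : StrictPseudofunctor G K) {a b c : G} {f f' : a ⟶ b}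
    (η : f ⟶ f') (g : b ⟶ c) :
    M.map₂ (η ▷ g) = eqToHom (M.map_comp f g) ≫ M.map₂ η ▷ M.map g ≫
      eqToHom (M.map_comp f' g).symm := by
  rw [M.map₂_whisker_right, M.mapComp_eq_eqToIso, M.mapComp_eq_eqToIso]
  rfl

theorem map₂_whiskerLeft_strict (M : StrictPseudofunctor G K) {a b c : G} (f : a ⟶ b)
    {g g' : b ⟶ c} (η : g ⟶ g') :
    M.map₂ (f ◁ η) ≫ eqToHom (M.map_comp f g') =
      eqToHom (M.map_comp f g) ≫ M.map f ◁ M.map₂ η := by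
  rw [M.map₂_whisker_left, M.mapComp_eq_eqToIso, M.mapComp_eq_eqToIso]
  simp

end Strict

section Representable

variable {K : Type u₁} [Bicategory.{w₁, v₁} K] [Strict K]

theorem whiskerRight_id' {a b : K} {f g : a ⟶ b} (η : f ⟶ g) :
    η ▷ 𝟙 b = eqToHom (Strict.comp_id f) ≫ η ≫ eqToHom (Strict.comp_id g).symm := by
  simp [Strict.rightUnitor_eqToIso]

theorem whiskerRight_comp' {a b c d : K} {h h' : a ⟶ b} (η : h ⟶ h') (f : b ⟶ c) (g : c ⟶ d) :
    η ▷ (f ≫ g) = eqToHom (Strict.assoc h f g).symm ≫ (η ▷ f) ▷ g ≫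
      eqToHom (Strict.assoc h' f g) := by
  simp [Strict.associator_eqToIso]

theorem whiskerLeft_whiskerLeft' {a b c d : K} (h : a ⟶ b) (f : b ⟶ c) {g g' : c ⟶ d}
    (η : g ⟶ g') :
    h ◁ f ◁ η = eqToHom (Strict.assoc h f g).symm ≫ (h ≫ f) ◁ η ≫
      eqToHom (Strict.assoc h f g') := by
  simp [Strict.associator_eqToIso]

theorem whiskerLeft_whiskerRight' {a b c d : K} (h : a ⟶ b) {f f' : b ⟶ c} (η : f ⟶ f')
    (g : c ⟶ d) :
    h ◁ (η ▷ g) = eqToHom (Strict.assoc h f g).symm ≫ (h ◁ η) ▷ g ≫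
      eqToHom (Strict.assoc h f' g) := by
  simp [Strict.associator_eqToIso]

theorem whiskerLeft_whiskerLeft_eqToHom {a b c d : K} (h : a ⟶ b) (f : b ⟶ c) {g g' : c ⟶ d}
    (η : g ⟶ g') :
    h ◁ f ◁ η ≫ eqToHom (Strict.assoc h f g').symm =
      eqToHom (Strict.assoc h f g).symm ≫ (h ≫ f) ◁ η := by
  simp [Strict.associator_eqToIso]

theorem whiskerRight_comp_eqToHom {a b c d : K} {h h' : a ⟶ b} (η : h ⟶ h') (f : b ⟶ c)
    (g : c ⟶ d) :
    η ▷ (f ≫ g) ≫ eqToHom (Strict.assoc h' f g).symm =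
      eqToHom (Strict.assoc h f g).symm ≫ (η ▷ f) ▷ g := by
  simp [Strict.associator_eqToIso]

theorem cat_eqToHom_app {C D : Cat.{w₂, v₂}} {F G : C ⟶ D} (h : F = G) (x : C) :
    (eqToHom h).toNatTrans.app x =
      eqToHom (congrArg (fun T : C ⟶ D => T.toFunctor.obj x) h) := by
  subst h; rfl

/-- The representable 2-functor `K(X, -)`. -/
def corep (X : K) : StrictPseudofunctor K Cat.{w₁, v₁} :=
  StrictPseudofunctor.mk''
    { obj := fun Y => Cat.of (X ⟶ Y)
      map := fun f => (postcomp X f).toCatHom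
      map₂ := fun η => NatTrans.toCatHom₂ ((postcomposing X _ _).map η)
      map₂_id := fun f => congrArg NatTrans.toCatHom₂ ((postcomposing X _ _).map_id f)
      map₂_comp := fun η θ => congrArg NatTrans.toCatHom₂ ((postcomposing X _ _).map_comp η θ)
      map_id := by
        intro Y
        apply Cat.ext
        refine CategoryTheory.Functor.ext (fun f => Strict.comp_id f) ?_
        intro f g η
        exact whiskerRight_id' η
      map_comp := by
        intro a b c f g
        apply Cat.ext
        refine CategoryTheory.Functor.ext (fun h => (Strict.assoc h f g).symm) ?_
        intro h h' η
        exact whiskerRight_comp' η f g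
      map₂_whisker_left := by
        intro a b c f g g' η
        ext h
        rw [Cat.Hom₂.comp_app, Cat.Hom₂.comp_app, cat_eqToHom_app, cat_eqToHom_app]
        exact whiskerLeft_whiskerLeft' h f η
      map₂_whisker_right := by
        intro a b c f f' η g
        ext h
        rw [Cat.Hom₂.comp_app, Cat.Hom₂.comp_app, cat_eqToHom_app, cat_eqToHom_app]
        exact whiskerLeft_whiskerRight' h η g }

variable {E : Type u₂} [Bicategory.{w₂, v₂} E]

/-- The 2-functor `K(X, F-) : E ⥤ Cat`. -/
abbrev homTo (X : K) (F : StrictPseudofunctor E K) : StrictPseudofunctor E Cat.{w₁, v₁} :=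
  F.comp (corep X)

/-- Precomposition with `h`, as a functor `K(Y, F e) ⥤ K(X, F e)`. -/
def homToApp (F : StrictPseudofunctor E K) {X Y : K} (h : X ⟶ Y) (e : E) :
    (homTo Y F).obj e ⟶ (homTo X F).obj e :=
  (precomp (F.obj e) h).toCatHom

/-- Precomposition with a 2-cell `η`, as a natural transformation. -/
def homToApp₂ (F : StrictPseudofunctor E K) {X Y : K} {h h' : X ⟶ Y} (η : h ⟶ h') (e : E) :
    homToApp F h e ⟶ homToApp F h' e :=
  NatTrans.toCatHom₂ ((precomposing X Y (F.obj e)).map η)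

theorem homToMap_nat (F : StrictPseudofunctor E K) {X Y : K} (h : X ⟶ Y) {a b : E} (f : a ⟶ b) :
    (homTo Y F).map f ≫ homToApp F h b = homToApp F h a ≫ (homTo X F).map f := by
  apply Cat.ext
  refine CategoryTheory.Functor.ext (fun g => (Strict.assoc h g (F.map f)).symm) ?_
  intro g g' η
  exact whiskerLeft_whiskerRight' h η (F.map f)

/-- Precomposition with `h : X ⟶ Y`, as a 2-natural transformation `K(Y, F-) ⟶ K(X, F-)`. -/
def homToMap (F : StrictPseudofunctor E K) {X Y : K} (h : X ⟶ Y) :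
    TwoNat (homTo Y F) (homTo X F) :=
  TwoNat.ofApp (homToApp F h)
    (fun f => homToMap_nat F h f)
    (by
      intro a b f g η
      ext k
      rw [Cat.Hom₂.comp_app, Cat.Hom₂.comp_app, cat_eqToHom_app, cat_eqToHom_app]
      exact whiskerLeft_whiskerLeft_eqToHom h k (F.map₂ η))

/-- The modification `K(Y, F-) ⟶ K(X, F-)` given by precomposition with a 2-cell. -/
def homToMap₂ (F : StrictPseudofunctor E K) {X Y : K} {h h' : X ⟶ Y} (η : h ⟶ h') :
    (homToMap F h).obj ⟶ (homToMap F h').obj :=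
  ⟨{ app := homToApp₂ F η
     naturality := by
       intro a b f
       ext g
       rw [Cat.Hom₂.comp_app, Cat.Hom₂.comp_app]
       change _ ≫ (eqToHom (homToMap_nat F h' f)).toNatTrans.app g =
         (eqToHom (homToMap_nat F h f)).toNatTrans.app g ≫ _
       rw [cat_eqToHom_app, cat_eqToHom_app]
       exact whiskerRight_comp_eqToHom η g (F.map f) }⟩

/-- For a cone `γ : W ⟶ K(L, F-)`, the functor `K(X, L) ⥤ [E, Cat](W, K(X, F-))` which
sends `h : X ⟶ L` to the composite of `γ` with precomposition by `h`. It is 2-natural in `X`. -/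
def coneComparison {W : StrictPseudofunctor E Cat.{w₁, v₁}} {F : StrictPseudofunctor E K} {L : K}
    (γ : TwoNat W (homTo L F)) (X : K) : (X ⟶ L) ⥤ TwoNat W (homTo X F) where
  obj h := γ.comp (homToMap F h)
  map η := ObjectProperty.homMk (γ.obj ◁ homToMap₂ F η)
  map_id h := by
    apply ObjectProperty.hom_ext
    apply Pseudofunctor.StrongTrans.homCategory.ext
    intro e
    ext x
    exact id_whiskerRight h _
  map_comp η θ := by
    apply ObjectProperty.hom_ext
    apply Pseudofunctor.StrongTrans.homCategory.ext
    intro e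
    ext x
    exact comp_whiskerRight η θ _

/-- `γ` exhibits `L` as the homotopy 2-limit of `F` weighted by `W`. -/
def IsHomotopyLimitCone {W : StrictPseudofunctor E Cat.{w₁, v₁}} {F : StrictPseudofunctor E K}
    {L : K} (γ : TwoNat W (homTo L F)) : Prop :=
  ∀ X : K, (coneComparison γ X).IsEquivalence

/-- The action of a 2-functor `M` on hom-categories, as a 2-natural transformation
`G(L, F-) ⟶ K(M L, M F-)`. -/
def homToAction {G : Type u₃} [Bicategory.{w₁, v₁} G] [Strict G] (M : StrictPseudofunctor G K)
    (L : G) (F : StrictPseudofunctor E G) :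
    TwoNat (homTo L F) (homTo (M.obj L) (F.comp M)) :=
  TwoNat.ofApp (fun e => (M.mapFunctor L (F.obj e)).toCatHom)
    (by
      intro a b f
      apply Cat.ext
      refine CategoryTheory.Functor.ext (fun g => M.map_comp g (F.map f)) ?_
      intro g g' η
      exact map₂_whiskerRight_strict M η (F.map f))
    (by
      intro a b f g η
      ext k
      rw [Cat.Hom₂.comp_app, Cat.Hom₂.comp_app, cat_eqToHom_app, cat_eqToHom_app]
      exact map₂_whiskerLeft_strict M k (F.map₂ η))

/-- The image of a cone under a 2-functor. -/
def mapCone {G : Type u₃} [Bicategory.{w₁, v₁} G] [Strict G] (M : StrictPseudofunctor G K)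
    {W : StrictPseudofunctor E Cat.{w₁, v₁}} {F : StrictPseudofunctor E G} {L : G}
    (γ : TwoNat W (homTo L F)) : TwoNat W (homTo (M.obj L) (F.comp M)) :=
  γ.comp (homToAction M L F)

end Representable

section Sketches

/-- An isofibration of categories: isomorphisms out of the image lift. -/
def IsIsofibration {C : Type u₁} [Category.{v₁} C] {D : Type u₂} [Category.{v₂} D]
    (p : C ⥤ D) : Prop :=
  ∀ ⦃x : C⦄ ⦃y : D⦄ (i : p.obj x ≅ y), ∃ (x' : C) (j : x ≅ x') (h : p.obj x' = y),
    p.map j.hom ≫ eqToHom h = i.hom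

/-- A 2-functor `W : E ⥤ Cat` is cofibrant in the projective model structure on `[E, Cat]`: every
2-natural transformation out of `W` lifts through every pointwise trivial fibration (for the
standard model structure on categories: an isofibration which is an equivalence). -/
def IsCofibrant {E : Type u₁} [Bicategory.{w₁, v₁} E] (W : StrictPseudofunctor E Cat.{u, u}) :
    Prop :=
  ∀ (H K : StrictPseudofunctor E Cat.{u, u}) (p : TwoNat H K),
    (∀ e, (p.obj.app e).toFunctor.IsEquivalence ∧ IsIsofibration (p.obj.app e).toFunctor) →
    ∀ f : TwoNat W K, ∃ g : TwoNat W H, g.comp p = f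

/-- A weighted 2-cone `(E, F, W, L, γ)` in a 2-category `G`. -/
structure WeightedCone (G : Type u) [Bicategory.{u, u} G] [Strict G] where
  /-- the shape, a small 2-category -/
  E : Type u
  [bicategory : Bicategory.{u, u} E]
  [strict : Strict E]
  /-- the diagram -/
  diagram : StrictPseudofunctor E G
  /-- the weight -/
  weight : StrictPseudofunctor E Cat.{u, u}
  /-- the vertex -/
  vertex : G
  /-- the cone -/
  legs : TwoNat weight (homTo vertex diagram)

attribute [instance] WeightedCone.bicategory WeightedCone.strict

/-- A weighted limit 2-sketch: a small 2-category with a (small) set of weighted cones. -/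
structure LimitSketch where
  /-- the underlying small 2-category -/
  G : Type u
  [bicategory : Bicategory.{u, u} G]
  [strict : Strict G]
  /-- the index set of the family of cones -/
  Idx : Type u
  /-- the cones -/
  cone : Idx → WeightedCone G

attribute [instance] LimitSketch.bicategory LimitSketch.strict

namespace LimitSketch

variable (S : LimitSketch.{u})

/-- A weighted limit 2-sketch is a weighted homotopy limit 2-sketch if all its weights are
cofibrant. -/
def IsHomotopySketch : Prop :=
  ∀ i, IsCofibrant (S.cone i).weight

/-- A 2-functor `G ⥤ Cat` is a homotopy model if it sends the cones to homotopy 2-limits. -/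
def IsHomotopyModel (M : StrictPseudofunctor S.G Cat.{u, u}) : Prop :=
  ∀ i, IsHomotopyLimitCone (mapCone M (S.cone i).legs)

/-- Homotopy models of a sketch. -/
abbrev HModel : Type (u + 1) :=
  { M : StrictPseudofunctor S.G Cat.{u, u} // S.IsHomotopyModel M }

/-- The 2-category of homotopy models, pseudo-natural transformations and modifications: the full
sub-2-category of the 2-category of 2-functors `G ⥤ Cat` and pseudo-natural transformations. -/
abbrev HMod : Type (u + 1) :=
  InducedBicategory (Pseudofunctor S.G Cat.{u, u}) (fun M : S.HModel => M.1.toPseudofunctor)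

end LimitSketch

/-- A biequivalence: a pseudofunctor which is surjective on objects up to equivalence and
induces equivalences of hom-categories. -/
structure IsBiequivalence {B : Type u₁} [Bicategory.{w₁, v₁} B] {C : Type u₂}
    [Bicategory.{w₂, v₂} C] (Φ : Pseudofunctor B C) : Prop where
  essSurj : ∀ c : C, ∃ b : B, Nonempty (Bicategory.Equivalence (Φ.obj b) c)
  isEquivalence : ∀ a b : B, (Φ.mapFunctor a b).IsEquivalence

end Sketches

section Adjoin

/-- A lax square in a bicategory. -/
structure LaxSquare (B : Type u) [Bicategory.{u, u} B] where
  {src mid₁ mid₂ tgt : B}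
  u : src ⟶ mid₁
  f : mid₁ ⟶ tgt
  d : src ⟶ mid₂
  t : mid₂ ⟶ tgt
  α : u ≫ f ⟶ d ≫ t

variable {B : Type u} [Bicategory.{u, u} B]

/-- Formal composites of 1-cells of `B` and of new 1-cells `u_!`. -/
inductive PreHom : B → B → Type u
  | base {a b : B} (f : a ⟶ b) : PreHom a b
  | shriek {a b : B} (u : a ⟶ b) : PreHom b a
  | comp {a b c : B} (p : PreHom a b) (q : PreHom b c) : PreHom a c

/-- The relations between 1-cells: associativity and unit laws, the composition law of `B`, and,
if `u` already has a left adjoint in `B`, then no new 1-cell is added: `u_!` is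
the (chosen) left adjoint in `B`. -/
inductive PreHom.Rel : ∀ {a b : B}, PreHom a b → PreHom a b → Prop
  | base_comp {a b c : B} (f : a ⟶ b) (g : b ⟶ c) :
      Rel (.base (f ≫ g)) (.comp (.base f) (.base g))
  | id_comp {a b : B} (p : PreHom a b) : Rel (.comp (.base (𝟙 a)) p) p
  | comp_id {a b : B} (p : PreHom a b) : Rel (.comp p (.base (𝟙 b))) p
  | assoc {a b c d : B} (p : PreHom a b) (q : PreHom b c) (r : PreHom c d) :
      Rel (.comp (.comp p q) r) (.comp p (.comp q r))
  | shriek_eq {a b : B} (u : a ⟶ b) [IsRightAdjoint u] :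
      Rel (.shriek u) (.base (leftAdjoint u))
  | comp_left {a b c : B} (p : PreHom a b) {q q' : PreHom b c} :
      Rel q q' → Rel (.comp p q) (.comp p q')
  | comp_right {a b c : B} {p p' : PreHom a b} (q : PreHom b c) :
      Rel p p' → Rel (.comp p q) (.comp p' q)

/-- The objects of the 2-category obtained from `B` by adjoining left adjoints to all 1-cells and
inverses of the Beck-Chevalley 2-cells of the squares `sq`: they are the objects of `B`. -/
structure Adjoined {S : Type u} (sq : S → LaxSquare B) where
  /-- the object of the free 2-category given by an object of `B` -/
  of ::
  /-- the underlying object -/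
  as : B

namespace Adjoined

variable {S : Type u} (sq : S → LaxSquare B)

instance : CategoryStruct.{u} (Adjoined sq) where
  Hom a b := Quot (PreHom.Rel (a := a.as) (b := b.as))
  id a := Quot.mk _ (.base (𝟙 a.as))
  comp f g := Quot.map₂ PreHom.comp (fun p _ _ h => .comp_left p h) (fun _ _ q h => .comp_right q h) f g

variable {sq}

theorem id_comp' {a b : Adjoined sq} (f : a ⟶ b) : 𝟙 a ≫ f = f := by
  obtain ⟨p⟩ := f
  exact Quot.sound (.id_comp p)

theorem comp_id' {a b : Adjoined sq} (f : a ⟶ b) : f ≫ 𝟙 b = f := by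
  obtain ⟨p⟩ := f
  exact Quot.sound (.comp_id p)

theorem assoc' {a b c d : Adjoined sq} (f : a ⟶ b) (g : b ⟶ c) (h : c ⟶ d) :
    (f ≫ g) ≫ h = f ≫ g ≫ h := by
  obtain ⟨p⟩ := f
  obtain ⟨q⟩ := g
  obtain ⟨r⟩ := h
  exact Quot.sound (.assoc p q r)

variable (sq)

/-- The 1-cell given by a 1-cell of `B`. -/
def ι₁ {a b : B} (f : a ⟶ b) : (of a : Adjoined sq) ⟶ of b := Quot.mk _ (.base f)

/-- The adjoined left adjoint `u_!` of a 1-cell `u` of `B`. -/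
def shriek {a b : B} (u : a ⟶ b) : (of b : Adjoined sq) ⟶ of a := Quot.mk _ (.shriek u)

theorem ι₁_id (a : B) : ι₁ sq (𝟙 a) = 𝟙 (of a) := rfl

theorem ι₁_comp {a b c : B} (f : a ⟶ b) (g : b ⟶ c) :
    ι₁ sq (f ≫ g) = ι₁ sq f ≫ ι₁ sq g :=
  Quot.sound (.base_comp f g)

theorem shriek_eq {a b : B} (u : a ⟶ b) [IsRightAdjoint u] :
    shriek sq u = ι₁ sq (leftAdjoint u) :=
  Quot.sound (.shriek_eq u)

/-- Formal composites of 2-cells: the 2-cells of `B`, new unit and counit 2-cells for `u_!`,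
and a new 2-cell `u_! d ⟶ f t_!` for each square. The 2-cell
`eqTo h` is the identity of a 1-cell, regarded as a 2-cell between equal 1-cells. -/
inductive PreHom₂ : ∀ {a b : Adjoined sq}, (a ⟶ b) → (a ⟶ b) → Type u
  | eqTo {a b : Adjoined sq} {f g : a ⟶ b} (h : f = g) : PreHom₂ f g
  | comp {a b : Adjoined sq} {f g h : a ⟶ b} (η : PreHom₂ f g) (θ : PreHom₂ g h) : PreHom₂ f h
  | whiskerLeft {a b c : Adjoined sq} (f : a ⟶ b) {g h : b ⟶ c} (η : PreHom₂ g h) :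
      PreHom₂ (f ≫ g) (f ≫ h)
  | whiskerRight {a b c : Adjoined sq} {f g : a ⟶ b} (η : PreHom₂ f g) (h : b ⟶ c) :
      PreHom₂ (f ≫ h) (g ≫ h)
  | base {a b : B} {f g : a ⟶ b} (η : f ⟶ g) : PreHom₂ (ι₁ sq f) (ι₁ sq g)
  | unit {a b : B} (u : a ⟶ b) : PreHom₂ (𝟙 (of b)) (shriek sq u ≫ ι₁ sq u)
  | counit {a b : B} (u : a ⟶ b) : PreHom₂ (ι₁ sq u ≫ shriek sq u) (𝟙 (of a))
  | bcInv (s : S) :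
      PreHom₂ (shriek sq (sq s).u ≫ ι₁ sq (sq s).d) (ι₁ sq (sq s).f ≫ shriek sq (sq s).t)

variable {sq}

namespace PreHom₂

/-- The composite `u_! ⟶ u_! u u_! ⟶ u_!` (in diagrammatic order). -/
def leftTriangle {a b : B} (u : a ⟶ b) : PreHom₂ sq (shriek sq u) (shriek sq u) :=
  .comp (.eqTo (id_comp' _).symm) <| .comp (.whiskerRight (.unit u) (shriek sq u)) <|
  .comp (.eqTo (assoc' _ _ _)) <| .comp (.whiskerLeft (shriek sq u) (.counit u)) <|
  .eqTo (comp_id' _)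

/-- The composite `u ⟶ u u_! u ⟶ u` (in diagrammatic order). -/
def rightTriangle {a b : B} (u : a ⟶ b) : PreHom₂ sq (ι₁ sq u) (ι₁ sq u) :=
  .comp (.eqTo (comp_id' _).symm) <| .comp (.whiskerLeft (ι₁ sq u) (.unit u)) <|
  .comp (.eqTo (assoc' _ _ _).symm) <| .comp (.whiskerRight (.counit u) (ι₁ sq u)) <|
  .eqTo (id_comp' _)

/-- The Beck-Chevalley 2-cell of a square, i.e. the composite
`f t_! ⟶ u_! u f t_! ⟶ u_! d t t_! ⟶ u_! d` (in diagrammatic order). -/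
def bc (s : S) :
    PreHom₂ sq (ι₁ sq (sq s).f ≫ shriek sq (sq s).t) (shriek sq (sq s).u ≫ ι₁ sq (sq s).d) :=
  .comp (.eqTo (id_comp' _).symm) <|
  .comp (.whiskerRight (.unit (sq s).u) (ι₁ sq (sq s).f ≫ shriek sq (sq s).t)) <|
  .comp (.eqTo (by rw [ι₁_comp, assoc', assoc'])) <|
  .comp (.whiskerLeft (shriek sq (sq s).u) (.whiskerRight (.base (sq s).α) (shriek sq (sq s).t))) <|
  .comp (.eqTo (by rw [ι₁_comp, assoc'])) <|
  .comp (.whiskerLeft (shriek sq (sq s).u) (.whiskerLeft (ι₁ sq (sq s).d) (.counit (sq s).t))) <|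
  .eqTo (by rw [comp_id'])

/-- The relations between 2-cells: the axioms of a 2-category; the composition laws of `B`; the
triangle identities; if `u` already has a left adjoint in `B`, the unit and counit are those of `B`;
the 2-cells `bcInv` are inverse to the Beck-Chevalley 2-cells; and congruence. -/
inductive Rel : ∀ {a b : Adjoined sq} {f g : a ⟶ b}, PreHom₂ sq f g → PreHom₂ sq f g → Prop
  | id_comp {a b : Adjoined sq} {f g : a ⟶ b} (η : PreHom₂ sq f g) : Rel (.comp (.eqTo rfl) η) η
  | comp_id {a b : Adjoined sq} {f g : a ⟶ b} (η : PreHom₂ sq f g) : Rel (.comp η (.eqTo rfl)) η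
  | assoc {a b : Adjoined sq} {f g h k : a ⟶ b} (η : PreHom₂ sq f g) (θ : PreHom₂ sq g h)
      (κ : PreHom₂ sq h k) : Rel (.comp (.comp η θ) κ) (.comp η (.comp θ κ))
  | whiskerLeft_id {a b c : Adjoined sq} (f : a ⟶ b) (g : b ⟶ c) :
      Rel (.whiskerLeft f (.eqTo (rfl : g = g))) (.eqTo rfl)
  | whiskerLeft_comp {a b c : Adjoined sq} (f : a ⟶ b) {g h k : b ⟶ c} (η : PreHom₂ sq g h)
      (θ : PreHom₂ sq h k) :
      Rel (.whiskerLeft f (.comp η θ)) (.comp (.whiskerLeft f η) (.whiskerLeft f θ))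
  | id_whiskerLeft {a b : Adjoined sq} {f g : a ⟶ b} (η : PreHom₂ sq f g) :
      Rel (.whiskerLeft (𝟙 a) η) (.comp (.eqTo (id_comp' f)) (.comp η (.eqTo (id_comp' g).symm)))
  | comp_whiskerLeft {a b c d : Adjoined sq} (f : a ⟶ b) (g : b ⟶ c) {h h' : c ⟶ d}
      (η : PreHom₂ sq h h') :
      Rel (.whiskerLeft (f ≫ g) η)
        (.comp (.eqTo (assoc' f g h))
          (.comp (.whiskerLeft f (.whiskerLeft g η)) (.eqTo (assoc' f g h').symm)))
  | id_whiskerRight {a b c : Adjoined sq} (f : a ⟶ b) (g : b ⟶ c) :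
      Rel (.whiskerRight (.eqTo (rfl : f = f)) g) (.eqTo rfl)
  | comp_whiskerRight {a b c : Adjoined sq} {f g h : a ⟶ b} (η : PreHom₂ sq f g)
      (θ : PreHom₂ sq g h) (i : b ⟶ c) :
      Rel (.whiskerRight (.comp η θ) i) (.comp (.whiskerRight η i) (.whiskerRight θ i))
  | whiskerRight_id {a b : Adjoined sq} {f g : a ⟶ b} (η : PreHom₂ sq f g) :
      Rel (.whiskerRight η (𝟙 b)) (.comp (.eqTo (comp_id' f)) (.comp η (.eqTo (comp_id' g).symm)))
  | whiskerRight_comp {a b c d : Adjoined sq} {f f' : a ⟶ b} (η : PreHom₂ sq f f') (g : b ⟶ c)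
      (h : c ⟶ d) :
      Rel (.whiskerRight η (g ≫ h))
        (.comp (.eqTo (assoc' f g h).symm)
          (.comp (.whiskerRight (.whiskerRight η g) h) (.eqTo (assoc' f' g h))))
  | whisker_assoc {a b c d : Adjoined sq} (f : a ⟶ b) {g g' : b ⟶ c} (η : PreHom₂ sq g g')
      (h : c ⟶ d) :
      Rel (.whiskerRight (.whiskerLeft f η) h)
        (.comp (.eqTo (assoc' f g h))
          (.comp (.whiskerLeft f (.whiskerRight η h)) (.eqTo (assoc' f g' h).symm)))
  | whisker_exchange {a b c : Adjoined sq} {f g : a ⟶ b} {h i : b ⟶ c} (η : PreHom₂ sq f g)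
      (θ : PreHom₂ sq h i) :
      Rel (.comp (.whiskerLeft f θ) (.whiskerRight η i))
        (.comp (.whiskerRight η h) (.whiskerLeft g θ))
  | base_id {a b : B} (f : a ⟶ b) : Rel (.base (𝟙 f)) (.eqTo rfl)
  | base_comp {a b : B} {f g h : a ⟶ b} (η : f ⟶ g) (θ : g ⟶ h) :
      Rel (.base (η ≫ θ)) (.comp (.base η) (.base θ))
  | base_whiskerLeft {a b c : B} (f : a ⟶ b) {g h : b ⟶ c} (η : g ⟶ h) :
      Rel (.base (f ◁ η))
        (.comp (.eqTo (ι₁_comp sq f g))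
          (.comp (.whiskerLeft (ι₁ sq f) (.base η)) (.eqTo (ι₁_comp sq f h).symm)))
  | base_whiskerRight {a b c : B} {f g : a ⟶ b} (η : f ⟶ g) (h : b ⟶ c) :
      Rel (.base (η ▷ h))
        (.comp (.eqTo (ι₁_comp sq f h))
          (.comp (.whiskerRight (.base η) (ι₁ sq h)) (.eqTo (ι₁_comp sq g h).symm)))
  | left_triangle {a b : B} (u : a ⟶ b) : Rel (leftTriangle u) (.eqTo rfl)
  | right_triangle {a b : B} (u : a ⟶ b) : Rel (rightTriangle u) (.eqTo rfl)
  | unit_eq {a b : B} (u : a ⟶ b) [IsRightAdjoint u] :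
      Rel (.unit u)
        (.comp (.base (Adjunction.ofIsRightAdjoint u).unit)
          (.eqTo (by rw [ι₁_comp, shriek_eq])))
  | counit_eq {a b : B} (u : a ⟶ b) [IsRightAdjoint u] :
      Rel (.counit u)
        (.comp (.eqTo (by rw [ι₁_comp, shriek_eq]))
          (.base (Adjunction.ofIsRightAdjoint u).counit))
  | bc_bcInv (s : S) : Rel (.comp (bc s) (.bcInv s)) (.eqTo rfl)
  | bcInv_bc (s : S) : Rel (.comp (.bcInv s) (bc s)) (.eqTo rfl)
  | comp_left {a b : Adjoined sq} {f g h : a ⟶ b} (η : PreHom₂ sq f g) {θ θ' : PreHom₂ sq g h} :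
      Rel θ θ' → Rel (.comp η θ) (.comp η θ')
  | comp_right {a b : Adjoined sq} {f g h : a ⟶ b} {η η' : PreHom₂ sq f g} (θ : PreHom₂ sq g h) :
      Rel η η' → Rel (.comp η θ) (.comp η' θ)
  | whiskerLeft_congr {a b c : Adjoined sq} (f : a ⟶ b) {g h : b ⟶ c} {η η' : PreHom₂ sq g h} :
      Rel η η' → Rel (.whiskerLeft f η) (.whiskerLeft f η')
  | whiskerRight_congr {a b c : Adjoined sq} {f g : a ⟶ b} {η η' : PreHom₂ sq f g} (h : b ⟶ c) :
      Rel η η' → Rel (.whiskerRight η h) (.whiskerRight η' h)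

end PreHom₂

instance homCategory (a b : Adjoined sq) : Category.{u} (a ⟶ b) where
  Hom f g := Quot (PreHom₂.Rel (f := f) (g := g))
  id f := Quot.mk _ (.eqTo rfl)
  comp η θ := Quot.map₂ PreHom₂.comp (fun η _ _ h => .comp_left η h)
    (fun _ _ θ h => .comp_right θ h) η θ
  id_comp := by
    rintro f g ⟨η⟩
    exact Quot.sound (.id_comp η)
  comp_id := by
    rintro f g ⟨η⟩
    exact Quot.sound (.comp_id η)
  assoc := by
    rintro f g h k ⟨η⟩ ⟨θ⟩ ⟨κ⟩
    exact Quot.sound (.assoc η θ κ)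

theorem mk_eqTo {a b : Adjoined sq} {f g : a ⟶ b} (h : f = g) :
    (Quot.mk _ (PreHom₂.eqTo h) : f ⟶ g) = eqToHom h := by
  subst h; rfl

/-- Left whiskering of 2-cells. -/
def wl {a b c : Adjoined sq} (f : a ⟶ b) {g h : b ⟶ c} (η : g ⟶ h) : f ≫ g ⟶ f ≫ h :=
  Quot.map (PreHom₂.whiskerLeft f) (fun _ _ h => .whiskerLeft_congr f h) η

/-- Right whiskering of 2-cells. -/
def wr {a b c : Adjoined sq} {f g : a ⟶ b} (η : f ⟶ g) (h : b ⟶ c) : f ≫ h ⟶ g ≫ h :=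
  Quot.map (fun η => PreHom₂.whiskerRight η h) (fun _ _ r => .whiskerRight_congr h r) η

theorem wl_eqToHom {a b c : Adjoined sq} (f : a ⟶ b) {g h : b ⟶ c} (e : g = h) :
    wl f (eqToHom e) = eqToHom (by rw [e]) := by
  subst e
  exact Quot.sound (.whiskerLeft_id f g)

theorem wr_eqToHom {a b c : Adjoined sq} {f g : a ⟶ b} (e : f = g) (h : b ⟶ c) :
    wr (eqToHom e) h = eqToHom (by rw [e]) := by
  subst e
  exact Quot.sound (.id_whiskerRight f h)

instance : Bicategory.{u, u} (Adjoined sq) where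
  whiskerLeft f _ _ η := wl f η
  whiskerRight η h := wr η h
  associator f g h := eqToIso (assoc' f g h)
  leftUnitor f := eqToIso (id_comp' f)
  rightUnitor f := eqToIso (comp_id' f)
  whiskerLeft_id f g := Quot.sound (PreHom₂.Rel.whiskerLeft_id f g)
  whiskerLeft_comp := by
    rintro a b c f g h i ⟨η⟩ ⟨θ⟩
    exact Quot.sound (.whiskerLeft_comp f η θ)
  id_whiskerLeft := by
    rintro a b f g ⟨η⟩
    rw [eqToIso.hom, eqToIso.inv, ← mk_eqTo, ← mk_eqTo]
    exact Quot.sound (.id_whiskerLeft η)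
  comp_whiskerLeft := by
    rintro a b c d f g h h' ⟨η⟩
    rw [eqToIso.hom, eqToIso.inv, ← mk_eqTo, ← mk_eqTo]
    exact Quot.sound (.comp_whiskerLeft f g η)
  id_whiskerRight f g := Quot.sound (PreHom₂.Rel.id_whiskerRight f g)
  comp_whiskerRight := by
    rintro a b c f g h ⟨η⟩ ⟨θ⟩ i
    exact Quot.sound (.comp_whiskerRight η θ i)
  whiskerRight_id := by
    rintro a b f g ⟨η⟩
    rw [eqToIso.hom, eqToIso.inv, ← mk_eqTo, ← mk_eqTo]
    exact Quot.sound (.whiskerRight_id η)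
  whiskerRight_comp := by
    rintro a b c d f f' ⟨η⟩ g h
    rw [eqToIso.hom, eqToIso.inv, ← mk_eqTo, ← mk_eqTo]
    exact Quot.sound (.whiskerRight_comp η g h)
  whisker_assoc := by
    rintro a b c d f g g' ⟨η⟩ h
    rw [eqToIso.hom, eqToIso.inv, ← mk_eqTo, ← mk_eqTo]
    exact Quot.sound (.whisker_assoc f η h)
  whisker_exchange := by
    rintro a b c f g h i ⟨η⟩ ⟨θ⟩
    exact Quot.sound (.whisker_exchange η θ)
  pentagon f g h i := by
    simp only [eqToIso.hom, wl_eqToHom, wr_eqToHom, eqToHom_trans]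
  triangle f g := by
    simp only [eqToIso.hom, wl_eqToHom, wr_eqToHom, eqToHom_trans]

instance : Strict (Adjoined sq) where
  id_comp := id_comp'
  comp_id := comp_id'
  assoc := assoc'
  leftUnitor_eqToIso _ := rfl
  rightUnitor_eqToIso _ := rfl
  associator_eqToIso _ _ _ := rfl

variable (sq)

/-- The canonical 2-functor from `B` to the 2-category obtained by adjoining left adjoints and
inverses of Beck-Chevalley 2-cells. -/
def incl [Strict B] : StrictPseudofunctor B (Adjoined sq) :=
  StrictPseudofunctor.mk''
    { obj := of
      map := fun f => ι₁ sq f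
      map₂ := fun η => Quot.mk _ (.base η)
      map₂_id := fun f => Quot.sound (.base_id f)
      map₂_comp := fun η θ => Quot.sound (.base_comp η θ)
      map_id := fun _ => rfl
      map_comp := fun f g => ι₁_comp sq f g
      map₂_whisker_left := by
        intro a b c f g g' η
        rw [← mk_eqTo, ← mk_eqTo]
        exact Quot.sound (.base_whiskerLeft f η)
      map₂_whisker_right := by
        intro a b c f g η h
        rw [← mk_eqTo, ← mk_eqTo]
        exact Quot.sound (.base_whiskerRight η h) }

end Adjoined

end Adjoin

section Derivators

/-- A (small) category of diagrams: a family, indexed by a small set, of small categories, viewed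
as a full sub-2-category of `Cat`, with the required closure properties (up to isomorphism of
categories, with chosen representatives). -/
structure DiagramCategory where
  /-- the objects -/
  Obj : Type u
  /-- the category given by an object -/
  cat : Obj → Cat.{u, u}
  /-- the empty category -/
  empty : Obj
  emptyIso : cat empty ≅ Cat.of (Discrete PEmpty.{u + 1})
  /-- the terminal category `e` -/
  pt : Obj
  ptIso : cat pt ≅ Cat.of (Discrete PUnit.{u + 1})
  /-- the category `{0 < 1}` -/
  two : Obj
  twoIso : cat two ≅ Cat.of (ULift.{u} (Fin 2))
  /-- binary coproducts -/
  coprod : Obj → Obj → Obj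
  coprodIso : ∀ i j, cat (coprod i j) ≅ Cat.of (cat i ⊕ cat j)
  exists_pullback : ∀ {i j k : Obj} (u : cat i ⟶ cat k) (v : cat j ⟶ cat k),
    ∃ (l : Obj) (p : cat l ⟶ cat i) (q : cat l ⟶ cat j), IsPullback p q u v
  /-- the undercategory `d \ C` of `u : C ⟶ D` at `d : D`, with objects `(c, d ⟶ u c)` -/
  underCat : ∀ {i j : Obj}, (cat i ⟶ cat j) → cat j → Obj
  underIso : ∀ {i j : Obj} (u : cat i ⟶ cat j) (d : cat j),
    cat (underCat u d) ≅ Cat.of (StructuredArrow d u.toFunctor)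
  /-- the overcategory `C / d` of `u : C ⟶ D` at `d : D`, with objects `(c, u c ⟶ d)` -/
  overCat : ∀ {i j : Obj}, (cat i ⟶ cat j) → cat j → Obj
  overIso : ∀ {i j : Obj} (u : cat i ⟶ cat j) (d : cat j),
    cat (overCat u d) ≅ Cat.of (CostructuredArrow u.toFunctor d)
  /-- opposite categories -/
  op : Obj → Obj
  opIso : ∀ i, cat (op i) ≅ Cat.of (cat i)ᵒᵖ

namespace DiagramCategory

/-- The objects of the 2-category `Dia^coop`. -/
structure Coop (𝔇 : DiagramCategory.{u}) : Type u where
  /-- the object of `Dia^coop` given by an object of `Dia` -/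
  of ::
  /-- the underlying object -/
  as : 𝔇.Obj

variable {𝔇 : DiagramCategory.{u}}

/-- `Dia^coop`: 1-cells and 2-cells are reversed; so a 1-cell `j ⟶ i` is (the opposite of)
a functor `u : cat i ⥤ cat j`, and a 2-cell `op u ⟶ op v` is a natural transformation `v ⟶ u`. -/
instance : Bicategory.{u, u} 𝔇.Coop where
  Hom x y := (𝔇.cat y.as ⟶ 𝔇.cat x.as)ᵒᵖ
  id x := Opposite.op (𝟙 (𝔇.cat x.as))
  comp f g := Opposite.op (g.unop ≫ f.unop)
  homCategory x y := (inferInstance : Category (𝔇.cat y.as ⟶ 𝔇.cat x.as)ᵒᵖ)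
  whiskerLeft f _ _ η := (η.unop ▷ f.unop).op
  whiskerRight η h := (h.unop ◁ η.unop).op
  associator f g h := (α_ h.unop g.unop f.unop).op
  leftUnitor f := (ρ_ f.unop).symm.op
  rightUnitor f := (λ_ f.unop).symm.op
  whisker_exchange η θ := congrArg Quiver.Hom.op (whisker_exchange θ.unop η.unop)
  pentagon f g h i := by
    apply Quiver.Hom.unop_inj
    simp
  triangle f g := by
    apply Quiver.Hom.unop_inj
    simp


instance : Strict 𝔇.Coop where
  id_comp f := congrArg Opposite.op (Strict.comp_id f.unop)
  comp_id f := congrArg Opposite.op (Strict.id_comp f.unop)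
  assoc f g h := congrArg Opposite.op (Strict.assoc h.unop g.unop f.unop).symm
  leftUnitor_eqToIso f := by
    ext
    exact rfl
  rightUnitor_eqToIso f := by
    ext
    exact rfl
  associator_eqToIso f g h := by
    ext
    exact rfl

/-- The 1-cell of `Dia^coop` given by a functor `u`. -/
abbrev opMap {i j : 𝔇.Obj} (u : 𝔇.cat i ⟶ 𝔇.cat j) : (Coop.of j : 𝔇.Coop) ⟶ Coop.of i :=
  Opposite.op u

variable (𝔇)

/-- The functor `e ⥤ C` given by an object of `C`. -/
def const {i : 𝔇.Obj} (d : 𝔇.cat i) : 𝔇.cat 𝔇.pt ⟶ 𝔇.cat i :=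
  ((Functor.const _).obj d).toCatHom

/-- The functor `C ⥤ e`. -/
def toPt (i : 𝔇.Obj) : 𝔇.cat i ⟶ 𝔇.cat 𝔇.pt :=
  ((Functor.const _).obj (𝔇.ptIso.inv.toFunctor.obj ⟨PUnit.unit⟩)).toCatHom

/-- The inclusion of the first summand of a coproduct. -/
def inl (i j : 𝔇.Obj) : 𝔇.cat i ⟶ 𝔇.cat (𝔇.coprod i j) :=
  (Sum.inl_ (𝔇.cat i) (𝔇.cat j)).toCatHom ≫ (𝔇.coprodIso i j).inv

/-- The inclusion of the second summand of a coproduct. -/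
def inr (i j : 𝔇.Obj) : 𝔇.cat j ⟶ 𝔇.cat (𝔇.coprod i j) :=
  (Sum.inr_ (𝔇.cat i) (𝔇.cat j)).toCatHom ≫ (𝔇.coprodIso i j).inv

/-- The forgetful functor `d \ C ⥤ C`. -/
def forgetUnder {i j : 𝔇.Obj} (u : 𝔇.cat i ⟶ 𝔇.cat j) (d : 𝔇.cat j) :
    𝔇.cat (𝔇.underCat u d) ⟶ 𝔇.cat i :=
  (𝔇.underIso u d).hom ≫ (StructuredArrow.proj d u.toFunctor).toCatHom

/-- The 2-cell `α` of the square
```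
d \ C --f--> C
  |t         |u
  e ---d---> D
```
whose component at `(c, a : d ⟶ u c)` is `a`. -/
def underCell {i j : 𝔇.Obj} (u : 𝔇.cat i ⟶ 𝔇.cat j) (d : 𝔇.cat j) :
    𝔇.toPt (𝔇.underCat u d) ≫ 𝔇.const d ⟶ 𝔇.forgetUnder u d ≫ u :=
  NatTrans.toCatHom₂
    { app := fun x => ((𝔇.underIso u d).hom.toFunctor.obj x).hom
      naturality := fun x y a => by
        refine (Category.id_comp _).trans ?_
        exact (StructuredArrow.w ((𝔇.underIso u d).hom.toFunctor.map a)).symm }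

/-- The square of the Beck-Chevalley axiom for `u : C ⥤ D` and `d : D`, as a square in
`Dia^coop`. -/
def underSquare {i j : 𝔇.Obj} (u : 𝔇.cat i ⟶ 𝔇.cat j) (d : 𝔇.cat j) : LaxSquare 𝔇.Coop where
  u := opMap u
  f := opMap (𝔇.forgetUnder u d)
  d := opMap (𝔇.const d)
  t := opMap (𝔇.toPt (𝔇.underCat u d))
  α := (𝔇.underCell u d).op

end DiagramCategory

variable (𝔇 : DiagramCategory.{u})

open DiagramCategory

/-- A prederivator: a 2-functor `Dia^coop ⥤ Cat`. -/
abbrev Prederivator : Type (u + 1) := StrictPseudofunctor 𝔇.Coop Cat.{u, u}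

variable {𝔇}

/-- The Beck-Chevalley transform `t_! f^* ⟶ d^* u_!` of the image under a 2-functor `D` of a square
in `Dia^coop`, for given left adjoints `u_!` and `t_!`. -/
def beckChevalley (D : Prederivator 𝔇) (s : LaxSquare 𝔇.Coop)
    {Lu : D.obj s.mid₁ ⟶ D.obj s.src} (adju : Lu ⊣ D.map s.u)
    {Lt : D.obj s.tgt ⟶ D.obj s.mid₂} (adjt : Lt ⊣ D.map s.t) :
    D.map s.f ≫ Lt ⟶ Lu ≫ D.map s.d :=
  (mateEquiv adju adjt).symm
    ((D.mapComp s.u s.f).inv ≫ D.map₂ s.α ≫ (D.mapComp s.d s.t).hom)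

/-- The axioms of a right derivator. -/
structure IsRightDerivator (D : Prederivator 𝔇) : Prop where
  /-- `D` sends binary coproducts to products -/
  coprod : ∀ i j : 𝔇.Obj, (Functor.prod' (D.map (opMap (𝔇.inl i j))).toFunctor
    (D.map (opMap (𝔇.inr i j))).toFunctor).IsEquivalence
  /-- `D` of the empty category is terminal -/
  empty : Nonempty (D.obj (Coop.of 𝔇.empty) ≌ Discrete PUnit.{u + 1})
  /-- isomorphisms are detected pointwise -/
  isIso_iff : ∀ (i : 𝔇.Obj) ⦃x y : D.obj (Coop.of i)⦄ (f : x ⟶ y),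
    IsIso f ↔ ∀ c : 𝔇.cat i, IsIso ((D.map (opMap (𝔇.const c))).toFunctor.map f)
  /-- each `u^*` has a left adjoint `u_!` -/
  isRightAdjoint : ∀ {i j : 𝔇.Obj} (u : 𝔇.cat i ⟶ 𝔇.cat j), IsRightAdjoint (D.map (opMap u))
  /-- left Kan extensions are computed pointwise -/
  isIso_beckChevalley : ∀ {i j : 𝔇.Obj} (u : 𝔇.cat i ⟶ 𝔇.cat j) (d : 𝔇.cat j)
    {Lu : D.obj (Coop.of i) ⟶ D.obj (Coop.of j)} (adju : Lu ⊣ D.map (𝔇.underSquare u d).u)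
    {Lt : D.obj (Coop.of (𝔇.underCat u d)) ⟶ D.obj (Coop.of 𝔇.pt)}
    (adjt : Lt ⊣ D.map (𝔇.underSquare u d).t),
    IsIso (beckChevalley D (𝔇.underSquare u d) adju adjt)

/-- A pseudo-natural transformation `θ` of prederivators is cocontinuous if it
commutes with left Kan extensions: for every `u`, the Beck-Chevalley transform `u_! θ ⟶ θ u_!` of
the structural 2-isomorphism of `θ` at `u` is invertible. -/
def IsCocontinuous {D E : Prederivator 𝔇} (θ : D.toPseudofunctor ⟶ E.toPseudofunctor) : Prop :=
  ∀ ⦃x y : 𝔇.Coop⦄ (u : x ⟶ y) ⦃L : D.obj y ⟶ D.obj x⦄ (adj : L ⊣ D.map u)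
    ⦃L' : E.obj y ⟶ E.obj x⦄ (adj' : L' ⊣ E.map u),
    IsIso ((mateEquiv adj adj').symm (θ.naturality u).hom)

theorem isCocontinuous_id (D : Prederivator 𝔇) : IsCocontinuous (𝟙 D.toPseudofunctor) := by
  intro x y u L adj L' adj'
  have h : (mateEquiv adj adj').symm ((ρ_ (D.map u)).hom ≫ (λ_ (D.map u)).inv) =
      (λ_ L').hom ≫ (conjugateEquiv adj adj').symm (𝟙 _) ≫ (ρ_ L).inv := by
    simp [conjugateEquiv_symm_apply]
  have h' : IsIso ((mateEquiv adj adj').symm ((ρ_ (D.map u)).hom ≫ (λ_ (D.map u)).inv)) := by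
    rw [h]
    infer_instance
  exact h'

theorem isIso_vcomp {B : Type u₁} [Bicategory.{w₁, v₁} B] {a b c d e f : B} {g₁ : a ⟶ c}
    {g₂ : c ⟶ e} {h₁ : b ⟶ d} {h₂ : d ⟶ f} {l₁ : a ⟶ b} {l₂ : c ⟶ d} {l₃ : e ⟶ f}
    {σ : g₁ ≫ l₂ ⟶ l₁ ≫ h₁} {τ : g₂ ≫ l₃ ⟶ l₂ ≫ h₂} (hσ : IsIso σ) (hτ : IsIso τ) :
    IsIso (leftAdjointSquare.vcomp σ τ) := by
  unfold leftAdjointSquare.vcomp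
  infer_instance

theorem isCocontinuous_comp {D E F : Prederivator 𝔇} {θ : D.toPseudofunctor ⟶ E.toPseudofunctor}
    {κ : E.toPseudofunctor ⟶ F.toPseudofunctor} (hE : IsRightDerivator E)
    (hθ : IsCocontinuous θ) (hκ : IsCocontinuous κ) : IsCocontinuous (θ ≫ κ) := by
  intro x y u L adj L' adj'
  have : IsRightAdjoint (E.map u) := hE.isRightAdjoint u.unop
  let adjE := Adjunction.ofIsRightAdjoint (E.map u)
  have h₁ := hθ u adj adjE
  have h₂ := hκ u adjE adj'
  have h := mateEquiv_vcomp adj adjE adj' ((mateEquiv adj adjE).symm (θ.naturality u).hom)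
    ((mateEquiv adjE adj').symm (κ.naturality u).hom)
  rw [Equiv.apply_symm_apply, Equiv.apply_symm_apply] at h
  have e : ((θ ≫ κ).naturality u).hom =
    rightAdjointSquare.vcomp (θ.naturality u).hom (κ.naturality u).hom := rfl
  rw [e, ← h]
  erw [Equiv.symm_apply_apply]
  exact isIso_vcomp h₁ h₂

variable (𝔇)

/-- Right derivators. -/
structure RightDer where
  /-- the underlying prederivator -/
  toPrederivator : Prederivator 𝔇
  isRightDerivator : IsRightDerivator toPrederivator

variable {𝔇}

namespace RightDer

/-- 1-cells between right derivators: cocontinuous pseudo-natural transformations. -/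
structure Hom (D E : RightDer 𝔇) where
  /-- the underlying pseudo-natural transformation -/
  hom : D.toPrederivator.toPseudofunctor ⟶ E.toPrederivator.toPseudofunctor
  isCocontinuous : IsCocontinuous hom

instance : CategoryStruct (RightDer 𝔇) where
  Hom D E := Hom D E
  id D := ⟨𝟙 _, isCocontinuous_id D.toPrederivator⟩
  comp {_ E _} θ κ := ⟨θ.hom ≫ κ.hom,
    isCocontinuous_comp E.isRightDerivator θ.isCocontinuous κ.isCocontinuous⟩

/-- 2-cells between cocontinuous transformations: modifications. -/
@[ext]
structure Hom₂ {D E : RightDer 𝔇} (θ κ : D ⟶ E) where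
  /-- the underlying modification -/
  hom : θ.hom ⟶ κ.hom

instance homCategory (D E : RightDer 𝔇) : Category (D ⟶ E) where
  Hom θ κ := Hom₂ θ κ
  id θ := ⟨𝟙 θ.hom⟩
  comp η ξ := ⟨η.hom ≫ ξ.hom⟩
  id_comp η := Hom₂.ext (Category.id_comp η.hom)
  comp_id η := Hom₂.ext (Category.comp_id η.hom)
  assoc η ξ ζ := Hom₂.ext (Category.assoc η.hom ξ.hom ζ.hom)

/-- An invertible modification gives an invertible 2-cell. -/
def isoMk {D E : RightDer 𝔇} {θ κ : D ⟶ E} (e : θ.hom ≅ κ.hom) : θ ≅ κ where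
  hom := ⟨e.hom⟩
  inv := ⟨e.inv⟩
  hom_inv_id := Hom₂.ext e.hom_inv_id
  inv_hom_id := Hom₂.ext e.inv_hom_id

/-- The 2-category of right derivators, cocontinuous pseudo-natural transformations and
modifications. -/
instance : Bicategory (RightDer 𝔇) where
  homCategory := homCategory
  whiskerLeft θ _ _ η := Hom₂.mk (θ.hom ◁ Hom₂.hom η)
  whiskerRight η θ := Hom₂.mk (Hom₂.hom η ▷ θ.hom)
  associator θ κ μ := isoMk (α_ θ.hom κ.hom μ.hom)
  leftUnitor θ := isoMk (λ_ θ.hom)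
  rightUnitor θ := isoMk (ρ_ θ.hom)
  whiskerLeft_id θ κ := Hom₂.ext (whiskerLeft_id θ.hom κ.hom)
  whiskerLeft_comp θ _ _ _ η κ := Hom₂.ext (whiskerLeft_comp θ.hom η.hom κ.hom)
  id_whiskerLeft η := Hom₂.ext (id_whiskerLeft η.hom)
  comp_whiskerLeft θ κ _ _ η := Hom₂.ext (comp_whiskerLeft θ.hom κ.hom η.hom)
  id_whiskerRight θ κ := Hom₂.ext (id_whiskerRight θ.hom κ.hom)
  comp_whiskerRight η κ θ := Hom₂.ext (comp_whiskerRight η.hom κ.hom θ.hom)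
  whiskerRight_id η := Hom₂.ext (whiskerRight_id η.hom)
  whiskerRight_comp η θ κ := Hom₂.ext (whiskerRight_comp η.hom θ.hom κ.hom)
  whisker_assoc θ _ _ η κ := Hom₂.ext (whisker_assoc θ.hom η.hom κ.hom)
  whisker_exchange η κ := Hom₂.ext (whisker_exchange η.hom κ.hom)
  pentagon θ κ μ ν := Hom₂.ext (pentagon θ.hom κ.hom μ.hom ν.hom)
  triangle θ κ := Hom₂.ext (triangle θ.hom κ.hom)

end RightDer

end Derivators

section Conical

variable {J : Type u} [Category.{u} J] {B : Type u₂} [Bicategory.{w₂, v₂} B] [Strict B]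

/-- A functor from a category `J` to (the underlying category of) a 2-category, as a 2-functor on
the locally discrete 2-category given by `J`. -/
def ofFunctor (F : J ⥤ B) : StrictPseudofunctor (LocallyDiscrete J) B :=
  StrictPseudofunctor.mk''
    { obj := fun a => F.obj a.as
      map := fun f => F.map f.as
      map₂ := fun η => eqToHom (congrArg (fun f => F.map f.as) (LocallyDiscrete.eq_of_hom η))
      map_id := fun a => F.map_id a.as
      map_comp := fun f g => F.map_comp f.as g.as
      map₂_whisker_left := by
        intro a b c f g g' η
        obtain rfl := LocallyDiscrete.eq_of_hom η
        simp
      map₂_whisker_right := by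
        intro a b c f g η h
        obtain rfl := LocallyDiscrete.eq_of_hom η
        simp }

/-- The constant functor `W j ⥤ B(L, F j)` given by a 1-cell `l : L ⟶ F j`. -/
def constLeg (W : J ⥤ Cat.{w₂, v₂}) (F : J ⥤ B) {L : B} (j : LocallyDiscrete J)
    (l : L ⟶ F.obj j.as) : (ofFunctor W).obj j ⟶ (homTo L (ofFunctor F)).obj j :=
  ((Functor.const (W.obj j.as)).obj l).toCatHom

theorem constLeg_nat {L : B} {W : J ⥤ Cat.{w₂, v₂}} {F : J ⥤ B} (leg : ∀ j, L ⟶ F.obj j)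
    (w : ∀ {j j' : J} (f : j ⟶ j'), leg j ≫ F.map f = leg j') {a b : LocallyDiscrete J}
    (f : a ⟶ b) :
    (ofFunctor W).map f ≫ constLeg W F b (leg b.as) =
      constLeg W F a (leg a.as) ≫ (homTo L (ofFunctor F)).map f := by
  apply Cat.ext
  refine CategoryTheory.Functor.ext (fun _ => (w f.as).symm) ?_
  intro x y g
  have h : 𝟙 (leg b.as) = eqToHom (w f.as).symm ≫ (𝟙 (leg a.as) ▷ F.map f.as) ≫
      eqToHom (w f.as) := by
    simp
  exact h

theorem id_whisker_eqToHom {a b c d : B} {p : a ⟶ b} {q : b ⟶ d} {r : a ⟶ c} {s : c ⟶ d}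
    (h : p ≫ q = r ≫ s) : 𝟙 p ▷ q ≫ eqToHom h = eqToHom h ≫ r ◁ 𝟙 s := by
  simp

/-- The cone with legs `leg j : L ⟶ F j` such that `F f ∘ leg j = leg j'` for all `f : j ⟶ j'`,
considered as a cone with weight `W`: all the functors `W j ⥤ B(L, F j)` are constant. -/
def constCone {L : B} (W : J ⥤ Cat.{w₂, v₂}) (F : J ⥤ B) (leg : ∀ j, L ⟶ F.obj j)
    (w : ∀ {j j' : J} (f : j ⟶ j'), leg j ≫ F.map f = leg j') :
    TwoNat (ofFunctor W) (homTo L (ofFunctor F)) :=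
  TwoNat.ofApp (fun j => constLeg W F j (leg j.as))
    (fun f => constLeg_nat leg w f)
    (by
      intro a b f g η
      obtain rfl := LocallyDiscrete.eq_of_hom η
      obtain rfl : η = 𝟙 _ := Subsingleton.elim _ _
      rw [(ofFunctor W).map₂_id, (homTo L (ofFunctor F)).map₂_id]
      exact id_whisker_eqToHom (constLeg_nat leg w f))

end Conical

section DerivatorSketch

/-- The indiscrete category on a set. -/
structure Indiscrete (X : Type u) : Type u where
  /-- the underlying element -/
  as : X

instance (X : Type u) : Category.{u} (Indiscrete X) where
  Hom _ _ := PUnit.{u + 1}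
  id _ := PUnit.unit
  comp _ _ := PUnit.unit

/-- The category `{0 < 1}`. -/
abbrev walkingArrow : Cat.{u, u} := Cat.of (ULift.{u} (Fin 2))

/-- The indiscrete category on `{0, 1, c}`. -/
abbrev arrowCylinder : Cat.{u, u} := Cat.of (Indiscrete (Option (ULift.{u} (Fin 2))))

/-- The inclusion of `{0 < 1}` into the indiscrete category on `{0, 1, c}`. -/
def toArrowCylinder : walkingArrow.{u} ⟶ arrowCylinder.{u} :=
  Functor.toCatHom
    { obj := fun x => ⟨some x⟩
      map := fun _ => PUnit.unit }

/-- The weight on the category `X` with an initial object adjoined (`X` a set) which is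
the pseudomorphism classifier (a cofibrant replacement) of the weight `G` with `G ∗ = {0 < 1}` and
`G x = e` for `x` in `X`. Its value at `∗` is `{0 < 1}`; its value at `x` is obtained
from `{0 < 1}` and `e = {c}` by adjoining an isomorphism from each object of `{0 < 1}`
to `c`, compatible with `0 < 1`: it is the indiscrete category on `{0, 1, c}`. -/
def conservativeWeight (X : Type u) : WithInitial (Discrete X) ⥤ Cat.{u, u} :=
  WithInitial.lift (Z := walkingArrow) (Discrete.functor fun _ : X => arrowCylinder)
    (fun _ => toArrowCylinder) (by rintro ⟨x⟩ ⟨y⟩ ⟨⟨rfl : x = y⟩⟩; rfl)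

variable (𝔇 : DiagramCategory.{u})

open DiagramCategory

/-- The underlying 2-category of the sketch: it is obtained from `Dia^coop` by adjoining left adjoints
to all 1-cells which do not already have one, and inverses of the Beck-Chevalley 2-cells of the
squares `underSquare u d`. -/
abbrev SketchCat : Type u :=
  Adjoined (fun s : (Σ i j : 𝔇.Obj, (𝔇.cat i ⟶ 𝔇.cat j) × 𝔇.cat j) => 𝔇.underSquare s.2.2.1 s.2.2.2)

/-- The canonical 2-functor from `Dia^coop` to the underlying 2-category of the sketch. -/
abbrev sketchIncl : StrictPseudofunctor 𝔇.Coop (SketchCat 𝔇) :=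
  Adjoined.incl _

/-- The product cone on a coproduct in `Dia`. -/
def coprodCone (i j : 𝔇.Obj) : WeightedCone (SketchCat 𝔇) where
  E := LocallyDiscrete (Discrete (ULift.{u} Bool))
  diagram := ofFunctor (Discrete.functor fun b =>
    (sketchIncl 𝔇).obj (Coop.of (bif b.down then j else i)))
  weight := ofFunctor ((Functor.const _).obj (Cat.of (Discrete PUnit.{u + 1})))
  vertex := (sketchIncl 𝔇).obj (Coop.of (𝔇.coprod i j))
  legs := constCone _ _
    (fun
      | ⟨⟨false⟩⟩ => (sketchIncl 𝔇).map (opMap (𝔇.inl i j))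
      | ⟨⟨true⟩⟩ => (sketchIncl 𝔇).map (opMap (𝔇.inr i j)))
    (by
      rintro ⟨b⟩ ⟨b'⟩ ⟨⟨rfl : b = b'⟩⟩
      exact Category.comp_id _)

/-- The empty cone, with vertex the empty category. -/
def emptyCone : WeightedCone (SketchCat 𝔇) where
  E := LocallyDiscrete (Discrete PEmpty.{u + 1})
  diagram := ofFunctor (Discrete.functor PEmpty.elim)
  weight := ofFunctor ((Functor.const _).obj (Cat.of (Discrete PUnit.{u + 1})))
  vertex := (sketchIncl 𝔇).obj (Coop.of 𝔇.empty)
  legs := constCone _ _ (fun j => j.as.elim) (fun {j} => j.as.elim)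

/-- The cone expressing that isomorphisms in `D(C)` are detected by evaluation at the objects
`c` of `C`. Its shape is the set of objects of `C` with an initial object `∗` adjoined, the diagram
sends `∗` to `C` and `∗ ⟶ c` to `c : e ⥤ C`, the weight is `conservativeWeight`, the vertex is `C`,
and the leg at `∗` is the identity. -/
def conservativeCone (i : 𝔇.Obj) : WeightedCone (SketchCat 𝔇) where
  E := LocallyDiscrete (WithInitial (Discrete (𝔇.cat i)))
  diagram := ofFunctor (WithInitial.lift (Z := (sketchIncl 𝔇).obj (Coop.of i))
    (Discrete.functor fun _ : 𝔇.cat i => (sketchIncl 𝔇).obj (Coop.of 𝔇.pt))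
    (fun c => (sketchIncl 𝔇).map (opMap (𝔇.const c.as)))
    (by rintro ⟨c⟩ ⟨c'⟩ ⟨⟨rfl : c = c'⟩⟩; exact Category.comp_id _))
  weight := ofFunctor (conservativeWeight (𝔇.cat i))
  vertex := (sketchIncl 𝔇).obj (Coop.of i)
  legs := constCone _ _
    (fun
      | .star => 𝟙 ((sketchIncl 𝔇).obj (Coop.of i))
      | .of c => (sketchIncl 𝔇).map (opMap (𝔇.const c.as)))
    (by
      rintro (⟨⟨c⟩⟩ | _) (⟨⟨c'⟩⟩ | _) f
      · obtain ⟨⟨rfl : c = c'⟩⟩ := f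
        exact Category.comp_id _
      · exact f.elim
      · exact Category.id_comp _
      · exact Category.comp_id _)

/-- The index set of the family of cones of the sketch for right derivators. -/
inductive ConeIdx : Type u
  | coprod (i j : 𝔇.Obj)
  | empty
  | conservative (i : 𝔇.Obj)

/-- The sketch for right derivators. -/
def derivatorSketch : LimitSketch.{u} where
  G := SketchCat 𝔇
  Idx := ConeIdx 𝔇
  cone
    | .coprod i j => coprodCone 𝔇 i j
    | .empty => emptyCone 𝔇
    | .conservative i => conservativeCone 𝔇 i

/-- The restriction of a 2-functor on the underlying 2-category of the sketch to `Dia^coop`. -/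
def restrict (M : StrictPseudofunctor (derivatorSketch 𝔇).G Cat.{u, u}) : Prederivator 𝔇 :=
  (sketchIncl 𝔇).comp M

end DerivatorSketch

end DerivatorSketch

/-! The biequivalence is restriction itself. It works because the generators and relations adjoined
to $\mathfrak{Dia}^{coop}$ encode axioms 3 and 4, while the cones encode axioms 1 and 2.

Objects. A 2-functor preserves adjunctions and mates, so the restriction of any 2-functor on
$\mathcal G$ satisfies axioms 3 and 4. Conversely, a right derivator $D$ extends to $\mathcal G$ by
recursion on formal composites: $u_!$ goes to a chosen left adjoint of $u^*$, and the formal inverse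
goes to the inverse of the actual Beck–Chevalley transform. Where $u$ already has a left adjoint,
the choice must be the image under $D$ of the chosen one. The extension restricts to $D$ on the nose
(`ExtensionData.res_extension`). For a discrete shape with terminal weight, the homotopy limit
condition says that the legs form an equivalence onto the product. A cone for the conservative
weight amounts to an arrow $f$ of functors into $M(C)$ such that every $c^*f$ extends to an
indiscrete category, hence is invertible. The comparison functor hits only identity arrows, so it is
an equivalence exactly when such arrows are invertible (`isHomotopyLimitCone_conservativeCone_iff`).
Together these give `isRightDerivator_restrict_iff`.

Hom-categories. Compatibility of a pseudo-natural transformation with the unit of $l\dashv r$ says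
precisely that its square at $l$ is inverse to the mate of its square at $r$ (`natAlong_unit_iff`).
Hence the squares at $u_!$ are forced, and they exist exactly when the mates are invertible, which
is cocontinuity. Compatibility with counits and Beck–Chevalley inverses then follows (`extNat`). A
modification compatible with $u$ is compatible with $u_!$ because mates are natural
(`ModNat.leftAdjoint`).

Cofibrancy. Through a trivial fibration, a lift of a functor is determined by its lift on objects.
It therefore suffices to lift objects compatibly with the 1-cells of the shape; the objects of these
weights can be generated freely. -/

namespace DerivatorSketch

/-! ### Calculus of mates in a bicategory -/

section Mates

variable {B : Type u₁} [Bicategory.{w₁, v₁} B]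
variable {c d e f : B} {g : c ⟶ e} {h : d ⟶ f} {l₁ : c ⟶ d} {r₁ : d ⟶ c} {l₂ : e ⟶ f} {r₂ : f ⟶ e}
variable (adj₁ : l₁ ⊣ r₁) (adj₂ : l₂ ⊣ r₂)

/-- The two sides of the equation are the transposes of `ν` and `τ` to 2-cells `g ⟶ l₁ ≫ h ≫ r₂`,
and transposition is bijective. This form matches compatibility of naturality squares with a unit.
-/
theorem mateEquiv_eq_iff_unit (τ : g ≫ l₂ ⟶ l₁ ≫ h) (ν : r₁ ≫ g ⟶ h ≫ r₂) :
    mateEquiv adj₁ adj₂ τ = ν ↔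
      (λ_ g).inv ≫ adj₁.unit ▷ g ≫ (α_ _ _ _).hom ≫ l₁ ◁ ν =
        (ρ_ g).inv ≫ g ◁ adj₂.unit ≫ (α_ _ _ _).inv ≫ τ ▷ r₂ ≫ (α_ _ _ _).hom := by
  rw [mateEquiv_eq_iff, Adjunction.homEquiv₁_symm_apply, Adjunction.homEquiv₂_apply]
  simp only [Category.assoc]

/-- The dual transposition, to 2-cells `r₁ ≫ g ≫ l₂ ⟶ h`. With the unit form it transfers
compatibility from units to counits. -/
theorem mateEquiv_eq_iff_counit (τ : g ≫ l₂ ⟶ l₁ ≫ h) (ν : r₁ ≫ g ⟶ h ≫ r₂) :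
    mateEquiv adj₁ adj₂ τ = ν ↔
      r₁ ◁ τ ≫ (α_ _ _ _).inv ≫ adj₁.counit ▷ h ≫ (λ_ h).hom =
        (α_ _ _ _).inv ≫ ν ▷ l₂ ≫ (α_ _ _ _).hom ≫ h ◁ adj₂.counit ≫ (ρ_ h).hom := by
  have e : mateEquiv adj₁ adj₂ τ = adj₂.homEquiv₂ ((α_ _ _ _).hom ≫ adj₁.homEquiv₁ τ) := by
    rw [mateEquiv_apply', Adjunction.homEquiv₁_apply, Adjunction.homEquiv₂_apply]
    bicategory
  rw [e, ← Equiv.eq_symm_apply, Adjunction.homEquiv₁_apply, Adjunction.homEquiv₂_symm_apply,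
    ← Iso.eq_inv_comp]

/-- Mates are natural in the vertical 1-cells. -/
theorem mateEquiv_symm_naturality {g' : c ⟶ e} {h' : d ⟶ f} (γ : g ⟶ g') (δ : h ⟶ h')
    (ν : r₁ ≫ g ⟶ h ≫ r₂) (ν' : r₁ ≫ g' ⟶ h' ≫ r₂) (w : r₁ ◁ γ ≫ ν' = ν ≫ δ ▷ r₂) :
    γ ▷ l₂ ≫ (mateEquiv adj₁ adj₂).symm ν' = (mateEquiv adj₁ adj₂).symm ν ≫ l₁ ◁ δ := by
  rw [mateEquiv_symm_apply', mateEquiv_symm_apply']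
  calc
    _ = 𝟙 _ ⊗≫ ((𝟙 c) ◁ γ ≫ adj₁.unit ▷ g') ▷ l₂ ⊗≫ l₁ ◁ ν' ▷ l₂ ⊗≫
        l₁ ◁ h' ◁ adj₂.counit ⊗≫ 𝟙 _ := by bicategory
    _ = 𝟙 _ ⊗≫ adj₁.unit ▷ g ▷ l₂ ⊗≫ l₁ ◁ (r₁ ◁ γ ≫ ν') ▷ l₂ ⊗≫
        l₁ ◁ h' ◁ adj₂.counit ⊗≫ 𝟙 _ := by rw [whisker_exchange]; bicategory
    _ = 𝟙 _ ⊗≫ adj₁.unit ▷ g ▷ l₂ ⊗≫ l₁ ◁ ν ▷ l₂ ⊗≫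
        l₁ ◁ (δ ▷ (r₂ ≫ l₂) ≫ h' ◁ adj₂.counit) ⊗≫ 𝟙 _ := by rw [w]; bicategory
    _ = _ := by rw [← whisker_exchange]; bicategory

/-- The conjugate of `𝟙 r₁` is the canonical comparison of two left adjoints of `r₁`; this is the
unit form of the mate equation for it. -/
theorem unit_conjugateEquiv_symm {l₁' : c ⟶ d} (adj₁' : l₁' ⊣ r₁) :
    adj₁.unit ≫ (conjugateEquiv adj₁' adj₁).symm (𝟙 r₁) ▷ r₁ = adj₁'.unit := by
  have h := (mateEquiv_eq_iff_unit adj₁' adj₁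
    ((λ_ _).hom ≫ (conjugateEquiv adj₁' adj₁).symm (𝟙 r₁) ≫ (ρ_ _).inv)
    ((ρ_ _).hom ≫ (λ_ _).inv)).1 (by rw [conjugateEquiv_symm_apply]; simp)
  calc
    _ = 𝟙 _ ⊗≫ ((ρ_ _).inv ≫ 𝟙 _ ◁ adj₁.unit ≫ (α_ _ _ _).inv ≫
      ((λ_ _).hom ≫ (conjugateEquiv adj₁' adj₁).symm (𝟙 r₁) ≫ (ρ_ _).inv) ▷ r₁ ≫
        (α_ _ _ _).hom) ⊗≫ 𝟙 _ := by bicategory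
    _ = _ := by rw [← h]; bicategory

/-- Invertibility of a mate does not depend on the choice of the adjunctions. -/
theorem isIso_mateEquiv_symm {l₁' : c ⟶ d} {l₂' : e ⟶ f} (adj₁' : l₁' ⊣ r₁) (adj₂' : l₂' ⊣ r₂)
    (ν : r₁ ≫ g ⟶ h ≫ r₂) (hν : IsIso ((mateEquiv adj₁ adj₂).symm ν)) :
    IsIso ((mateEquiv adj₁' adj₂').symm ν) := by
  -- Changing the left adjoints changes the mate only by the comparison isomorphisms on either side.
  have key : (mateEquiv adj₁' adj₂').symm ν =
      g ◁ (conjugateEquiv adj₂ adj₂').symm (𝟙 r₂) ≫ (mateEquiv adj₁ adj₂).symm ν ≫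
        (conjugateEquiv adj₁' adj₁).symm (𝟙 r₁) ▷ h := by
    rw [Equiv.symm_apply_eq, eq_comm, mateEquiv_eq_iff_unit]
    have h₁ := (mateEquiv_eq_iff_unit adj₁ adj₂ _ _).1
      ((mateEquiv adj₁ adj₂).apply_symm_apply ν)
    symm
    calc
      _ = (ρ_ g).inv ≫ g ◁ (adj₂'.unit ≫ (conjugateEquiv adj₂ adj₂').symm (𝟙 r₂) ▷ r₂) ≫
          (α_ _ _ _).inv ≫ (mateEquiv adj₁ adj₂).symm ν ▷ r₂ ≫ (α_ _ _ _).hom ⊗≫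
          ((conjugateEquiv adj₁' adj₁).symm (𝟙 r₁) ▷ (h ≫ r₂)) := by bicategory
      _ = ((ρ_ g).inv ≫ g ◁ adj₂.unit ≫ (α_ _ _ _).inv ≫
          (mateEquiv adj₁ adj₂).symm ν ▷ r₂ ≫ (α_ _ _ _).hom) ⊗≫
          ((conjugateEquiv adj₁' adj₁).symm (𝟙 r₁) ▷ (h ≫ r₂)) := by
        rw [unit_conjugateEquiv_symm]; bicategory
      _ = 𝟙 _ ⊗≫ adj₁.unit ▷ g ⊗≫
          (l₁ ◁ ν ≫ (conjugateEquiv adj₁' adj₁).symm (𝟙 r₁) ▷ (h ≫ r₂)) := by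
        rw [← h₁]; bicategory
      _ = 𝟙 _ ⊗≫ (adj₁.unit ≫ (conjugateEquiv adj₁' adj₁).symm (𝟙 r₁) ▷ r₁) ▷ g ⊗≫ l₁' ◁ ν := by
        rw [whisker_exchange]; bicategory
      _ = _ := by rw [unit_conjugateEquiv_symm]; bicategory
  rw [key]
  infer_instance

end Mates

/-! ### Pseudo-naturality squares and their compatibility with 2-cells -/

section NaturalitySquares

variable {B : Type u₁} [Bicategory.{w₁, v₁} B] {K : Type u₂} [Bicategory.{w₂, v₂} K]
variable {M N : Pseudofunctor B K} (app : ∀ a, M.obj a ⟶ N.obj a)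

/-- A pseudo-naturality square at a 1-cell for the family `app` of 1-cells. -/
abbrev NatSquare {a b : B} (f : a ⟶ b) : Type w₂ :=
  M.map f ≫ app b ≅ app a ≫ N.map f

variable {app}

/-- Compatibility of naturality squares with a 2-cell. -/
def NatAlong {a b : B} {f g : a ⟶ b} (η : f ⟶ g) (s : NatSquare app f) (t : NatSquare app g) :
    Prop :=
  M.map₂ η ▷ app b ≫ t.hom = s.hom ≫ app a ◁ N.map₂ η

variable (app) in
/-- The naturality square at an identity. -/
def NatSquare.id (a : B) : NatSquare app (𝟙 a) :=
  whiskerRightIso (M.mapId a) (app a) ≪≫ λ_ _ ≪≫ (ρ_ _).symm ≪≫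
    whiskerLeftIso (app a) (N.mapId a).symm

/-- Pasting of naturality squares. -/
def NatSquare.comp {a b c : B} {f : a ⟶ b} {g : b ⟶ c} (s : NatSquare app f)
    (t : NatSquare app g) : NatSquare app (f ≫ g) :=
  whiskerRightIso (M.mapComp f g) (app c) ≪≫ (α_ _ _ _) ≪≫
      whiskerLeftIso (M.map f) t ≪≫ (α_ _ _ _).symm ≪≫
      whiskerRightIso s (N.map g) ≪≫ α_ _ _ _ ≪≫
      whiskerLeftIso (app a) (N.mapComp f g).symm

theorem NatSquare.comp_hom {a b c : B} {f : a ⟶ b} {g : b ⟶ c} (s : NatSquare app f)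
    (t : NatSquare app g) : (s.comp t).hom =
      (M.mapComp f g).hom ▷ app c ≫ (α_ _ _ _).hom ≫ M.map f ◁ t.hom ≫
      (α_ _ _ _).inv ≫ s.hom ▷ N.map g ≫ (α_ _ _ _).hom ≫
      app a ◁ (N.mapComp f g).inv := by
  simp [NatSquare.comp]

theorem NatSquare.id_hom (a : B) : (NatSquare.id app a).hom =
    (M.mapId a).hom ▷ app a ≫ (λ_ (app a)).hom ≫ (ρ_ (app a)).inv ≫
      app a ◁ (N.mapId a).inv := by
  simp [NatSquare.id]

theorem natAlong_id_iff {a b : B} {f : a ⟶ b} (s t : NatSquare app f) :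
    NatAlong (𝟙 f) s t ↔ s = t := by
  simp only [NatAlong, PrelaxFunctor.map₂_id, id_whiskerRight, Category.id_comp, whiskerLeft_id,
    Category.comp_id]
  exact ⟨fun h => Iso.ext h.symm, fun h => h ▸ rfl⟩

/-- Expresses transport along an equality of 1-cells as compatibility with a 2-cell, so that
well-definedness on the quotient of formal 1-cells can be proved by pasting. -/
theorem natAlong_eqToHom_iff {a b : B} {f g : a ⟶ b} (h : f = g) (s : NatSquare app f)
    (t : NatSquare app g) : NatAlong (eqToHom h) s t ↔ h ▸ s = t := by
  subst h
  exact natAlong_id_iff s t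

/-- With the whiskering lemmas and `NatAlong.inv`, this reduces compatibility with formal 2-cells to
the generators. -/
theorem NatAlong.vcomp {a b : B} {f g h : a ⟶ b} {η : f ⟶ g} {θ : g ⟶ h} {s : NatSquare app f}
    {t : NatSquare app g} {r : NatSquare app h} (h₁ : NatAlong η s t) (h₂ : NatAlong θ t r) :
    NatAlong (η ≫ θ) s r := by
  simp only [NatAlong] at *
  simp only [PrelaxFunctor.map₂_comp, comp_whiskerRight, Category.assoc, h₂, whiskerLeft_comp]
  rw [reassoc_of% h₁]

theorem NatAlong.whiskerLeft {a b c : B} {f : a ⟶ b} {g h : b ⟶ c} {η : g ⟶ h}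
    (s : NatSquare app f) {t : NatSquare app g} {r : NatSquare app h} (H : NatAlong η t r) :
    NatAlong (f ◁ η) (s.comp t) (s.comp r) := by
  simp only [NatAlong] at *
  rw [NatSquare.comp_hom, NatSquare.comp_hom, M.map₂_whisker_left, N.map₂_whisker_left]
  calc
    _ = (M.mapComp f g).hom ▷ app c ⊗≫ M.map f ◁ (M.map₂ η ▷ app c ≫ r.hom) ⊗≫
        s.hom ▷ N.map h ⊗≫ app a ◁ (N.mapComp f h).inv := by
      simp only [comp_whiskerRight, Category.assoc, inv_hom_whiskerRight_assoc]
      bicategory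
    _ = (M.mapComp f g).hom ▷ app c ⊗≫ M.map f ◁ t.hom ⊗≫ ((M.map f ≫ app b) ◁ N.map₂ η ≫
        s.hom ▷ N.map h) ⊗≫ app a ◁ (N.mapComp f h).inv := by
      rw [H]; bicategory
    _ = _ := by
      rw [whisker_exchange]
      simp only [whiskerLeft_comp, Category.assoc, whiskerLeft_inv_hom_assoc]
      bicategory

theorem NatAlong.whiskerRight {a b c : B} {f g : a ⟶ b} {h : b ⟶ c} {η : f ⟶ g}
    {s : NatSquare app f} {t : NatSquare app g} (H : NatAlong η s t) (r : NatSquare app h) :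
    NatAlong (η ▷ h) (s.comp r) (t.comp r) := by
  simp only [NatAlong] at *
  rw [NatSquare.comp_hom, NatSquare.comp_hom, M.map₂_whisker_right, N.map₂_whisker_right]
  calc
    _ = (M.mapComp f h).hom ▷ app c ⊗≫ (M.map₂ η ▷ (M.map h ≫ app c) ≫ M.map g ◁ r.hom) ⊗≫
        t.hom ▷ N.map h ⊗≫ app a ◁ (N.mapComp g h).inv := by
      simp only [comp_whiskerRight, Category.assoc, inv_hom_whiskerRight_assoc]
      bicategory
    _ = (M.mapComp f h).hom ▷ app c ⊗≫ M.map f ◁ r.hom ⊗≫ (M.map₂ η ▷ app b ≫ t.hom) ▷ N.map h ⊗≫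
        app a ◁ (N.mapComp g h).inv := by
      rw [← whisker_exchange]; bicategory
    _ = _ := by
      rw [H]
      simp only [whiskerLeft_comp, Category.assoc, whiskerLeft_inv_hom_assoc]
      bicategory

/-- Whiskering with the invertible `N.map₂ η.hom` can be cancelled. This handles the formal inverses
of the Beck–Chevalley 2-cells. -/
theorem NatAlong.inv {a b : B} {f g : a ⟶ b} {η : f ≅ g} {s : NatSquare app f}
    {t : NatSquare app g} (H : NatAlong η.hom s t) : NatAlong η.inv t s := by
  simp only [NatAlong] at *
  rw [← cancel_mono (app a ◁ N.map₂ η.hom), Category.assoc, ← H, Category.assoc,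
    ← comp_whiskerRight_assoc, ← whiskerLeft_comp, ← M.map₂_comp, ← N.map₂_comp]
  simp

theorem natAlong_associator {a b c d : B} {f : a ⟶ b} {g : b ⟶ c} {h : c ⟶ d}
    (s : NatSquare app f) (t : NatSquare app g) (r : NatSquare app h) :
    NatAlong (α_ f g h).hom ((s.comp t).comp r) (s.comp (t.comp r)) := by
  simp only [NatAlong, NatSquare.comp_hom, M.map₂_associator, N.map₂_associator]
  calc
    _ = (M.mapComp (f ≫ g) h).hom ▷ app d ⊗≫ (M.mapComp f g).hom ▷ M.map h ▷ app d ⊗≫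
        M.map f ◁ ((M.mapComp g h).inv ≫ (M.mapComp g h).hom) ▷ app d ⊗≫
        M.map f ◁ M.map g ◁ r.hom ⊗≫ M.map f ◁ t.hom ▷ N.map h ⊗≫
        (M.map f ≫ app b) ◁ (N.mapComp g h).inv ≫
        s.hom ▷ N.map (g ≫ h) ≫ (α_ _ _ _).hom ≫ app a ◁ (N.mapComp f (g ≫ h)).inv := by
      simp only [comp_whiskerRight, Category.assoc, inv_hom_whiskerRight_assoc]
      bicategory
    _ = (M.mapComp (f ≫ g) h).hom ▷ app d ⊗≫
        ((M.mapComp f g).hom ▷ (M.map h ≫ app d) ≫ (M.map f ≫ M.map g) ◁ r.hom) ⊗≫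
        M.map f ◁ t.hom ▷ N.map h ⊗≫ s.hom ▷ N.map g ▷ N.map h ⊗≫
        app a ◁ N.map f ◁ (N.mapComp g h).inv ≫ app a ◁ (N.mapComp f (g ≫ h)).inv := by
      rw [Iso.inv_hom_id, whisker_exchange_assoc]
      bicategory
    _ = (M.mapComp (f ≫ g) h).hom ▷ app d ⊗≫
        M.map (f ≫ g) ◁ r.hom ⊗≫ (M.mapComp f g).hom ▷ (app c ≫ N.map h) ⊗≫
        M.map f ◁ t.hom ▷ N.map h ⊗≫ s.hom ▷ N.map g ▷ N.map h ⊗≫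
        app a ◁ ((N.mapComp f g).inv ≫ (N.mapComp f g).hom) ▷ N.map h ⊗≫
        app a ◁ N.map f ◁ (N.mapComp g h).inv ≫ app a ◁ (N.mapComp f (g ≫ h)).inv := by
      rw [← whisker_exchange, Iso.inv_hom_id]
      bicategory
    _ = _ := by
      simp only [whiskerLeft_comp, Category.assoc, whiskerLeft_inv_hom_assoc]
      bicategory

theorem natAlong_leftUnitor {a b : B} {f : a ⟶ b} (s : NatSquare app f) :
    NatAlong (λ_ f).hom ((NatSquare.id app a).comp s) s := by
  simp only [NatAlong, NatSquare.comp_hom, NatSquare.id_hom, M.map₂_left_unitor, N.map₂_left_unitor]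
  symm
  calc
    _ = (M.mapComp (𝟙 a) f).hom ▷ app b ⊗≫ (M.map (𝟙 a) ◁ s.hom ≫
        (M.mapId a).hom ▷ (app a ≫ N.map f)) ⊗≫
        app a ◁ ((N.mapId a).inv ≫ (N.mapId a).hom) ▷ N.map f ⊗≫ 𝟙 _ := by
      simp only [whiskerLeft_comp, Category.assoc, whiskerLeft_inv_hom_assoc]
      bicategory
    _ = _ := by
      rw [whisker_exchange, Iso.inv_hom_id]
      bicategory

theorem natAlong_rightUnitor {a b : B} {f : a ⟶ b} (s : NatSquare app f) :
    NatAlong (ρ_ f).hom (s.comp (NatSquare.id app b)) s := by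
  simp only [NatAlong, NatSquare.comp_hom, NatSquare.id_hom, M.map₂_right_unitor,
    N.map₂_right_unitor]
  symm
  calc
    _ = (M.mapComp f (𝟙 b)).hom ▷ app b ⊗≫ M.map f ◁ (M.mapId b).hom ▷ app b ⊗≫
        ((M.map f ≫ app b) ◁ (N.mapId b).inv ≫ s.hom ▷ N.map (𝟙 b)) ⊗≫
        app a ◁ N.map f ◁ (N.mapId b).hom ⊗≫ 𝟙 _ := by
      simp only [whiskerLeft_comp, Category.assoc, whiskerLeft_inv_hom_assoc]
      bicategory
    _ = (M.mapComp f (𝟙 b)).hom ▷ app b ⊗≫ M.map f ◁ (M.mapId b).hom ▷ app b ⊗≫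
        s.hom ⊗≫ app a ◁ N.map f ◁ ((N.mapId b).inv ≫ (N.mapId b).hom) ⊗≫ 𝟙 _ := by
      rw [whisker_exchange]
      bicategory
    _ = _ := by
      rw [Iso.inv_hom_id]
      bicategory

/-- The key point about adjunctions: the square at a left adjoint is forced by the square at the
right adjoint. After cancelling invertible 2-cells, compatibility with the unit is the unit form of
the mate equation. -/
theorem natAlong_unit_iff {a b : B} {l : b ⟶ a} {r : a ⟶ b} (adj : l ⊣ r)
    (s : NatSquare app l) (t : NatSquare app r) :
    NatAlong adj.unit (NatSquare.id app b) (s.comp t) ↔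
      s.inv = (mateEquiv (M.mapAdjunction adj) (N.mapAdjunction adj)).symm t.hom := by
  rw [Equiv.eq_symm_apply, mateEquiv_eq_iff_unit]
  simp only [NatAlong, NatSquare.comp_hom, NatSquare.id_hom, Pseudofunctor.mapAdjunction_unit]
  -- `e₁` and `e₂` exhibit the two sides of the mate equation as the two sides of the compatibility
  -- condition, composed before and after with the same invertible 2-cells. One of these is a
  -- whiskering of `s.inv`.
  have e₁ : (λ_ (app b)).inv ≫ ((M.mapId b).inv ≫ M.map₂ adj.unit ≫ (M.mapComp l r).hom) ▷ app b ≫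
      (α_ _ _ _).hom ≫ M.map l ◁ t.hom =
      ((λ_ (app b)).inv ≫ (M.mapId b).inv ▷ app b) ≫ (M.map₂ adj.unit ▷ app b ≫
        (M.mapComp l r).hom ▷ app b ≫ (α_ _ _ _).hom ≫ M.map l ◁ t.hom ≫
      (α_ _ _ _).inv ≫ s.hom ▷ N.map r ≫ (α_ _ _ _).hom ≫
      app b ◁ (N.mapComp l r).inv) ≫ (app b ◁ (N.mapComp l r).hom ≫ (α_ _ _ _).inv ≫
        s.inv ▷ N.map r ≫ (α_ _ _ _).hom) := by
    simp
  have e₂ : (ρ_ (app b)).inv ≫ app b ◁ ((N.mapId b).inv ≫ N.map₂ adj.unit ≫ (N.mapComp l r).hom) ≫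
      (α_ _ _ _).inv ≫ s.inv ▷ N.map r ≫ (α_ _ _ _).hom =
      ((λ_ (app b)).inv ≫ (M.mapId b).inv ▷ app b) ≫ (((M.mapId b).hom ▷ app b ≫
        (λ_ (app b)).hom ≫ (ρ_ (app b)).inv ≫ app b ◁ (N.mapId b).inv) ≫
          app b ◁ N.map₂ adj.unit) ≫ (app b ◁ (N.mapComp l r).hom ≫ (α_ _ _ _).inv ≫
        s.inv ▷ N.map r ≫ (α_ _ _ _).hom) := by
    simp
  rw [e₁, e₂]
  simp only [cancel_epi, cancel_mono]

/-- The mate equation also has a counit form, so no condition beyond the one for the unit is needed.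
-/
theorem natAlong_counit {a b : B} {l : b ⟶ a} {r : a ⟶ b} (adj : l ⊣ r)
    (s : NatSquare app l) (t : NatSquare app r)
    (h : s.inv = (mateEquiv (M.mapAdjunction adj) (N.mapAdjunction adj)).symm t.hom) :
    NatAlong adj.counit (t.comp s) (NatSquare.id app a) := by
  rw [Equiv.eq_symm_apply, mateEquiv_eq_iff_counit] at h
  simp only [NatAlong, NatSquare.comp_hom, NatSquare.id_hom]
  simp only [Pseudofunctor.mapAdjunction_counit] at h
  have h' : (M.mapComp r l).inv ▷ app a ≫ M.map₂ adj.counit ▷ app a ≫ (M.mapId a).hom ▷ app a =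
      ((α_ _ _ _).hom ≫ M.map r ◁ s.hom) ≫ (M.map r ◁ s.inv ≫
        (α_ (M.map r) (M.map l) (app a)).inv ≫
        ((M.mapComp r l).inv ≫ M.map₂ adj.counit ≫ (M.mapId a).hom) ▷ app a ≫ (λ_ (app a)).hom) ≫
        (λ_ (app a)).inv := by
    simp
  have h'' : M.map₂ adj.counit ▷ app a ≫ (M.mapId a).hom ▷ app a =
    (M.mapComp r l).hom ▷ app a ≫ (M.mapComp r l).inv ▷ app a ≫
      M.map₂ adj.counit ▷ app a ≫ (M.mapId a).hom ▷ app a := by simp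
  rw [reassoc_of% h'', reassoc_of% h', reassoc_of% h]
  simp

end NaturalitySquares

/-! ### Extending transformations along the canonical 2-functor -/

section Extension

variable {B : Type u} [Bicategory.{u, u} B] {S : Type u} {sq : S → LaxSquare B}

theorem leftZigzag_eq_of_triangle {K : Type u₂} [Bicategory.{w₂, v₂} K] {a b : K} {f : a ⟶ b}
    {g : b ⟶ a} (η : 𝟙 a ⟶ f ≫ g) (ξ : g ≫ f ⟶ 𝟙 b)
    (h : (λ_ f).inv ≫ η ▷ f ≫ (α_ _ _ _).hom ≫ f ◁ ξ ≫ (ρ_ f).hom = 𝟙 f) :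
    leftZigzag η ξ = (λ_ f).hom ≫ (ρ_ f).inv := by
  calc
    _ = (λ_ f).hom ≫ ((λ_ f).inv ≫ η ▷ f ≫ (α_ _ _ _).hom ≫ f ◁ ξ ≫ (ρ_ f).hom) ≫
        (ρ_ f).inv := by bicategory
    _ = _ := by rw [h, Category.id_comp]

theorem rightZigzag_eq_of_triangle {K : Type u₂} [Bicategory.{w₂, v₂} K] {a b : K} {f : a ⟶ b}
    {g : b ⟶ a} (η : 𝟙 a ⟶ f ≫ g) (ξ : g ≫ f ⟶ 𝟙 b)
    (h : (ρ_ g).inv ≫ g ◁ η ≫ (α_ _ _ _).inv ≫ ξ ▷ g ≫ (λ_ g).hom = 𝟙 g) :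
    rightZigzag η ξ = (ρ_ g).hom ≫ (λ_ g).inv := by
  calc
    _ = (ρ_ g).hom ≫ ((ρ_ g).inv ≫ g ◁ η ≫ (α_ _ _ _).inv ≫ ξ ▷ g ≫ (λ_ g).hom) ≫
        (λ_ g).inv := by bicategory
    _ = _ := by rw [h, Category.id_comp]

/-- The rearrangement behind `natAlong_base_comp`: `s` is a square at a composite, `m` and `n` are
the compositors of the restrictions, and `m''` and `n''` are those of the 2-functors themselves.
Stating it for arbitrary 2-cells separates it from the definitional unfolding of the restriction. -/
theorem comp_eq_of_factor {K : Type u₂} [Bicategory.{w₂, v₂} K] {a b a' b' : K}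
    {x y z : a ⟶ b} {p : b ⟶ b'} {q : a ⟶ a'} {x' y' z' : a' ⟶ b'} {s : x ≫ p ⟶ q ≫ x'}
    {m : x ⟶ z} {m' : x ⟶ y} {m'' : y ⟶ z} {n : z' ⟶ x'} {n' : x' ⟶ y'} {n'' : z' ⟶ y'}
    {k₁ k₂ k₃ k₄ : a ⟶ b'} {r₁ : z ≫ p ⟶ k₁} {r₂ : k₁ ⟶ k₂} {r₃ : k₂ ⟶ k₃} {r₄ : k₃ ⟶ k₄}
    {r₅ : k₄ ⟶ q ≫ z'} (h : s = m ▷ p ≫ r₁ ≫ r₂ ≫ r₃ ≫ r₄ ≫ r₅ ≫ q ◁ n)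
    (hm : m = m' ≫ m'') (hn : n ≫ n' = n'') :
    m' ▷ p ≫ m'' ▷ p ≫ r₁ ≫ r₂ ≫ r₃ ≫ r₄ ≫ r₅ ≫ q ◁ n'' = s ≫ q ◁ n' := by
  subst hm hn h
  simp

theorem inv_comp_eq_inv_of_hom_eq {C : Type u₁} [Category.{v₁} C] {x y z : C} {i : x ≅ z}
    {j : y ≅ z} {m : x ⟶ y} (h : i.hom = m ≫ j.hom) : i.inv ≫ m = j.inv := by
  rw [Iso.inv_comp_eq, h, Category.assoc, Iso.hom_inv_id, Category.comp_id]

namespace Adjoined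

variable (sq) in
/-- The adjunction `u_! ⊣ u` in the 2-category obtained by adjoining left adjoints. -/
def shriekAdj {a b : B} (u : a ⟶ b) : shriek sq u ⊣ ι₁ sq u where
  unit := Quot.mk _ (.unit u)
  counit := Quot.mk _ (.counit u)
  left_triangle := by
    have h : (λ_ (shriek sq u)).inv ≫ (Quot.mk _ (.unit u) : 𝟙 (of b) ⟶ _) ▷ shriek sq u ≫
        (α_ _ _ _).hom ≫ shriek sq u ◁ (Quot.mk _ (.counit u) : _ ⟶ 𝟙 (of a)) ≫
          (ρ_ (shriek sq u)).hom = 𝟙 _ := by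
      simp only [Strict.leftUnitor_eqToIso, Strict.rightUnitor_eqToIso, Strict.associator_eqToIso,
        eqToIso.hom, eqToIso.inv]
      simp only [← mk_eqTo]
      exact Quot.sound (.left_triangle u)
    exact leftZigzag_eq_of_triangle _ _ h
  right_triangle := by
    have h : (ρ_ (ι₁ sq u)).inv ≫ ι₁ sq u ◁ (Quot.mk _ (.unit u) : 𝟙 (of b) ⟶ _) ≫
        (α_ _ _ _).inv ≫ (Quot.mk _ (.counit u) : _ ⟶ 𝟙 (of a)) ▷ ι₁ sq u ≫
          (λ_ (ι₁ sq u)).hom = 𝟙 _ := by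
      simp only [Strict.leftUnitor_eqToIso, Strict.rightUnitor_eqToIso, Strict.associator_eqToIso,
        eqToIso.hom, eqToIso.inv]
      simp only [← mk_eqTo]
      exact Quot.sound (.right_triangle u)
    exact rightZigzag_eq_of_triangle _ _ h

variable (sq) in
/-- The Beck-Chevalley 2-cell of a square, which is invertible. -/
def bcIso (s : S) : ι₁ sq (sq s).f ≫ shriek sq (sq s).t ≅ shriek sq (sq s).u ≫ ι₁ sq (sq s).d where
  hom := Quot.mk _ (PreHom₂.bc s)
  inv := Quot.mk _ (.bcInv s)
  hom_inv_id := Quot.sound (.bc_bcInv s)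
  inv_hom_id := Quot.sound (.bcInv_bc s)

variable {K : Type u₂} [Bicategory.{w₂, v₂} K] [Strict B]

/-- The restriction of a 2-functor along the canonical 2-functor. -/
abbrev res (M : StrictPseudofunctor (Adjoined sq) K) : StrictPseudofunctor B K :=
  (incl sq).comp M

theorem res_mapId (M : StrictPseudofunctor (Adjoined sq) K) (a : B) :
    (res M).mapId a = M.mapId (of a) := by
  rw [(res M).mapId_eq_eqToIso, M.mapId_eq_eqToIso]
  rfl

/-- `ι₁_comp` is an equality imposed by the quotient, not a definitional one, so the compositor
acquires the image of an `eqToHom`. Identities are preserved definitionally, hence the simpler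
`res_mapId`. -/
theorem res_mapComp (M : StrictPseudofunctor (Adjoined sq) K) {a b c : B} (f : a ⟶ b)
    (g : b ⟶ c) : ((res M).mapComp f g).hom =
      M.map₂ (eqToHom (ι₁_comp sq f g)) ≫ (M.mapComp (ι₁ sq f) (ι₁ sq g)).hom := by
  rw [(res M).mapComp_eq_eqToIso, M.mapComp_eq_eqToIso, PrelaxFunctor.map₂_eqToHom, eqToIso.hom,
    eqToIso.hom, eqToHom_trans]
  rfl

theorem res_mapComp_inv (M : StrictPseudofunctor (Adjoined sq) K) {a b c : B} (f : a ⟶ b)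
    (g : b ⟶ c) : ((res M).mapComp f g).inv ≫ M.map₂ (eqToHom (ι₁_comp sq f g)) =
      (M.mapComp (ι₁ sq f) (ι₁ sq g)).inv :=
  inv_comp_eq_inv_of_hom_eq (res_mapComp M f g)

variable {M N : StrictPseudofunctor (Adjoined sq) K}
  (θ : (res M).toPseudofunctor ⟶ (res N).toPseudofunctor)

/-- The components of a transformation of restricted 2-functors. -/
abbrev resApp (a : Adjoined sq) : M.toPseudofunctor.obj a ⟶ N.toPseudofunctor.obj a := θ.app a.as

/-- The naturality square of a transformation of restricted 2-functors. -/
abbrev resSq {a b : B} (f : a ⟶ b) : NatSquare (resApp θ) (ι₁ sq f) := θ.naturality f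

theorem natAlong_base {a b : B} {f g : a ⟶ b} (η : f ⟶ g) :
    NatAlong (M := M.toPseudofunctor) (N := N.toPseudofunctor) (app := resApp θ)
      (Quot.mk _ (.base η)) (resSq θ f) (resSq θ g) :=
  θ.naturality_naturality η

theorem resSq_id (a : B) : resSq θ (𝟙 a) = NatSquare.id (resApp θ) (of a) := by
  ext
  rw [NatSquare.id_hom]
  have h := Pseudofunctor.StrongTrans.naturality_id_hom θ a
  rw [res_mapId, res_mapId] at h
  exact h

theorem natAlong_base_comp {a b c : B} (f : a ⟶ b) (g : b ⟶ c) :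
    NatAlong (eqToHom (ι₁_comp sq f g)) (resSq θ (f ≫ g)) ((resSq θ f).comp (resSq θ g)) := by
  have h := Pseudofunctor.StrongTrans.naturality_comp_hom θ f g
  simp only [NatAlong, NatSquare.comp_hom]
  exact comp_eq_of_factor h (res_mapComp M f g) (res_mapComp_inv N f g)

/-- Naturality squares at two left adjoints of the same 1-cell which are determined by
the same unit agree. -/
theorem natAlong_eqToHom_of_unit {G : Type u₁} [Bicategory.{w₁, v₁} G] {M N : Pseudofunctor G K}
    {app : ∀ a, M.obj a ⟶ N.obj a} {a b : G} {l l' : b ⟶ a} {r : a ⟶ b} (adj : l ⊣ r)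
    (adj' : l' ⊣ r) (h : l = l') (hu : adj.unit ≫ eqToHom (by rw [h]) = adj'.unit)
    (s : NatSquare app l) (s' : NatSquare app l') (t : NatSquare app r)
    (hs : NatAlong adj.unit (NatSquare.id app b) (s.comp t))
    (hs' : NatAlong adj'.unit (NatSquare.id app b) (s'.comp t)) :
    NatAlong (eqToHom h) s s' := by
  subst h
  rw [eqToHom_refl, Category.comp_id] at hu
  rw [eqToHom_refl, natAlong_id_iff]
  rw [← hu, natAlong_unit_iff] at hs'
  rw [natAlong_unit_iff] at hs
  rw [← Iso.symm_eq_iff]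
  ext
  exact hs.trans hs'.symm

/-- The unit of an adjunction in `B` is a 2-cell of `B`, for which `θ` is natural by assumption. -/
theorem natAlong_base_unit {a b : B} {l : b ⟶ a} {r : a ⟶ b} (adj : l ⊣ r) :
    NatAlong ((incl sq).mapAdjunction adj).unit (NatSquare.id (resApp θ) (of b))
      ((resSq θ l).comp (resSq θ r)) := by
  rw [StrictPseudofunctor.mapAdjunction_unit', ← resSq_id]
  exact ((natAlong_id_iff _ _).2 rfl).vcomp ((natAlong_base θ adj.unit).vcomp
    (natAlong_base_comp θ l r))

theorem unit_shriekAdj {a b : B} (v : a ⟶ b) [IsRightAdjoint v] :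
    (shriekAdj sq v).unit ≫ eqToHom (by rw [shriek_eq]; rfl) =
      ((incl sq).mapAdjunction (Adjunction.ofIsRightAdjoint v)).unit := by
  have h : (shriekAdj sq v).unit =
      (incl sq).map₂ (Adjunction.ofIsRightAdjoint v).unit ≫ eqToHom _ :=
    (Quot.sound (.unit_eq v)).trans (congrArg (fun k => (incl sq).map₂ _ ≫ k) (mk_eqTo _))
  rw [StrictPseudofunctor.mapAdjunction_unit', h]
  refine (Category.assoc _ _ _).trans ?_
  exact (congrArg (fun k => (incl sq).map₂ _ ≫ k) (eqToHom_trans _ _)).trans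
    (Category.id_comp _).symm

/-- The Beck-Chevalley transforms of the naturality squares of `θ` at all 1-cells are invertible. -/
def HasInvertibleMates : Prop :=
  ∀ ⦃a b : B⦄ (v : a ⟶ b), IsIso ((mateEquiv (M.mapAdjunction (shriekAdj sq v))
    (N.mapAdjunction (shriekAdj sq v))).symm (resSq θ v).hom)

variable {θ} (hθ : HasInvertibleMates θ)

/-- The naturality square of the extension of `θ` at `u_!`. -/
noncomputable def shriekSq {a b : B} (v : a ⟶ b) : NatSquare (resApp θ) (shriek sq v) :=
  have := hθ v
  (asIso ((mateEquiv (M.mapAdjunction (shriekAdj sq v))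
    (N.mapAdjunction (shriekAdj sq v))).symm (resSq θ v).hom)).symm

theorem shriekSq_inv {a b : B} (v : a ⟶ b) : (shriekSq hθ v).inv =
    (mateEquiv (M.mapAdjunction (shriekAdj sq v))
    (N.mapAdjunction (shriekAdj sq v))).symm (resSq θ v).hom :=
  rfl

/-- The naturality square of the extension of `θ` at a formal composite. -/
noncomputable def preSq : ∀ {a b : B} (p : PreHom a b),
    NatSquare (resApp θ) (Quot.mk _ p : (of a : Adjoined sq) ⟶ of b)
  | _, _, .base f => resSq θ f
  | _, _, .shriek v => shriekSq hθ v
  | _, _, .comp p q => (preSq p).comp (preSq q)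

theorem natAlong_of_rel {a b : B} {p q : PreHom a b} (h : PreHom.Rel p q) :
    NatAlong (eqToHom (Quot.sound h)) (preSq hθ p) (preSq hθ q) := by
  induction h with
  | base_comp f g => exact natAlong_base_comp θ f g
  | id_comp p =>
    have h := natAlong_leftUnitor (preSq hθ p)
    rw [← resSq_id] at h
    exact h
  | comp_id p =>
    have h := natAlong_rightUnitor (preSq hθ p)
    rw [← resSq_id] at h
    exact h
  | assoc p q r => exact natAlong_associator (preSq hθ p) (preSq hθ q) (preSq hθ r)
  -- Both squares are determined by compatibility with a unit, and the relation `unit_eq` identifies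
  -- the two units.
  | shriek_eq v =>
    refine natAlong_eqToHom_of_unit (shriekAdj sq v)
      ((incl sq).mapAdjunction (Adjunction.ofIsRightAdjoint v)) _ ?_ _ _ (resSq θ v)
      ((natAlong_unit_iff _ _ _).2 (shriekSq_inv hθ v)) (natAlong_base_unit θ _)
    exact unit_shriekAdj v
  | comp_left p h ih =>
    have h := ih.whiskerLeft (preSq hθ p)
    rw [whiskerLeft_eqToHom] at h
    exact h
  | comp_right q h ih =>
    have h := ih.whiskerRight (preSq hθ q)
    rw [eqToHom_whiskerRight] at h
    exact h

/-- The naturality squares of the extension of `θ`. -/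
noncomputable def extSq {a b : Adjoined sq} (f : a ⟶ b) : NatSquare (resApp θ) f :=
  Quot.rec (motive := fun f : a ⟶ b => NatSquare (resApp θ) f) (fun p => preSq hθ p)
    (fun _ _ h => (natAlong_eqToHom_iff _ _ _).1 (natAlong_of_rel hθ h)) f

theorem extSq_comp {a b c : Adjoined sq} (f : a ⟶ b) (g : b ⟶ c) :
    extSq hθ (f ≫ g) = (extSq hθ f).comp (extSq hθ g) := by
  obtain ⟨p⟩ := f
  obtain ⟨q⟩ := g
  rfl

theorem extSq_id (a : Adjoined sq) : extSq hθ (𝟙 a) = NatSquare.id (resApp θ) a :=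
  resSq_id θ a.as

/-- Compatibility of the extension of `θ` with a formal 2-cell. -/
abbrev ExtNat {a b : Adjoined sq} {f g : a ⟶ b} (η : PreHom₂ sq f g) : Prop :=
  NatAlong (Quot.mk _ η : f ⟶ g) (extSq hθ f) (extSq hθ g)

variable {hθ}

theorem extNat_eqTo {a b : Adjoined sq} {f g : a ⟶ b} (h : f = g) : ExtNat hθ (.eqTo h) := by
  subst h
  exact (natAlong_id_iff _ _).2 rfl

theorem ExtNat.comp {a b : Adjoined sq} {f g h : a ⟶ b} {η : PreHom₂ sq f g} {κ : PreHom₂ sq g h}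
    (h₁ : ExtNat hθ η) (h₂ : ExtNat hθ κ) : ExtNat hθ (.comp η κ) :=
  NatAlong.vcomp h₁ h₂

theorem ExtNat.whiskerLeft {a b c : Adjoined sq} (f : a ⟶ b) {g h : b ⟶ c} {η : PreHom₂ sq g h}
    (h₁ : ExtNat hθ η) : ExtNat hθ (.whiskerLeft f η) := by
  unfold ExtNat
  rw [extSq_comp, extSq_comp]
  exact NatAlong.whiskerLeft _ h₁

theorem ExtNat.whiskerRight {a b c : Adjoined sq} {f g : a ⟶ b} {η : PreHom₂ sq f g}
    (h₁ : ExtNat hθ η) (h : b ⟶ c) : ExtNat hθ (.whiskerRight η h) := by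
  unfold ExtNat
  rw [extSq_comp, extSq_comp]
  exact NatAlong.whiskerRight h₁ _

theorem extNat_base {a b : B} {f g : a ⟶ b} (η : f ⟶ g) : ExtNat hθ (.base η) :=
  natAlong_base θ η

theorem extNat_unit {a b : B} (v : a ⟶ b) : ExtNat hθ (.unit v) := by
  unfold ExtNat
  rw [extSq_id, extSq_comp]
  exact (natAlong_unit_iff (shriekAdj sq v) _ _).2 (shriekSq_inv hθ v)

theorem extNat_counit {a b : B} (v : a ⟶ b) : ExtNat hθ (.counit v) := by
  unfold ExtNat
  rw [extSq_id, extSq_comp]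
  exact natAlong_counit (shriekAdj sq v) _ _ (shriekSq_inv hθ v)

/-- The formal Beck–Chevalley 2-cell is assembled from units, counits and 2-cells of `B`, for which
compatibility is known. -/
theorem extNat_bc (s : S) : ExtNat hθ (PreHom₂.bc s) :=
  (extNat_eqTo _).comp <| ((extNat_unit _).whiskerRight _).comp <| (extNat_eqTo _).comp <|
    (((extNat_base _).whiskerRight _).whiskerLeft _).comp <| (extNat_eqTo _).comp <|
    (((extNat_counit _).whiskerLeft _).whiskerLeft _).comp <| extNat_eqTo _

/-- Compatibility is a property of a 2-cell, so only generators and operations are treated; the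
relations between formal 2-cells play no role. -/
theorem extNat {a b : Adjoined sq} {f g : a ⟶ b} (η : PreHom₂ sq f g) : ExtNat hθ η := by
  induction η with
  | eqTo h => exact extNat_eqTo h
  | comp _ _ h₁ h₂ => exact h₁.comp h₂
  | whiskerLeft f _ h => exact h.whiskerLeft f
  | whiskerRight _ f h => exact h.whiskerRight f
  | base η => exact extNat_base η
  | unit v => exact extNat_unit v
  | counit v => exact extNat_counit v
  | bcInv s => exact NatAlong.inv (η := bcIso sq s) (extNat_bc s)

variable (hθ)

/-- The extension of a transformation with invertible mates of restricted 2-functors. -/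
noncomputable def extend : M.toPseudofunctor ⟶ N.toPseudofunctor where
  app := resApp θ
  naturality f := extSq hθ f
  naturality_naturality := by
    rintro a b f g ⟨η⟩
    exact extNat η
  naturality_id a := by
    rw [extSq_id, NatSquare.id_hom]
    simp
  naturality_comp f g := by
    rw [extSq_comp, NatSquare.comp_hom]
    simp

end Adjoined

end Extension

/-! ### Restricting transformations, and extending modifications -/

section Restriction

variable {B : Type u} [Bicategory.{u, u} B] [Strict B] {S : Type u} {sq : S → LaxSquare B}
variable {K : Type u₂} [Bicategory.{w₂, v₂} K]

theorem strongTrans_naturality_comp {G : Type u₁} [Bicategory.{w₁, v₁} G] {M N : Pseudofunctor G K}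
    (θ : M ⟶ N) {a b c : G} (f : a ⟶ b) (g : b ⟶ c) :
    θ.naturality (f ≫ g) = NatSquare.comp (app := θ.app) (θ.naturality f) (θ.naturality g) :=
  θ.naturality_comp_iso f g

theorem strongTrans_naturality_id {G : Type u₁} [Bicategory.{w₁, v₁} G] {M N : Pseudofunctor G K}
    (θ : M ⟶ N) (a : G) : θ.naturality (𝟙 a) = NatSquare.id θ.app a :=
  θ.naturality_id_iso a

/-- The naturality square of a pseudo-natural transformation at a left adjoint is the inverse of the
mate of the naturality square at the right adjoint. -/
theorem strongTrans_naturality_inv_leftAdjoint {G : Type u₁} [Bicategory.{w₁, v₁} G]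
    {M N : Pseudofunctor G K} (θ : M ⟶ N) {a b : G} {l : b ⟶ a} {r : a ⟶ b} (adj : l ⊣ r) :
    (θ.naturality l).inv = (mateEquiv (M.mapAdjunction adj) (N.mapAdjunction adj)).symm
      (θ.naturality r).hom := by
  refine (natAlong_unit_iff (app := θ.app) adj (θ.naturality l) (θ.naturality r)).1 ?_
  rw [← strongTrans_naturality_comp, ← strongTrans_naturality_id]
  exact θ.naturality_naturality adj.unit

/-- The condition that a family of 2-cells is compatible with naturality squares at a 1-cell. -/
def ModNat {G : Type u₁} [Bicategory.{w₁, v₁} G] {M N : Pseudofunctor G K} (θ κ : M ⟶ N)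
    (γ : ∀ a, θ.app a ⟶ κ.app a) {a b : G} (f : a ⟶ b) : Prop :=
  M.map f ◁ γ b ≫ (κ.naturality f).hom = (θ.naturality f).hom ≫ γ a ▷ N.map f

section ModNat

variable {G : Type u₁} [Bicategory.{w₁, v₁} G] {M N : Pseudofunctor G K} {θ κ : M ⟶ N}
  {γ : ∀ a, θ.app a ⟶ κ.app a}

theorem ModNat.comp {a b c : G} {f : a ⟶ b} {g : b ⟶ c} (hf : ModNat θ κ γ f)
    (hg : ModNat θ κ γ g) : ModNat θ κ γ (f ≫ g) := by
  unfold ModNat at *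
  rw [θ.naturality_comp_hom, κ.naturality_comp_hom]
  calc
    _ = (M.map (f ≫ g) ◁ γ c ≫ (M.mapComp f g).hom ▷ κ.app c) ⊗≫
        M.map f ◁ (κ.naturality g).hom ⊗≫ (κ.naturality f).hom ▷ N.map g ⊗≫
        κ.app a ◁ (N.mapComp f g).inv := by bicategory
    _ = (M.mapComp f g).hom ▷ θ.app c ⊗≫ M.map f ◁ (M.map g ◁ γ c ≫ (κ.naturality g).hom) ⊗≫
        (κ.naturality f).hom ▷ N.map g ⊗≫ κ.app a ◁ (N.mapComp f g).inv := by
      rw [whisker_exchange]; bicategory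
    _ = (M.mapComp f g).hom ▷ θ.app c ⊗≫ M.map f ◁ (θ.naturality g).hom ⊗≫
        (M.map f ◁ γ b ≫ (κ.naturality f).hom) ▷ N.map g ⊗≫ κ.app a ◁ (N.mapComp f g).inv := by
      rw [hg]; bicategory
    _ = (M.mapComp f g).hom ▷ θ.app c ⊗≫ M.map f ◁ (θ.naturality g).hom ⊗≫
        (θ.naturality f).hom ▷ N.map g ⊗≫
        (γ a ▷ (N.map f ≫ N.map g) ≫ κ.app a ◁ (N.mapComp f g).inv) := by
      rw [hf]; bicategory
    _ = _ := by
      rw [← whisker_exchange]; bicategory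

/-- The squares at `l` are inverse to the mates of the squares at `r`, and mates are natural in the
vertical 1-cells. -/
theorem ModNat.leftAdjoint {a b : G} {l : b ⟶ a} {r : a ⟶ b} (adj : l ⊣ r)
    (h : ModNat θ κ γ r) : ModNat θ κ γ l := by
  unfold ModNat at *
  have := mateEquiv_symm_naturality (M.mapAdjunction adj) (N.mapAdjunction adj) (γ b) (γ a)
    (θ.naturality r).hom (κ.naturality r).hom h
  rw [← strongTrans_naturality_inv_leftAdjoint, ← strongTrans_naturality_inv_leftAdjoint] at this
  rw [← Iso.eq_comp_inv, Category.assoc, this, Iso.hom_inv_id_assoc]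

end ModNat

namespace Adjoined

variable {M N : StrictPseudofunctor (Adjoined sq) K}

/-- The rearrangement for `resTrans`: `s` is the square at the image of a composite and `t` the
square at the composite of the images. The hypothesis `hs` is naturality along the `eqToHom` joining
them. -/
theorem comp_eq_of_factor' {a b a' b' : K}
    {x y z : a ⟶ b} {p : b ⟶ b'} {q : a ⟶ a'} {x' y' z' : a' ⟶ b'} {s : x ≫ p ⟶ q ≫ x'}
    {t : y ≫ p ⟶ q ≫ y'}
    {m : x ⟶ z} {m' : x ⟶ y} {m'' : y ⟶ z} {n : x' ⟶ z'} {n' : x' ⟶ y'} {n'' : y' ⟶ z'}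
    {r : z ≫ p ⟶ q ≫ z'} (h : t ≫ q ◁ n'' = m'' ▷ p ≫ r) (hm : m = m' ≫ m'') (hn : n = n' ≫ n'')
    (hs : m' ▷ p ≫ t = s ≫ q ◁ n') :
    s ≫ q ◁ n = m ▷ p ≫ r := by
  subst hm hn
  rw [whiskerLeft_comp, ← reassoc_of% hs, h, comp_whiskerRight_assoc]

/-- The restriction of a pseudo-natural transformation along the canonical 2-functor. -/
def resTrans (θ : M.toPseudofunctor ⟶ N.toPseudofunctor) :
    (res M).toPseudofunctor ⟶ (res N).toPseudofunctor where
  app a := θ.app (of a)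
  naturality f := θ.naturality (ι₁ sq f)
  naturality_naturality η := θ.naturality_naturality ((incl sq).map₂ η)
  naturality_id a := by
    rw [res_mapId, res_mapId]
    exact θ.naturality_id (of a)
  naturality_comp f g :=
    comp_eq_of_factor' (θ.naturality_comp (ι₁ sq f) (ι₁ sq g)) (res_mapComp M f g)
      (res_mapComp N f g) (θ.naturality_naturality (eqToHom (ι₁_comp sq f g)))

/-- The restriction of a modification along the canonical 2-functor. -/
def resMod {θ κ : M.toPseudofunctor ⟶ N.toPseudofunctor} (Γ : θ ⟶ κ) :
    resTrans θ ⟶ resTrans κ :=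
  ⟨{ app := fun a => Γ.as.app (of a)
     naturality := fun f => Γ.as.naturality (ι₁ sq f) }⟩

/-- The mate in question is the inverse of the naturality isomorphism at `shriek sq v`. -/
theorem hasInvertibleMates_resTrans (θ : M.toPseudofunctor ⟶ N.toPseudofunctor) :
    HasInvertibleMates (resTrans θ) := by
  intro a b v
  have h := strongTrans_naturality_inv_leftAdjoint θ (shriekAdj sq v)
  have h' : IsIso (θ.naturality (shriek sq v)).inv := inferInstance
  rw [h] at h'
  exact h'

/-- The modification condition is a property of 1-cells closed under composition, so it suffices to
check generators; at the adjoined ones it follows by taking mates. -/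
theorem modNat_of_resTrans {θ κ : M.toPseudofunctor ⟶ N.toPseudofunctor}
    (Γ : resTrans θ ⟶ resTrans κ) {a b : B} (p : PreHom a b) :
    ModNat θ κ (fun a => Γ.as.app a.as) (Quot.mk _ p : (of a : Adjoined sq) ⟶ of b) := by
  induction p with
  | base f => exact Γ.as.naturality f
  | shriek v => exact ModNat.leftAdjoint (shriekAdj sq v) (Γ.as.naturality v)
  | comp p q hp hq => exact ModNat.comp hp hq

/-- The extension of a modification between restricted transformations. -/
def extMod {θ κ : M.toPseudofunctor ⟶ N.toPseudofunctor} (Γ : resTrans θ ⟶ resTrans κ) :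
    θ ⟶ κ :=
  ⟨{ app := fun a => Γ.as.app a.as
     naturality := by
       rintro a b ⟨p⟩
       exact modNat_of_resTrans Γ p }⟩

end Adjoined

end Restriction

/-! ### Extending 2-functors to the 2-category with adjoined left adjoints -/

section Universal

theorem prelaxFunctor_ext {B : Type u₁} [Bicategory.{w₁, v₁} B] {K : Type u₂}
    [Bicategory.{w₂, v₂} K] {F G : PrelaxFunctor B K} (h : F.toPrefunctor = G.toPrefunctor)
    (h₂ : ∀ {a b : B} (f g : a ⟶ b) (η : f ⟶ g), HEq (F.map₂ η) (G.map₂ η)) : F = G := by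
  obtain ⟨⟨F, F₂⟩, _, _⟩ := F
  obtain ⟨⟨G, G₂⟩, _, _⟩ := G
  obtain rfl : F = G := h
  obtain rfl : @F₂ = @G₂ := by
    funext a b f g η
    exact eq_of_heq (h₂ f g η)
  rfl

/-- The unit and composition isomorphisms of a strict pseudofunctor are prescribed `eqToIso`s, so
they carry no data. -/
theorem strictPseudofunctor_ext {B : Type u₁} [Bicategory.{w₁, v₁} B] {K : Type u₂}
    [Bicategory.{w₂, v₂} K] {F G : StrictPseudofunctor B K}
    (h : F.toPrelaxFunctor = G.toPrelaxFunctor) : F = G := by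
  obtain ⟨⟨⟨F, i, c, _, _, _, _, _⟩, hi, hi'⟩, hc, hc'⟩ := F
  obtain ⟨⟨⟨G, i', c', _, _, _, _, _⟩, ki, ki'⟩, kc, kc'⟩ := G
  obtain rfl : F = G := h
  obtain rfl : @i = @i' := by
    funext a
    exact (hi' a).trans (ki' a).symm
  obtain rfl : @c = @c' := by
    funext a b d f g
    exact (hc' f g).trans (kc' f g).symm
  rfl

variable {B : Type u} [Bicategory.{u, u} B] [Strict B] {S : Type u} (sq : S → LaxSquare B)
variable {K : Type u₂} [Bicategory.{w₂, v₂} K] [Strict K]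

section EqToHom

variable {C : Type u₁} [Category.{v₁} C]

theorem eqToHom_conj_eq_id {a b c d e : C} {f : b ⟶ c} {h : c = d} {g : d ⟶ e} {h' : b = e}
    (H : f ≫ eqToHom h ≫ g = eqToHom h') (i : a = b) (j : e = a) :
    eqToHom i ≫ f ≫ eqToHom h ≫ g ≫ eqToHom j = 𝟙 a := by
  subst i j h
  rw [eqToHom_refl, Category.id_comp] at H
  simp [H]

theorem eqToHom_conj_eq_id' {a b c : C} {f : b ⟶ c} {g : c ⟶ b}
    (H : f ≫ g = 𝟙 b) (i : a = b) (j : b = a) :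
    eqToHom i ≫ f ≫ g ≫ eqToHom j = 𝟙 a := by
  subst i
  simp [H]

theorem eqToHom_conj_comp_eqToHom {a b c d e : C} (f : b ⟶ c) (h : a = b) (i : c = d) (j : d = e) :
    (eqToHom h ≫ f ≫ eqToHom i) ≫ eqToHom j = eqToHom h ≫ f ≫ eqToHom (i.trans j) := by
  simp

theorem eqToHom_comp_eqToHom_conj {a b c d e : C} (f : c ⟶ d) (h : a = b) (i : b = c) (j : d = e) :
    eqToHom h ≫ eqToHom i ≫ f ≫ eqToHom j = eqToHom (h.trans i) ≫ f ≫ eqToHom j := by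
  simp

end EqToHom

theorem whiskerLeft_eq_of_eq {a b c : K} {x y : a ⟶ b} (h : x = y) {f g : b ⟶ c}
    (η : f ⟶ g) : x ◁ η = eqToHom (by rw [h]) ≫ y ◁ η ≫ eqToHom (by rw [h]) := by
  subst h; simp

theorem whiskerRight_eq_of_eq {a b c : K} {x y : b ⟶ c} (h : x = y) {f g : a ⟶ b}
    (η : f ⟶ g) : η ▷ x = eqToHom (by rw [h]) ≫ η ▷ y ≫ eqToHom (by rw [h]) := by
  subst h; simp

theorem adjunction_left_triangle_strict {a b : K} {l : a ⟶ b} {r : b ⟶ a} (adj : l ⊣ r) :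
    adj.unit ▷ l ≫ eqToHom (Strict.assoc l r l) ≫ l ◁ adj.counit =
      eqToHom ((Strict.id_comp l).trans (Strict.comp_id l).symm) := by
  have h := adj.left_triangle
  simpa [leftZigzag, bicategoricalComp, Strict.leftUnitor_eqToIso, Strict.rightUnitor_eqToIso,
    Strict.associator_eqToIso, -Bicategory.Adjunction.left_triangle] using h

theorem adjunction_right_triangle_strict {a b : K} {l : a ⟶ b} {r : b ⟶ a} (adj : l ⊣ r) :
    r ◁ adj.unit ≫ eqToHom (Strict.assoc r l r).symm ≫ adj.counit ▷ r =
      eqToHom ((Strict.comp_id r).trans (Strict.id_comp r).symm) := by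
  have h := adj.right_triangle
  simpa [rightZigzag, bicategoricalComp, Strict.leftUnitor_eqToIso, Strict.rightUnitor_eqToIso,
    Strict.associator_eqToIso, -Bicategory.Adjunction.right_triangle] using h

/-- The explicit pasting has the shape of `PreHom₂.bc`. The boundary of `ξ` is only equal to the
composites, which accommodates both `D.map (u ≫ f)` and `ι₁ sq (u ≫ f)`. -/
theorem mateEquiv_symm_strict {a b c d : K} {u : a ⟶ b} {f : b ⟶ d} {v : a ⟶ c} {t : c ⟶ d}
    {l : b ⟶ a} {m : d ⟶ c} (adj : l ⊣ u) (adj' : m ⊣ t) {x y : a ⟶ d} (hx : x = u ≫ f)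
    (hy : y = v ≫ t) (ξ : x ⟶ y) :
    (mateEquiv adj adj').symm (eqToHom hx.symm ≫ ξ ≫ eqToHom hy) =
      eqToHom (Strict.id_comp _).symm ≫ adj.unit ▷ (f ≫ m) ≫
        eqToHom (by rw [hx]; simp only [Strict.assoc]) ≫ l ◁ ξ ▷ m ≫
        eqToHom (by rw [hy]; simp only [Strict.assoc]) ≫ l ◁ v ◁ adj'.counit ≫
        eqToHom (by rw [Strict.comp_id]) := by
  subst hx hy
  rw [mateEquiv_symm_apply']
  simp [bicategoricalComp, Strict.leftUnitor_eqToIso, Strict.rightUnitor_eqToIso,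
    Strict.associator_eqToIso]

/-- The data needed to extend a 2-functor `D` to the 2-category obtained by adjoining left adjoints
and inverses of Beck-Chevalley 2-cells. -/
structure ExtensionData (D : StrictPseudofunctor B K) where
  /-- the left adjoints -/
  L : ∀ {a b : B}, (a ⟶ b) → (D.obj b ⟶ D.obj a)
  /-- the adjunctions -/
  adj : ∀ {a b : B} (v : a ⟶ b), L v ⊣ D.map v
  L_eq : ∀ {a b : B} (v : a ⟶ b) [IsRightAdjoint v], L v = D.map (leftAdjoint v)
  unit_eq : ∀ {a b : B} (v : a ⟶ b) [IsRightAdjoint v], (adj v).unit =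
    (D.mapAdjunction (Adjunction.ofIsRightAdjoint v)).unit ≫ eqToHom (by rw [L_eq])
  counit_eq : ∀ {a b : B} (v : a ⟶ b) [IsRightAdjoint v], (adj v).counit =
    eqToHom (by rw [L_eq]) ≫ (D.mapAdjunction (Adjunction.ofIsRightAdjoint v)).counit
  /-- the inverses of the Beck-Chevalley 2-cells -/
  bcInv : ∀ s, L (sq s).u ≫ D.map (sq s).d ⟶ D.map (sq s).f ≫ L (sq s).t
  bc_bcInv : ∀ s, (mateEquiv (adj (sq s).u) (adj (sq s).t)).symm
    (eqToHom (D.map_comp _ _).symm ≫ D.map₂ (sq s).α ≫ eqToHom (D.map_comp _ _)) ≫ bcInv s = 𝟙 _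
  bcInv_bc : ∀ s, bcInv s ≫ (mateEquiv (adj (sq s).u) (adj (sq s).t)).symm
    (eqToHom (D.map_comp _ _).symm ≫ D.map₂ (sq s).α ≫ eqToHom (D.map_comp _ _)) = 𝟙 _

namespace ExtensionData

variable {sq} {D : StrictPseudofunctor B K} (X : ExtensionData sq D)

/-- The value at a formal composite of 1-cells. -/
def preMap : ∀ {a b : B}, PreHom a b → (D.obj a ⟶ D.obj b)
  | _, _, .base f => D.map f
  | _, _, .shriek v => X.L v
  | _, _, .comp p q => preMap p ≫ preMap q

theorem preMap_eq {a b : B} {p q : PreHom a b} (h : PreHom.Rel p q) : X.preMap p = X.preMap q := by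
  induction h with
  | base_comp f g => exact D.map_comp f g
  | id_comp p => simp only [preMap, D.map_id, Strict.id_comp]
  | comp_id p => simp only [preMap, D.map_id, Strict.comp_id]
  | assoc p q r => exact Strict.assoc _ _ _
  | shriek_eq v => exact X.L_eq v
  | comp_left p h ih => simp only [preMap, ih]
  | comp_right p h ih => simp only [preMap, ih]

/-- The value at a 1-cell. -/
def map {a b : Adjoined sq} (f : a ⟶ b) : D.obj a.as ⟶ D.obj b.as :=
  Quot.lift X.preMap (fun _ _ h => X.preMap_eq h) f

theorem map_id (a : Adjoined sq) : X.map (𝟙 a) = 𝟙 _ := D.map_id a.as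

theorem map_comp {a b c : Adjoined sq} (f : a ⟶ b) (g : b ⟶ c) :
    X.map (f ≫ g) = X.map f ≫ X.map g := by
  obtain ⟨p⟩ := f
  obtain ⟨q⟩ := g
  rfl

/-- This and the next three equations hold by definition. They label the `eqToHom`s in `preMap₂`,
which keep the boundaries of 2-cells syntactically matched. -/
theorem map_ι {a b : B} (f : a ⟶ b) : X.map (Adjoined.ι₁ sq f) = D.map f := rfl

theorem map_shriek {a b : B} (v : a ⟶ b) : X.map (Adjoined.shriek sq v) = X.L v := rfl

theorem map_shriek_ι {a b c : B} (v : a ⟶ b) (f : a ⟶ c) :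
    X.map (Adjoined.shriek sq v ≫ Adjoined.ι₁ sq f) = X.L v ≫ D.map f := rfl

theorem map_ι_shriek {a b c : B} (v : a ⟶ b) (f : c ⟶ b) :
    X.map (Adjoined.ι₁ sq f ≫ Adjoined.shriek sq v) = D.map f ≫ X.L v := rfl

open Adjoined in
/-- The value at a formal composite of 2-cells. -/
def preMap₂ : ∀ {a b : Adjoined sq} {f g : a ⟶ b}, PreHom₂ sq f g → (X.map f ⟶ X.map g)
  | _, _, _, _, .eqTo h => eqToHom (by rw [h])
  | _, _, _, _, .comp η θ => preMap₂ η ≫ preMap₂ θ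
  | _, _, _, _, .whiskerLeft f η => eqToHom (X.map_comp _ _) ≫ X.map f ◁ preMap₂ η ≫
      eqToHom (X.map_comp _ _).symm
  | _, _, _, _, .whiskerRight η f => eqToHom (X.map_comp _ _) ≫ preMap₂ η ▷ X.map f ≫
      eqToHom (X.map_comp _ _).symm
  | _, _, _, _, .base η => eqToHom (X.map_ι _) ≫ D.map₂ η ≫ eqToHom (X.map_ι _).symm
  | _, _, _, _, .unit v => eqToHom (X.map_id _) ≫ (X.adj v).unit ≫
      eqToHom (X.map_shriek_ι _ _).symm
  | _, _, _, _, .counit v => eqToHom (X.map_ι_shriek _ _) ≫ (X.adj v).counit ≫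
      eqToHom (X.map_id _).symm
  | _, _, _, _, .bcInv s => eqToHom (X.map_shriek_ι _ _) ≫ X.bcInv s ≫
      eqToHom (X.map_ι_shriek _ _).symm

open Adjoined in
-- The formal Beck–Chevalley 2-cell goes to the actual mate, so the two relations for
-- `PreHom₂.bcInv` become the last two fields of `X`.
theorem preMap₂_bc (s : S) : X.preMap₂ (PreHom₂.bc s) =
    eqToHom (X.map_ι_shriek _ _) ≫ (mateEquiv (X.adj (sq s).u) (X.adj (sq s).t)).symm
    (eqToHom (D.map_comp _ _).symm ≫ D.map₂ (sq s).α ≫ eqToHom (D.map_comp _ _)) ≫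
    eqToHom (X.map_shriek_ι _ _).symm := by
  rw [mateEquiv_symm_strict _ _ (D.map_comp _ _)]
  simp only [PreHom₂.bc, preMap₂]
  rw [whiskerRight_eq_of_eq (X.map_ι_shriek _ _), whiskerLeft_eq_of_eq (X.map_shriek _),
    whiskerLeft_eq_of_eq (X.map_ι _)]
  simp only [comp_whiskerRight, whiskerLeft_comp, eqToHom_whiskerRight, whiskerLeft_eqToHom,
    Category.assoc, eqToHom_trans, eqToHom_trans_assoc]
  rfl

open Adjoined in
-- The relations expressing 2-category axioms hold because `K` is a strict 2-category, those about
-- 2-cells of `B` because `D` is a 2-functor, and the remaining ones by the fields of `X` and the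
-- triangle identities.
theorem preMap₂_eq {a b : Adjoined sq} {f g : a ⟶ b} {η θ : PreHom₂ sq f g}
    (h : PreHom₂.Rel η θ) : X.preMap₂ η = X.preMap₂ θ := by
  induction h with
  | id_comp η => simp [preMap₂]
  | comp_id η => simp [preMap₂]
  | assoc η θ κ => simp [preMap₂]
  | whiskerLeft_id f g => simp [preMap₂]
  | whiskerLeft_comp f η θ => simp [preMap₂]
  | id_whiskerLeft η =>
    simp only [preMap₂]
    rw [whiskerLeft_eq_of_eq (X.map_id _)]
    simp [Strict.leftUnitor_eqToIso]
  | comp_whiskerLeft f g η =>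
    simp only [preMap₂]
    rw [whiskerLeft_eq_of_eq (X.map_comp f g)]
    simp [Strict.associator_eqToIso]
  | id_whiskerRight f g => simp [preMap₂]
  | comp_whiskerRight η θ i => simp [preMap₂]
  | whiskerRight_id η =>
    simp only [preMap₂]
    rw [whiskerRight_eq_of_eq (X.map_id _)]
    simp [Strict.rightUnitor_eqToIso]
  | whiskerRight_comp η g h =>
    simp only [preMap₂]
    rw [whiskerRight_eq_of_eq (X.map_comp g h)]
    simp [Strict.associator_eqToIso]
  | whisker_assoc f η h => simp [preMap₂, Strict.associator_eqToIso]
  | whisker_exchange η θ => simp [preMap₂, whisker_exchange_assoc]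
  | base_id f => simp [preMap₂]
  | base_comp η θ => simp [preMap₂]
  | base_whiskerLeft f η =>
    simp only [preMap₂]
    rw [D.map₂_whisker_left, D.mapComp_eq_eqToIso, D.mapComp_eq_eqToIso,
      whiskerLeft_eq_of_eq (X.map_ι f)]
    simp
  | base_whiskerRight η f =>
    simp only [preMap₂]
    rw [D.map₂_whisker_right, D.mapComp_eq_eqToIso, D.mapComp_eq_eqToIso,
      whiskerRight_eq_of_eq (X.map_ι f)]
    simp
  | left_triangle v =>
    simp only [preMap₂, PreHom₂.leftTriangle]
    rw [whiskerLeft_eq_of_eq (X.map_shriek v), whiskerRight_eq_of_eq (X.map_shriek v)]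
    simp only [comp_whiskerRight, whiskerLeft_comp, eqToHom_whiskerRight, whiskerLeft_eqToHom,
      Category.assoc, eqToHom_trans, eqToHom_trans_assoc]
    exact eqToHom_conj_eq_id (adjunction_left_triangle_strict (X.adj v)) _ _
  | right_triangle v =>
    simp only [preMap₂, PreHom₂.rightTriangle, comp_whiskerRight, whiskerLeft_comp,
      eqToHom_whiskerRight, whiskerLeft_eqToHom, Category.assoc, eqToHom_trans, eqToHom_trans_assoc]
    exact eqToHom_conj_eq_id (adjunction_right_triangle_strict (X.adj v)) _ _
  | unit_eq v =>
    simp only [preMap₂]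
    rw [X.unit_eq, D.mapAdjunction_unit']
    simp only [Category.assoc, eqToHom_trans, eqToHom_trans_assoc]
    exact (eqToHom_conj_comp_eqToHom _ _ _ _).symm
  | counit_eq v =>
    simp only [preMap₂]
    rw [X.counit_eq, D.mapAdjunction_counit']
    simp only [Category.assoc, eqToHom_trans, eqToHom_trans_assoc]
    exact (eqToHom_comp_eqToHom_conj _ _ _ _).symm
  | bc_bcInv s =>
    simp only [preMap₂, preMap₂_bc, Category.assoc, eqToHom_trans_assoc, eqToHom_refl,
      Category.id_comp]
    exact eqToHom_conj_eq_id' (X.bc_bcInv s) _ _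
  | bcInv_bc s =>
    simp only [preMap₂, preMap₂_bc, Category.assoc, eqToHom_trans_assoc, eqToHom_refl,
      Category.id_comp]
    exact eqToHom_conj_eq_id' (X.bcInv_bc s) _ _
  | comp_left η h ih => simp only [preMap₂, ih]
  | comp_right θ h ih => simp only [preMap₂, ih]
  | whiskerLeft_congr f h ih => simp only [preMap₂, ih]
  | whiskerRight_congr f h ih => simp only [preMap₂, ih]

/-- The extension of `D` determined by the data `X`. -/
def extension : StrictPseudofunctor (Adjoined sq) K :=
  StrictPseudofunctor.mk''
    { obj := fun a => D.obj a.as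
      map := X.map
      map₂ := fun η => Quot.lift X.preMap₂ (fun _ _ h => X.preMap₂_eq h) η
      map₂_id := fun f => rfl
      map₂_comp := by
        rintro a b f g h ⟨η⟩ ⟨θ⟩
        rfl
      map_id := X.map_id
      map_comp := X.map_comp
      map₂_whisker_left := by
        rintro a b c f g h ⟨η⟩
        rfl
      map₂_whisker_right := by
        rintro a b c f g ⟨η⟩ h
        rfl }

theorem res_extension : Adjoined.res X.extension = D := by
  apply strictPseudofunctor_ext
  refine prelaxFunctor_ext rfl fun f g η => heq_of_eq ?_
  -- At a 2-cell of `B` the extension is `D.map₂ η` between two `eqToHom`s of reflexive equalities.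
  exact (Category.id_comp _).trans (Category.comp_id _)

end ExtensionData

end Universal

/-! ### Preservation of mates, and invertibility of Beck–Chevalley transforms -/

section BeckChevalley

/-- A mate is a pasting with a unit and a counit, and 2-functors preserve pastings and adjunctions.
-/
theorem map₂_mateEquiv_symm {B : Type u₁} [Bicategory.{w₁, v₁} B] [Strict B] {K : Type u₂}
    [Bicategory.{w₂, v₂} K] [Strict K] (M : StrictPseudofunctor B K) {a b c d : B} {u : a ⟶ b}
    {f : b ⟶ d} {v : a ⟶ c} {t : c ⟶ d} {l : b ⟶ a} {m : d ⟶ c} (adj : l ⊣ u) (adj' : m ⊣ t)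
    {x y : a ⟶ d} (hx : x = u ≫ f) (hy : y = v ≫ t) (ξ : x ⟶ y) :
    M.map₂ ((mateEquiv adj adj').symm (eqToHom hx.symm ≫ ξ ≫ eqToHom hy)) =
      eqToHom (M.map_comp f m) ≫
        (mateEquiv (M.mapAdjunction adj) (M.mapAdjunction adj')).symm
          (eqToHom (by rw [hx, M.map_comp]) ≫ M.map₂ ξ ≫ eqToHom (by rw [hy, M.map_comp])) ≫
      eqToHom (M.map_comp l v).symm := by
  rw [mateEquiv_symm_strict adj adj' hx hy ξ, mateEquiv_symm_strict (M.mapAdjunction adj)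
    (M.mapAdjunction adj') (by rw [hx, M.map_comp]) (by rw [hy, M.map_comp]),
    M.mapAdjunction_unit', M.mapAdjunction_counit']
  simp only [M.map₂_comp, M.map₂_whisker_left, M.map₂_whisker_right, M.mapComp_eq_eqToIso,
    PrelaxFunctor.map₂_eqToHom, eqToIso.hom, eqToIso.inv]
  rw [whiskerRight_eq_of_eq (M.map_comp f m)]
  simp only [comp_whiskerRight, whiskerLeft_comp, eqToHom_whiskerRight, whiskerLeft_eqToHom,
    Category.assoc, eqToHom_trans, eqToHom_trans_assoc]

theorem isIso_of_eqToHom_conj {C : Type u₁} [Category.{v₁} C] {a b c d : C} {f : b ⟶ c}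
    (i : a = b) (j : c = d) (h : IsIso (eqToHom i ≫ f ≫ eqToHom j)) : IsIso f := by
  subst i j
  simpa using h

variable {B : Type u} [Bicategory.{u, u} B] {S : Type u} (sq : S → LaxSquare B)
variable {K : Type u₂} [Bicategory.{w₂, v₂} K] [Strict K]

namespace Adjoined

/-- Rewrites the formal pasting as a mate, so that preservation of mates applies to it. -/
theorem bcIso_hom (s : S) : (bcIso sq s).hom =
    (mateEquiv (shriekAdj sq (sq s).u) (shriekAdj sq (sq s).t)).symm
      (eqToHom (ι₁_comp sq _ _).symm ≫
        (Quot.mk _ (.base (sq s).α) : ι₁ sq ((sq s).u ≫ (sq s).f) ⟶ ι₁ sq ((sq s).d ≫ (sq s).t)) ≫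
          eqToHom (ι₁_comp sq _ _)) := by
  rw [mateEquiv_symm_strict _ _ (ι₁_comp sq (sq s).u (sq s).f) (ι₁_comp sq (sq s).d (sq s).t)]
  simp only [← mk_eqTo]
  rfl

variable {sq}

theorem isIso_mateEquiv_symm_of_square [Strict B] (M : StrictPseudofunctor (Adjoined sq) K)
    (s : S) :
    IsIso ((mateEquiv (M.mapAdjunction (shriekAdj sq (sq s).u))
      (M.mapAdjunction (shriekAdj sq (sq s).t))).symm
        (eqToHom ((res M).map_comp (sq s).u (sq s).f).symm ≫ (res M).map₂ (sq s).α ≫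
          eqToHom ((res M).map_comp (sq s).d (sq s).t))) := by
  have h : IsIso (M.map₂ (bcIso sq s).hom) := inferInstance
  rw [bcIso_hom, map₂_mateEquiv_symm M (shriekAdj sq (sq s).u) (shriekAdj sq (sq s).t)
    (ι₁_comp sq (sq s).u (sq s).f) (ι₁_comp sq (sq s).d (sq s).t)] at h
  exact isIso_of_eqToHom_conj _ _ h

end Adjoined

end BeckChevalley

/-! ### Axioms 3 and 4 for restrictions, and extension of right derivators -/

section DerivatorExtension

open DiagramCategory

variable {𝔇 : DiagramCategory.{u}}

/-- The family of squares whose Beck-Chevalley 2-cells are inverted in the sketch. -/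
abbrev squares (𝔇 : DiagramCategory.{u})
    (s : Σ i j : 𝔇.Obj, (𝔇.cat i ⟶ 𝔇.cat j) × 𝔇.cat j) : LaxSquare 𝔇.Coop :=
  𝔇.underSquare s.2.2.1 s.2.2.2

theorem beckChevalley_eq (D : Prederivator 𝔇) (s : LaxSquare 𝔇.Coop)
    {Lu : D.obj s.mid₁ ⟶ D.obj s.src} (adju : Lu ⊣ D.map s.u)
    {Lt : D.obj s.tgt ⟶ D.obj s.mid₂} (adjt : Lt ⊣ D.map s.t) :
    beckChevalley D s adju adjt = (mateEquiv adju adjt).symm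
      (eqToHom (D.map_comp s.u s.f).symm ≫ D.map₂ s.α ≫ eqToHom (D.map_comp s.d s.t)) := by
  rw [beckChevalley, D.mapComp_eq_eqToIso, D.mapComp_eq_eqToIso]
  rfl

theorem isIso_beckChevalley_iff (D : Prederivator 𝔇) (s : LaxSquare 𝔇.Coop)
    {Lu : D.obj s.mid₁ ⟶ D.obj s.src} (adju : Lu ⊣ D.map s.u)
    {Lt : D.obj s.tgt ⟶ D.obj s.mid₂} (adjt : Lt ⊣ D.map s.t) :
    IsIso (beckChevalley D s adju adjt) ↔ IsIso ((mateEquiv adju adjt).symm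
      (eqToHom (D.map_comp s.u s.f).symm ≫ D.map₂ s.α ≫ eqToHom (D.map_comp s.d s.t))) := by
  rw [beckChevalley_eq]

/-- The formal Beck–Chevalley 2-cell is invertible, which settles the adjunctions coming from
`shriekAdj`; arbitrary ones follow by independence of the choice. -/
theorem isIso_beckChevalley_res (M : StrictPseudofunctor (SketchCat 𝔇) Cat.{u, u}) {i j : 𝔇.Obj}
    (v : 𝔇.cat i ⟶ 𝔇.cat j) (d : 𝔇.cat j)
    {Lu : (restrict 𝔇 M).obj (Coop.of i) ⟶ (restrict 𝔇 M).obj (Coop.of j)}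
    (adju : Lu ⊣ (restrict 𝔇 M).map (𝔇.underSquare v d).u)
    {Lt : (restrict 𝔇 M).obj (Coop.of (𝔇.underCat v d)) ⟶ (restrict 𝔇 M).obj (Coop.of 𝔇.pt)}
    (adjt : Lt ⊣ (restrict 𝔇 M).map (𝔇.underSquare v d).t) :
    IsIso (beckChevalley (restrict 𝔇 M) (𝔇.underSquare v d) adju adjt) := by
  refine (isIso_beckChevalley_iff (restrict 𝔇 M) (𝔇.underSquare v d) adju adjt).2 ?_
  exact isIso_mateEquiv_symm _ _ adju adjt _
    (Adjoined.isIso_mateEquiv_symm_of_square (sq := squares 𝔇) M ⟨i, j, v, d⟩)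

theorem isRightAdjoint_res (M : StrictPseudofunctor (SketchCat 𝔇) Cat.{u, u}) {i j : 𝔇.Obj}
    (v : 𝔇.cat i ⟶ 𝔇.cat j) : IsRightAdjoint ((restrict 𝔇 M).map (opMap v)) :=
  IsRightAdjoint.mk (M.mapAdjunction (Adjoined.shriekAdj (squares 𝔇) (opMap v)))

open Adjoined in
-- Cocontinuity quantifies over all left adjoints, while `HasInvertibleMates` mentions only the
-- images of `shriekAdj`; invertibility does not depend on this choice.
theorem isCocontinuous_of_hasInvertibleMates {M N : StrictPseudofunctor (SketchCat 𝔇) Cat.{u, u}}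
    {θ : (res M).toPseudofunctor ⟶ (res N).toPseudofunctor} (hθ : HasInvertibleMates θ) :
    IsCocontinuous (D := restrict 𝔇 M) (E := restrict 𝔇 N) θ := by
  intro x y v L adj L' adj'
  exact isIso_mateEquiv_symm _ _ adj adj' _ (hθ v)

open Adjoined in
theorem hasInvertibleMates_of_isCocontinuous {M N : StrictPseudofunctor (SketchCat 𝔇) Cat.{u, u}}
    {θ : (res M).toPseudofunctor ⟶ (res N).toPseudofunctor}
    (hθ : IsCocontinuous (D := restrict 𝔇 M) (E := restrict 𝔇 N) θ) : HasInvertibleMates θ :=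
  fun _ _ v => hθ v (M.mapAdjunction (shriekAdj (squares 𝔇) v))
    (N.mapAdjunction (shriekAdj (squares 𝔇) v))

/-- `chosenLeftAdjoint` reduces to the image of an adjunction only propositionally, so its unit must
be transported; likewise for the counit. -/
theorem LeftAdjoint.unit_eq {K : Type u₂} [Bicategory.{w₂, v₂} K] {a b : K} {r : b ⟶ a}
    {A A' : LeftAdjoint r} (h : A = A') :
    A.adj.unit = A'.adj.unit ≫ eqToHom (by rw [h]) := by
  subst h; simp

theorem LeftAdjoint.counit_eq {K : Type u₂} [Bicategory.{w₂, v₂} K] {a b : K} {r : b ⟶ a}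
    {A A' : LeftAdjoint r} (h : A = A') :
    A.adj.counit = eqToHom (by rw [h]) ≫ A'.adj.counit := by
  subst h; simp

variable {D : Prederivator 𝔇} (hD : IsRightDerivator D)

open Classical in
/-- A choice of left adjoints `v_!` for a right derivator, which is the image of the chosen left
adjoint of `v` if there is one. -/
noncomputable def chosenLeftAdjoint {x y : 𝔇.Coop} (v : x ⟶ y) : LeftAdjoint (D.map v) :=
  if _h : IsRightAdjoint v then ⟨_, D.mapAdjunction (Bicategory.Adjunction.ofIsRightAdjoint v)⟩
  else
    have : IsRightAdjoint (D.map v) := hD.isRightAdjoint v.unop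
    getLeftAdjoint (D.map v)

theorem chosenLeftAdjoint_eq {x y : 𝔇.Coop} (v : x ⟶ y) [h : IsRightAdjoint v] :
    chosenLeftAdjoint hD v = ⟨_, D.mapAdjunction (Bicategory.Adjunction.ofIsRightAdjoint v)⟩ :=
  dif_pos h

theorem isIso_mateEquiv_symm_chosenLeftAdjoint
    (s : Σ i j : 𝔇.Obj, (𝔇.cat i ⟶ 𝔇.cat j) × 𝔇.cat j) :
    IsIso ((mateEquiv (chosenLeftAdjoint hD (squares 𝔇 s).u).adj
      (chosenLeftAdjoint hD (squares 𝔇 s).t).adj).symm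
      (eqToHom (D.map_comp _ _).symm ≫ D.map₂ (squares 𝔇 s).α ≫ eqToHom (D.map_comp _ _))) := by
  rw [← beckChevalley_eq]
  exact hD.isIso_beckChevalley _ _ _ _

/-- The data which extend a right derivator to the underlying 2-category of the sketch. -/
noncomputable def derivatorExtensionData : ExtensionData (squares 𝔇) D where
  L v := (chosenLeftAdjoint hD v).left
  adj v := (chosenLeftAdjoint hD v).adj
  L_eq v _ := by rw [chosenLeftAdjoint_eq]
  unit_eq v _ := LeftAdjoint.unit_eq (chosenLeftAdjoint_eq hD v)
  counit_eq v _ := LeftAdjoint.counit_eq (chosenLeftAdjoint_eq hD v)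
  bcInv s :=
    have := isIso_mateEquiv_symm_chosenLeftAdjoint hD s
    inv ((mateEquiv (chosenLeftAdjoint hD (squares 𝔇 s).u).adj
      (chosenLeftAdjoint hD (squares 𝔇 s).t).adj).symm
      (eqToHom (D.map_comp _ _).symm ≫ D.map₂ (squares 𝔇 s).α ≫ eqToHom (D.map_comp _ _)))
  bc_bcInv s := by
    have := isIso_mateEquiv_symm_chosenLeftAdjoint hD s
    exact IsIso.hom_inv_id _
  bcInv_bc s := by
    have := isIso_mateEquiv_symm_chosenLeftAdjoint hD s
    exact IsIso.inv_hom_id _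

end DerivatorExtension

/-! ### Cofibrancy of the weights -/

section Cofibrancy

/-- The structural isomorphisms of a 2-natural transformation are `eqToIso`s, hence determined by
the components. -/
theorem TwoNat.ext_app {E : Type u₁} [Bicategory.{w₁, v₁} E] {K : Type u₂} [Bicategory.{w₂, v₂} K]
    {F G : StrictPseudofunctor E K} {θ κ : TwoNat F G} (h : ∀ a, θ.obj.app a = κ.obj.app a) :
    θ = κ := by
  obtain ⟨⟨app, nat, _, _, _⟩, hθ⟩ := θ
  obtain ⟨⟨app', nat', _, _, _⟩, hκ⟩ := κ
  obtain rfl : app = app' := funext h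
  obtain rfl : @nat = @nat' := by
    funext a b f
    obtain ⟨_, e⟩ := hθ f
    obtain ⟨_, e'⟩ := hκ f
    exact e.trans e'.symm
  rfl

variable {J : Type u₁} [Category.{v₁} J]

/-- Constructor for 2-natural transformations between 2-functors on a locally discrete
2-category. -/
def TwoNat.ofLocallyDiscrete {K : Type u₂} [Bicategory.{w₂, v₂} K] [Strict K]
    {F G : StrictPseudofunctor (LocallyDiscrete J) K} (app : ∀ a, F.obj a ⟶ G.obj a)
    (nat : ∀ {a b : LocallyDiscrete J} (f : a ⟶ b), F.map f ≫ app b = app a ≫ G.map f) :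
    TwoNat F G :=
  TwoNat.ofApp app nat (by
    intro a b f g η
    obtain rfl := LocallyDiscrete.eq_of_hom η
    obtain rfl : η = 𝟙 _ := Subsingleton.elim _ _
    rw [F.map₂_id, G.map₂_id]
    exact id_whisker_eqToHom (nat f))

/-- Lift an isomorphism from the image of some object to `y`. -/
theorem exists_obj_eq_of_isIsofibration {C : Type u₁} [Category.{v₁} C] {D : Type u₂}
    [Category.{v₂} D] {p : C ⥤ D} [p.IsEquivalence] (hp : IsIsofibration p) (y : D) :
    ∃ x, p.obj x = y := by
  obtain ⟨x, -, h, -⟩ := hp (p.objObjPreimageIso y)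
  exact ⟨x, h⟩

/-- Full faithfulness lifts each morphism uniquely once its endpoints are lifted; uniqueness gives
functoriality. -/
theorem exists_lift_of_obj {W H K : Cat.{u, u}} {p : H ⟶ K} (hp : p.toFunctor.IsEquivalence)
    {f : W ⟶ K} {o : W → H} (h : ∀ w, p.toFunctor.obj (o w) = f.toFunctor.obj w) :
    ∃ g : W ⟶ H, (∀ w, g.toFunctor.obj w = o w) ∧ g ≫ p = f := by
  let g : W ⥤ H :=
    { obj := o
      map := fun {w w'} φ =>
        p.toFunctor.preimage (eqToHom (h w) ≫ f.toFunctor.map φ ≫ eqToHom (h w').symm)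
      map_id := fun w => p.toFunctor.map_injective (by simp)
      map_comp := fun φ ψ => p.toFunctor.map_injective (by simp) }
  refine ⟨g.toCatHom, fun w => rfl, ?_⟩
  apply Cat.ext
  exact CategoryTheory.Functor.ext h (fun w w' φ => p.toFunctor.map_preimage _)

theorem comp_comp_eq_of_squares {C : Type u₁} [Category.{v₁} C] {w w' h h' k k' : C} {φ : w ⟶ w'}
    {χ : h ⟶ h'} {ψ : k ⟶ k'} {g : w ⟶ h} {g' : w' ⟶ h'} {p : h ⟶ k} {p' : h' ⟶ k'} {f : w ⟶ k}
    {f' : w' ⟶ k'} (hg : g ≫ p = f) (hg' : g' ≫ p' = f') (e₁ : χ ≫ p' = p ≫ ψ)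
    (e₂ : φ ≫ f' = f ≫ ψ) : (φ ≫ g') ≫ p' = (g ≫ χ) ≫ p' := by
  rw [Category.assoc, hg', e₂, Category.assoc, e₁, reassoc_of% hg]

theorem functor_eq_of_comp_faithful {W H K : Type u} [Category.{u} W] [Category.{u} H]
    [Category.{u} K] (p : H ⥤ K) [p.Faithful] {f g : W ⥤ H} (h : ∀ w, f.obj w = g.obj w)
    (h' : f ⋙ p = g ⋙ p) : f = g :=
  CategoryTheory.Functor.ext h (fun w w' φ => p.map_injective (by
    have := CategoryTheory.Functor.congr_hom h' φ
    simpa [eqToHom_map] using this))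

/-- A weight is cofibrant if its objects lift naturally through pointwise trivial fibrations. -/
theorem isCofibrant_of_lift_objects (W : StrictPseudofunctor (LocallyDiscrete J) Cat.{u, u})
    (hW : ∀ (H K : StrictPseudofunctor (LocallyDiscrete J) Cat.{u, u}) (p : TwoNat H K),
      (∀ e (y : K.obj e), ∃ x, (p.obj.app e).toFunctor.obj x = y) → ∀ f : TwoNat W K,
        ∃ o : ∀ e, W.obj e → H.obj e,
          (∀ e w, (p.obj.app e).toFunctor.obj (o e w) = (f.obj.app e).toFunctor.obj w) ∧
          ∀ {a b : LocallyDiscrete J} (φ : a ⟶ b) w,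
            o b ((W.map φ).toFunctor.obj w) = (H.map φ).toFunctor.obj (o a w)) :
    IsCofibrant W := by
  intro H K p hp f
  obtain ⟨o, ho, ho'⟩ := hW H K p (fun e =>
    have := (hp e).1
    exists_obj_eq_of_isIsofibration (hp e).2) f
  choose g hg hg' using fun e => exists_lift_of_obj (hp e).1 (ho e)
  refine ⟨TwoNat.ofLocallyDiscrete g ?_, TwoNat.ext_app hg'⟩
  intro a b φ
  apply Cat.ext
  have := (hp b).1
  -- The two sides of the naturality square agree on objects by the choice of `o`, and after
  -- composition with the faithful component of `p`; hence they are equal.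
  refine functor_eq_of_comp_faithful (p.obj.app b).toFunctor (fun w => ?_) ?_
  · exact (hg b _).trans ((ho' φ w).trans (congrArg (H.map φ).toFunctor.obj (hg a w).symm))
  · obtain ⟨e₁, -⟩ := p.property φ
    obtain ⟨e₂, -⟩ := f.property φ
    exact congrArg Cat.Hom.toFunctor (comp_comp_eq_of_squares (hg' a) (hg' b) e₁ e₂)

theorem map_id_obj {E : Type u₁} [Bicategory.{w₁, v₁} E] (F : StrictPseudofunctor E Cat.{u, u})
    (a : E) (x : F.obj a) : (F.map (𝟙 a)).toFunctor.obj x = x := by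
  rw [F.map_id]
  rfl

/-- There are only identity 1-cells, so object lifts can be chosen independently. -/
theorem isCofibrant_discrete {I : Type u} (W : StrictPseudofunctor (LocallyDiscrete (Discrete I))
    Cat.{u, u}) : IsCofibrant W := by
  apply isCofibrant_of_lift_objects
  intro H K p hp f
  choose l hl using hp
  refine ⟨fun e w => l e ((f.obj.app e).toFunctor.obj w), fun e w => hl _ _, ?_⟩
  rintro ⟨⟨a⟩⟩ ⟨⟨b⟩⟩ ⟨⟨⟨rfl : a = b⟩⟩⟩ w
  exact (congrArg (fun w => l _ ((f.obj.app ⟨⟨a⟩⟩).toFunctor.obj w)) (map_id_obj W _ w)).trans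
    (map_id_obj H _ _).symm

/-- The 1-cell from the initial object to an element of `X`. -/
abbrev toElement {X : Type u} (c : Discrete X) :
    (⟨.star⟩ : LocallyDiscrete (WithInitial (Discrete X))) ⟶ ⟨.of c⟩ :=
  ⟨PUnit.unit⟩

/-- On objects the weight is free: `0` and `1` at the initial object, and one new object `none` at
each element of `X`, may be lifted arbitrarily. -/
theorem isCofibrant_conservativeWeight (X : Type u) :
    IsCofibrant (ofFunctor (conservativeWeight X)) := by
  apply isCofibrant_of_lift_objects
  intro H K p hp f
  choose l hl using hp
  let o₀ : ULift.{u} (Fin 2) → H.obj ⟨.star⟩ :=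
    fun i => l _ ((f.obj.app ⟨.star⟩).toFunctor.obj i)
  -- The objects `some i` come from the initial object, so naturality forces their lifts.
  let o₁ : ∀ c : Discrete X, Indiscrete (Option (ULift.{u} (Fin 2))) → H.obj ⟨.of c⟩ := fun c w =>
    match w with
    | ⟨some i⟩ => (H.map (toElement c)).toFunctor.obj (o₀ i)
    | ⟨none⟩ => l _ ((f.obj.app ⟨.of c⟩).toFunctor.obj (⟨none⟩ : Indiscrete _))
  refine ⟨fun
    | ⟨.star⟩ => o₀
    | ⟨.of c⟩ => o₁ c, ?_, ?_⟩
  · rintro ⟨c | _⟩ w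
    · obtain ⟨i | i⟩ := w
      · exact hl _ _
      · obtain ⟨e₁, -⟩ := p.property (toElement c)
        obtain ⟨e₂, -⟩ := f.property (toElement c)
        refine (congrArg (fun F => F.toFunctor.obj (o₀ i)) e₁).trans ?_
        refine Eq.trans ?_ (congrArg (fun F => F.toFunctor.obj i) e₂).symm
        exact congrArg (K.map (toElement c)).toFunctor.obj (hl _ _)
    · exact hl _ _
  · rintro ⟨⟨⟨a⟩⟩ | _⟩ ⟨⟨⟨b⟩⟩ | _⟩ φ w
    · obtain ⟨⟨⟨rfl : a = b⟩⟩⟩ := φ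
      exact (congrArg (o₁ ⟨a⟩) (map_id_obj (ofFunctor (conservativeWeight X)) _ w)).trans
        (map_id_obj H _ _).symm
    · exact φ.as.elim
    · rfl
    · exact (congrArg o₀ (map_id_obj (ofFunctor (conservativeWeight X)) _ w)).trans
        (map_id_obj H _ _).symm

end Cofibrancy

/-! ### Weighted cones over a set -/

section DiscreteCones

variable {I : Type u} (Q : StrictPseudofunctor (LocallyDiscrete (Discrete I)) Cat.{u, u})
  (X : Cat.{u, u})

/-- The weight on a set with value the terminal category. -/
abbrev terminalWeight (I : Type u) :
    StrictPseudofunctor (LocallyDiscrete (Discrete I)) Cat.{u, u} :=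
  ofFunctor ((Functor.const _).obj (Cat.of (Discrete PUnit.{u + 1})))

/-- Disposes of the identity 1-cells of the shapes, over a set the only ones. -/
theorem modNat_id {G : Type u₁} [Bicategory.{w₁, v₁} G] {K : Type u₂} [Bicategory.{w₂, v₂} K]
    {M N : Pseudofunctor G K} {θ κ : M ⟶ N} (γ : ∀ a, θ.app a ⟶ κ.app a) (a : G) :
    ModNat θ κ γ (𝟙 a) := by
  unfold ModNat
  rw [θ.naturality_id_hom, κ.naturality_id_hom]
  calc
    _ = (M.map (𝟙 a) ◁ γ a ≫ (M.mapId a).hom ▷ κ.app a) ⊗≫ κ.app a ◁ (N.mapId a).inv := by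
      bicategory
    _ = (M.mapId a).hom ▷ θ.app a ⊗≫ (γ a ▷ 𝟙 _ ≫ κ.app a ◁ (N.mapId a).inv) := by
      rw [whisker_exchange]; bicategory
    _ = _ := by
      rw [← whisker_exchange]; bicategory

/-- Evaluation of weighted cones on a set. -/
def evalDiscrete : TwoNat (terminalWeight I) (homTo X Q) ⥤ ∀ i : I, (X ⟶ Q.obj ⟨⟨i⟩⟩) where
  obj θ i := (θ.obj.app ⟨⟨i⟩⟩).toFunctor.obj (⟨PUnit.unit⟩ : Discrete PUnit.{u + 1})
  map Γ i := (Γ.hom.as.app ⟨⟨i⟩⟩).toNatTrans.app (⟨PUnit.unit⟩ : Discrete PUnit.{u + 1})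

instance : (evalDiscrete Q X).Faithful where
  map_injective {θ κ Γ Γ'} h := by
    apply ObjectProperty.hom_ext
    apply Pseudofunctor.StrongTrans.homCategory.ext
    rintro ⟨⟨i⟩⟩
    ext x
    obtain ⟨⟨⟩⟩ := x
    exact congrFun h i

instance : (evalDiscrete Q X).Full where
  map_surjective {θ κ} g := by
    let γ : ∀ a, θ.obj.app a ⟶ κ.obj.app a := fun a =>
      NatTrans.toCatHom₂ (Discrete.natTrans (fun x => g a.as.as))
    refine ⟨ObjectProperty.homMk ⟨{ app := γ, naturality := ?_ }⟩, rfl⟩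
    rintro ⟨⟨a⟩⟩ ⟨⟨b⟩⟩ ⟨⟨⟨rfl : a = b⟩⟩⟩
    exact modNat_id γ _

instance : (evalDiscrete Q X).EssSurj where
  mem_essImage g := by
    refine ⟨TwoNat.ofLocallyDiscrete (fun a => ((Functor.const _).obj (g a.as.as)).toCatHom) ?_,
      ⟨Iso.refl _⟩⟩
    rintro ⟨⟨a⟩⟩ ⟨⟨b⟩⟩ ⟨⟨⟨rfl : a = b⟩⟩⟩
    have h₁ := (terminalWeight I).map_id ⟨⟨a⟩⟩
    have h₂ := (homTo X Q).map_id ⟨⟨a⟩⟩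
    exact (congrArg (fun k => k ≫ _) h₁).trans (congrArg (fun k =>
      ((Functor.const (Discrete PUnit.{u + 1})).obj (g a)).toCatHom ≫ k) h₂).symm

instance : (evalDiscrete Q X).IsEquivalence where

end DiscreteCones

/-! ### Homotopy products, tested on all categories and on the point -/

section Families

variable {I : Type u} {L : Cat.{u, u}} {Y : I → Cat.{u, u}} (T : ∀ i, L ⟶ Y i)

/-- Postcomposition with a family of functors. -/
def postcompFamily (X : Cat.{u, u}) : (X ⟶ L) ⥤ ∀ i, (X ⟶ Y i) where
  obj h i := h ≫ T i
  map η i := η ▷ T i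

variable {T}

/-- Full faithfulness of the functor to the product is applied pointwise on `X`; essential
surjectivity comes from composing with its inverse. -/
theorem isEquivalence_postcompFamily (hT : (Functor.pi' fun i => (T i).toFunctor).IsEquivalence)
    (X : Cat.{u, u}) : (postcompFamily T X).IsEquivalence where
  faithful := ⟨fun {h h' η η'} e => by
    ext x
    apply (Functor.pi' fun i => (T i).toFunctor).map_injective
    funext i
    exact congrArg (fun k => k.toNatTrans.app x) (congrFun e i)⟩
  full := ⟨fun {h h'} g => by
    let P := Functor.pi' fun i => (T i).toFunctor
    let k : ∀ x, P.obj (h.toFunctor.obj x) ⟶ P.obj (h'.toFunctor.obj x) :=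
      fun x i => (g i).toNatTrans.app x
    have hk : ∀ {x y} (f : x ⟶ y), P.map (h.toFunctor.map f) ≫ k y =
        k x ≫ P.map (h'.toFunctor.map f) := fun f =>
      funext fun i => (g i).toNatTrans.naturality f
    let η : h.toFunctor ⟶ h'.toFunctor :=
      { app := fun x => P.preimage (k x)
        naturality := fun x y f => P.map_injective (by simp [hk]) }
    refine ⟨NatTrans.toCatHom₂ η, ?_⟩
    funext i
    ext x
    exact congrFun (P.map_preimage (k x)) i⟩
  essSurj := ⟨fun g => by
    let P := Functor.pi' fun i => (T i).toFunctor
    let G := Functor.pi' fun i => (g i).toFunctor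
    let e : (G ⋙ P.inv) ⋙ P ≅ G := Functor.isoWhiskerLeft G P.asEquivalence.counitIso
    refine ⟨(G ⋙ P.inv).toCatHom, ⟨Pi.isoMk fun i => ?_⟩⟩
    exact Cat.Hom.isoMk (Functor.isoWhiskerRight e (Pi.eval _ i))⟩

/-- Functors out of the terminal category are objects, and their transformations are morphisms, so
testing on that one category suffices. -/
theorem isEquivalence_pi'_of_postcompFamily
    (h : (postcompFamily T (Cat.of (Discrete PUnit.{u + 1}))).IsEquivalence) :
    (Functor.pi' fun i => (T i).toFunctor).IsEquivalence where
  faithful := ⟨fun {x y f f'} e => by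
    let η : ∀ _ : x ⟶ y, ((Functor.const (Discrete PUnit.{u + 1})).obj x).toCatHom ⟶
      ((Functor.const (Discrete PUnit.{u + 1})).obj y).toCatHom := fun f =>
        NatTrans.toCatHom₂ ((Functor.const _).map f)
    have : η f = η f' := (postcompFamily T _).map_injective (by
      funext i
      ext z
      exact congrFun e i)
    exact congrArg (fun k => k.toNatTrans.app ⟨PUnit.unit⟩) this⟩
  full := ⟨fun {x y} g => by
    let cx : Cat.of (Discrete PUnit.{u + 1}) ⟶ L :=
      ((Functor.const (Discrete PUnit.{u + 1})).obj x).toCatHom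
    let cy : Cat.of (Discrete PUnit.{u + 1}) ⟶ L :=
      ((Functor.const (Discrete PUnit.{u + 1})).obj y).toCatHom
    obtain ⟨η, hη⟩ := (postcompFamily T _).map_surjective (X := cx) (Y := cy)
      (fun i => NatTrans.toCatHom₂ (Discrete.natTrans fun _ => g i))
    exact ⟨η.toNatTrans.app ⟨PUnit.unit⟩, funext fun i =>
      congrArg (fun k => k.toNatTrans.app ⟨PUnit.unit⟩) (congrFun hη i)⟩⟩
  essSurj := ⟨fun y => by
    obtain ⟨h, ⟨e⟩⟩ := h.essSurj.mem_essImage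
      (fun i => ((Functor.const (Discrete PUnit.{u + 1})).obj (y i)).toCatHom)
    exact ⟨h.toFunctor.obj ⟨PUnit.unit⟩, ⟨Pi.isoMk fun i =>
      (Cat.Hom.toNatIso (Pi.isoApp e i)).app ⟨PUnit.unit⟩⟩⟩⟩

theorem isEquivalence_pi'_iff : (Functor.pi' fun i => (T i).toFunctor).IsEquivalence ↔
    ∀ X, (postcompFamily T X).IsEquivalence :=
  ⟨isEquivalence_postcompFamily, fun h => isEquivalence_pi'_of_postcompFamily (h _)⟩

end Families

theorem isEquivalence_comp_iff {A : Type u₁} [Category.{v₁} A] {B : Type u₂} [Category.{v₂} B]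
    {C : Type u₃} [Category.{w₁} C] (F : A ⥤ B) (G : B ⥤ C) [G.IsEquivalence] :
    (F ⋙ G).IsEquivalence ↔ F.IsEquivalence :=
  ⟨fun _ => Functor.isEquivalence_of_comp_right F G, fun _ => inferInstance⟩

theorem isEquivalence_prod'_eval (Y : ULift.{u} Bool → Cat.{u, u}) :
    (Functor.prod' (Pi.eval (fun b => Y b) ⟨false⟩)
      (Pi.eval (fun b => Y b) ⟨true⟩)).IsEquivalence where
  faithful := ⟨fun {x y f g} e => by
    funext ⟨b⟩
    cases b
    · exact congrArg Prod.fst e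
    · exact congrArg Prod.snd e⟩
  full := ⟨fun {x y} g => ⟨fun
    | ⟨false⟩ => g.1
    | ⟨true⟩ => g.2, rfl⟩⟩
  essSurj := ⟨fun y => ⟨fun
    | ⟨false⟩ => y.1
    | ⟨true⟩ => y.2, ⟨Iso.refl _⟩⟩⟩

theorem isEquivalence_prod'_iff {L : Cat.{u, u}} {Y : ULift.{u} Bool → Cat.{u, u}}
    (T : ∀ b, L ⟶ Y b) :
    (Functor.prod' (T ⟨false⟩).toFunctor (T ⟨true⟩).toFunctor).IsEquivalence ↔
      (Functor.pi' fun b => (T b).toFunctor).IsEquivalence := by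
  have hE := isEquivalence_prod'_eval Y
  exact isEquivalence_comp_iff (Functor.pi' fun b => (T b).toFunctor) (Functor.prod' (Pi.eval (fun b => Y b) ⟨false⟩)
    (Pi.eval (fun b => Y b) ⟨true⟩))

theorem isEquivalence_star_pi (Y : PEmpty.{u + 1} → Cat.{u, u}) :
    (Functor.star.{u} (∀ b, Y b)).IsEquivalence where
  faithful := ⟨fun _ => funext fun b => b.elim⟩
  full := ⟨fun _ => ⟨fun b => b.elim, Subsingleton.elim _ _⟩⟩
  essSurj := ⟨fun _ => ⟨fun b => b.elim, ⟨eqToIso (Subsingleton.elim _ _)⟩⟩⟩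

/-- The product of the empty family is terminal. -/
theorem nonempty_equivalence_punit_iff {L : Cat.{u, u}} {Y : PEmpty.{u + 1} → Cat.{u, u}}
    (T : ∀ b, L ⟶ Y b) :
    Nonempty (L ≌ Discrete PUnit.{u + 1}) ↔
      (Functor.pi' fun b => (T b).toFunctor).IsEquivalence := by
  have hE := isEquivalence_star_pi Y
  constructor
  · rintro ⟨e⟩
    have h' : ((Functor.pi' fun b => (T b).toFunctor) ⋙
      Functor.star.{u} (∀ b, Y b)).IsEquivalence := by
      -- Any two functors to `Discrete PUnit` are equal, so this composite is the given equivalence.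
      rw [Functor.punit_ext' ((Functor.pi' fun b => (T b).toFunctor) ⋙
      Functor.star.{u} (∀ b, Y b)) e.functor]
      infer_instance
    exact Functor.isEquivalence_of_comp_right _ (Functor.star.{u} (∀ b, Y b))
  · intro h
    exact ⟨((Functor.pi' fun b => (T b).toFunctor) ⋙
      Functor.star.{u} (∀ b, Y b)).asEquivalence⟩

/-! ### Product cones and axiom 1 -/

section ProductCones

variable {G : Type u} [Bicategory.{u, u} G] [Strict G] (M : StrictPseudofunctor G Cat.{u, u})
  {I : Type u} {F : Discrete I ⥤ G} {V : G} (leg : ∀ j, V ⟶ F.obj j)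
  (w : ∀ {j j' : Discrete I} (f : j ⟶ j'), leg j ≫ F.map f = leg j')

theorem isHomotopyLimitCone_discrete_iff :
    IsHomotopyLimitCone (mapCone M
      (constCone ((Functor.const _).obj (Cat.of (Discrete PUnit.{u + 1}))) F leg w)) ↔
        (Functor.pi' fun i : I => (M.map (leg ⟨i⟩)).toFunctor).IsEquivalence := by
  rw [isEquivalence_pi'_iff]
  refine forall_congr' fun X => ?_
  -- By definition, the comparison functor followed by evaluation is `postcompFamily` for the legs.
  exact (isEquivalence_comp_iff _ (evalDiscrete ((ofFunctor F).comp M) X)).symm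

end ProductCones

variable {𝔇 : DiagramCategory.{u}} (M : StrictPseudofunctor (SketchCat 𝔇) Cat.{u, u})

open DiagramCategory

theorem isHomotopyLimitCone_coprodCone_iff (i j : 𝔇.Obj) :
    IsHomotopyLimitCone (mapCone M (coprodCone 𝔇 i j).legs) ↔
      (Functor.prod' ((restrict 𝔇 M).map (opMap (𝔇.inl i j))).toFunctor
        ((restrict 𝔇 M).map (opMap (𝔇.inr i j))).toFunctor).IsEquivalence := by
  refine (isHomotopyLimitCone_discrete_iff M _ (by
    rintro ⟨b⟩ ⟨b'⟩ ⟨⟨rfl : b = b'⟩⟩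
    exact Category.comp_id _)).trans ?_
  exact (isEquivalence_prod'_iff _).symm

theorem isHomotopyLimitCone_emptyCone_iff :
    IsHomotopyLimitCone (mapCone M (emptyCone 𝔇).legs) ↔
      Nonempty ((restrict 𝔇 M).obj (Coop.of 𝔇.empty) ≌ Discrete PUnit.{u + 1}) := by
  refine (isHomotopyLimitCone_discrete_iff M _ (fun {j} => j.as.elim)).trans ?_
  exact (nonempty_equivalence_punit_iff _).symm

/-! ### Functors on the arrow category and on indiscrete categories -/

section Indiscrete

variable {C : Type u₁} [Category.{v₁} C] {D : Type u₂} [Category.{v₂} D]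

/-- The isomorphism between two objects of an indiscrete category. -/
def Indiscrete.iso {X : Type u} (x y : Indiscrete X) : x ≅ y where
  hom := PUnit.unit
  inv := PUnit.unit

instance {X : Type u} (x y : Indiscrete X) : Subsingleton (x ⟶ y) :=
  inferInstanceAs (Subsingleton PUnit)

/-- The morphism from the initial object of `{0 < 1}`. -/
abbrev fromZero (x : ULift.{u} (Fin 2)) : (⟨0⟩ : ULift.{u} (Fin 2)) ⟶ x := homOfLE (Fin.zero_le _)

variable {X : Type u} {A A' : ULift.{u} (Fin 2) ⥤ C} {T T' : Indiscrete X ⥤ D}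
  {J : ULift.{u} (Fin 2) ⥤ Indiscrete X} {P : C ⥤ D}

theorem Indiscrete.isIso_map {x y : Indiscrete X} (φ : x ⟶ y) : IsIso (T.map φ) := by
  rw [Subsingleton.elim φ (Indiscrete.iso x y).hom]
  infer_instance

/-- Up to isomorphism `A ⋙ P` factors through an indiscrete category, where every morphism is
invertible. -/
theorem isIso_map_of_indiscrete (n : J ⋙ T ≅ A ⋙ P) {x y : ULift.{u} (Fin 2)} (φ : x ⟶ y) :
    IsIso (P.map (A.map φ)) :=
  (NatIso.isIso_map_iff n φ).1 (Indiscrete.isIso_map _)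

theorem natTrans_indiscrete_ext {γ γ' : T ⟶ T'} (x : X)
    (h : γ.app ⟨x⟩ = γ'.app ⟨x⟩) : γ = γ' := by
  ext y
  rw [← cancel_epi (T.map (Indiscrete.iso ⟨x⟩ y).hom), NatTrans.naturality, NatTrans.naturality, h]

/-- A natural transformation between functors on an indiscrete category is given by one
component. -/
def natTransOfApp (x : X) (k : T.obj ⟨x⟩ ⟶ T'.obj ⟨x⟩) :
    T ⟶ T' where
  app y := T.map (Indiscrete.iso y ⟨x⟩).hom ≫ k ≫ T'.map (Indiscrete.iso ⟨x⟩ y).hom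
  naturality y z φ := by
    rw [← Functor.map_comp_assoc, Category.assoc, Category.assoc, ← Functor.map_comp]
    congr 1

theorem natTransOfApp_app (x : X)
    (k : T.obj ⟨x⟩ ⟶ T'.obj ⟨x⟩) : (natTransOfApp x k).app ⟨x⟩ = k := by
  have h : (Indiscrete.iso (⟨x⟩ : Indiscrete X) ⟨x⟩).hom = 𝟙 _ := rfl
  simp [natTransOfApp, h]

theorem natTrans_arrow_ext {γ γ' : A ⟶ A'} [∀ x, IsIso (A.map (fromZero x))]
    (h : γ.app ⟨0⟩ = γ'.app ⟨0⟩) : γ = γ' := by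
  ext x
  rw [← cancel_epi (A.map (fromZero x)), NatTrans.naturality, NatTrans.naturality, h]

/-- A natural transformation out of an isomorphism is given by its component at the source. -/
noncomputable def natTransOfAppZero [∀ x, IsIso (A.map (fromZero x))]
    (g : A.obj ⟨0⟩ ⟶ A'.obj ⟨0⟩) : A ⟶ A' where
  app x := inv (A.map (fromZero x)) ≫ g ≫ A'.map (fromZero x)
  naturality x y φ := by
    rw [← cancel_epi (A.map (fromZero x)), ← Functor.map_comp_assoc,
      Subsingleton.elim (fromZero x ≫ φ) (fromZero y)]
    simp only [IsIso.hom_inv_id_assoc, Category.assoc, ← Functor.map_comp]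
    rw [Subsingleton.elim (fromZero x ≫ φ) (fromZero y)]

theorem natTransOfAppZero_app [∀ x, IsIso (A.map (fromZero x))] (g : A.obj ⟨0⟩ ⟶ A'.obj ⟨0⟩) :
    (natTransOfAppZero g).app ⟨0⟩ = g := by
  simp [natTransOfAppZero]

/-- `J ⋙ T` inverts every morphism, so an equality of natural transformations out of it can be
tested at `0`. -/
theorem indiscrete_compatible_iff {n : J ⋙ T ≅ A ⋙ P} {n' : J ⋙ T' ≅ A' ⋙ P} {γ : A ⟶ A'}
    {δ : T ⟶ T'} :
    (∀ x, δ.app (J.obj x) ≫ n'.hom.app x = n.hom.app x ≫ P.map (γ.app x)) ↔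
      δ.app (J.obj ⟨0⟩) = n.hom.app ⟨0⟩ ≫ P.map (γ.app ⟨0⟩) ≫ n'.inv.app ⟨0⟩ := by
  constructor
  · intro h
    rw [← reassoc_of% h ⟨0⟩, n'.hom_inv_id_app]
    exact (Category.comp_id _).symm
  · intro h
    have e : Functor.whiskerLeft J δ = n.hom ≫ Functor.whiskerRight γ P ≫ n'.inv := by
      ext x
      have : IsIso ((J ⋙ T).map (fromZero x)) := Indiscrete.isIso_map _
      rw [← cancel_epi ((J ⋙ T).map (fromZero x)), NatTrans.naturality, NatTrans.naturality]
      exact congrArg (· ≫ (J ⋙ T').map (fromZero x)) h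
    intro x
    have hcomp : Functor.whiskerLeft J δ ≫ n'.hom = n.hom ≫ Functor.whiskerRight γ P := by
      rw [e, Category.assoc, Category.assoc, n'.inv_hom_id, Category.comp_id]
    exact congrArg (fun k => k.app x) hcomp

/-- The inclusion of `{0 < 1}` into the indiscrete category on `{0, 1, c}`. -/
abbrev arrowInclusion : ULift.{u} (Fin 2) ⥤ Indiscrete (Option (ULift.{u} (Fin 2))) :=
  toArrowCylinder.toFunctor

/-- A functor to an indiscrete diagram with prescribed objects, all isomorphic to `d`. -/
def Indiscrete.functor {d : D} (o : X → D) (i : ∀ x, d ≅ o x) : Indiscrete X ⥤ D where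
  obj x := o x.as
  map {x y} _ := (i x.as).inv ≫ (i y.as).hom

/-- The values on `{0, 1, c}` of the extension of an isomorphism to an indiscrete category. -/
def cylinderObj (A : ULift.{u} (Fin 2) ⥤ D) : Option (ULift.{u} (Fin 2)) → D
  | some x => A.obj x
  | none => A.obj ⟨0⟩

/-- The extension of an isomorphism to the indiscrete category on `{0, 1, c}`. -/
noncomputable def cylinderFunctor (A : ULift.{u} (Fin 2) ⥤ D)
    (hA : ∀ x, IsIso (A.map (fromZero x))) : Indiscrete (Option (ULift.{u} (Fin 2))) ⥤ D :=
  Indiscrete.functor (d := A.obj ⟨0⟩) (cylinderObj A) fun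
    | some x =>
      let e : A.obj ⟨0⟩ ≅ A.obj x :=
        have := hA x
        asIso (A.map (fromZero x))
      e
    | none => Iso.refl _

/-- Strict equality is needed because weighted cones are 2-natural, not merely pseudo-natural. -/
theorem arrowInclusion_comp_cylinderFunctor (A : ULift.{u} (Fin 2) ⥤ D)
    (hA : ∀ x, IsIso (A.map (fromZero x))) : arrowInclusion ⋙ cylinderFunctor A hA = A := by
  refine CategoryTheory.Functor.ext (fun x => rfl) (fun x y φ => ?_)
  have h : inv (A.map (fromZero x)) ≫ A.map (fromZero y) = A.map φ := by
    rw [IsIso.inv_comp_eq, ← A.map_comp]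
    rfl
  have hrefl : A.map φ = eqToHom rfl ≫ A.map φ ≫ eqToHom rfl := by simp
  exact h.trans hrefl

/-- The functor on `{0 < 1}` given by a morphism. -/
def arrowFunctor {x y : C} (f : x ⟶ y) : ULift.{u} (Fin 2) ⥤ C :=
  Monotone.functor (f := ULift.down) (fun _ _ h => h) ⋙ ComposableArrows.mk₁ f

end Indiscrete

theorem comp_eq_comp_of_eq_id {C : Type u₁} [Category.{v₁} C] {x y : C} {f : x ⟶ x} {g : y ⟶ y}
    (hf : f = 𝟙 x) (hg : g = 𝟙 y) (k : x ⟶ y) : f ≫ k = k ≫ g := by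
  rw [hf, hg, Category.id_comp, Category.comp_id]

theorem isIso_of_isIso_app {C D : Cat.{u, u}} {F G : C ⟶ D} (η : F ⟶ G)
    (h : ∀ z, IsIso (η.toNatTrans.app z)) : IsIso η := by
  have := NatIso.isIso_of_isIso_app η.toNatTrans
  exact (Cat.Hom.isoMk (asIso η.toNatTrans)).isIso_hom

theorem isIso_app {C D : Cat.{u, u}} {F G : C ⟶ D} (η : F ⟶ G) (h : IsIso η) (z : C) :
    IsIso (η.toNatTrans.app z) :=
  inferInstanceAs (IsIso ((Cat.Hom.toNatIso (asIso η)).hom.app z))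

theorem isEquivalence_postcomp_id {B : Type u₁} [Bicategory.{w₁, v₁} B] (a b : B) :
    (postcomp a (𝟙 b)).IsEquivalence :=
  Functor.isEquivalence_of_iso (F := 𝟭 _) (NatIso.ofComponents (fun f => (ρ_ f).symm)
    fun f => rightUnitor_inv_naturality f)

/-! ### Cones for the conservative weight -/

section ConservativeCones

variable {X : Type u}
  (Q : StrictPseudofunctor (LocallyDiscrete (WithInitial (Discrete X))) Cat.{u, u})
  (Y : Cat.{u, u})

/-- Isomorphisms in the value of `Q` at the initial object are detected by the values at the other
objects. -/
def JointlyConservative : Prop :=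
  ∀ ⦃x y : Q.obj ⟨.star⟩⦄ (f : x ⟶ y),
    (∀ c : Discrete X, IsIso ((Q.map (toElement c)).toFunctor.map f)) → IsIso f

variable {Q Y}

section Components

variable (θ : TwoNat (ofFunctor (conservativeWeight X)) (homTo Y Q))

/-- The component of a weighted cone at the initial object. -/
def starComponent : ULift.{u} (Fin 2) ⥤ (Y ⟶ Q.obj ⟨.star⟩) := (θ.obj.app ⟨.star⟩).toFunctor

/-- The component of a weighted cone at an element. -/
def elementComponent (c : Discrete X) :
    Indiscrete (Option (ULift.{u} (Fin 2))) ⥤ (Y ⟶ Q.obj ⟨.of c⟩) :=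
  (θ.obj.app ⟨.of c⟩).toFunctor

/-- The compatibility of the components of a weighted cone. -/
def componentIso (c : Discrete X) :
    arrowInclusion ⋙ elementComponent θ c ≅
      starComponent θ ⋙ postcomp Y (Q.map (toElement c)) :=
  Cat.Hom.toNatIso (θ.obj.naturality (toElement c))

/-- Each element of `X` inverts the arrow, as its image extends over an indiscrete category. Joint
conservativity, applied at every object of `Y`, then makes the arrow itself invertible. -/
theorem isIso_starComponent_map (hQ : JointlyConservative Q) {x y : ULift.{u} (Fin 2)} (φ : x ⟶ y) :
    IsIso ((starComponent θ).map φ) := by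
  have h : ∀ c, IsIso ((postcomp Y (Q.map (toElement c))).map ((starComponent θ).map φ)) :=
    fun c => isIso_map_of_indiscrete (componentIso θ c) φ
  exact isIso_of_isIso_app _ fun z => hQ _ fun c => isIso_app _ (h c) z

end Components

variable (Q Y)

/-- Evaluation of weighted cones at the source of the arrow at the initial object. -/
def evalStar : TwoNat (ofFunctor (conservativeWeight X)) (homTo Y Q) ⥤ (Y ⟶ Q.obj ⟨.star⟩) where
  obj θ := (starComponent θ).obj ⟨0⟩
  map Γ := (Γ.hom.as.app ⟨.star⟩).toNatTrans.app (⟨0⟩ : ULift.{u} (Fin 2))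

variable {Q Y}

/-- The component of a modification at the initial object. -/
def starMod {θ κ : TwoNat (ofFunctor (conservativeWeight X)) (homTo Y Q)} (Γ : θ ⟶ κ) :
    starComponent θ ⟶ starComponent κ := (Γ.hom.as.app ⟨.star⟩).toNatTrans

/-- The component of a modification at an element. -/
def elementMod {θ κ : TwoNat (ofFunctor (conservativeWeight X)) (homTo Y Q)} (Γ : θ ⟶ κ)
    (c : Discrete X) : elementComponent θ c ⟶ elementComponent κ c :=
  (Γ.hom.as.app ⟨.of c⟩).toNatTrans

theorem elementMod_componentIso {θ κ : TwoNat (ofFunctor (conservativeWeight X)) (homTo Y Q)}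
    (Γ : θ ⟶ κ) (c : Discrete X) (x : ULift.{u} (Fin 2)) :
    (elementMod Γ c).app (arrowInclusion.obj x) ≫ (componentIso κ c).hom.app x =
      (componentIso θ c).hom.app x ≫ (postcomp Y (Q.map (toElement c))).map ((starMod Γ).app x) :=
  congrArg (fun k => k.toNatTrans.app x) (Γ.hom.as.naturality (toElement c))

/-- Since the arrow at the initial object is invertible, the component at `0` determines `starMod`.
Compatibility then gives one component over each element, and indiscreteness gives the rest. -/
theorem evalStar_faithful (hQ : JointlyConservative Q) : (evalStar Q Y).Faithful where
  map_injective {θ κ Γ Γ'} h := by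
    have hθ : ∀ x, IsIso ((starComponent θ).map (fromZero x)) := fun x =>
      isIso_starComponent_map θ hQ (fromZero x)
    have h₀ : starMod Γ = starMod Γ' := natTrans_arrow_ext h
    have h₁ : ∀ c, elementMod Γ c = elementMod Γ' c := by
      intro c
      have e := indiscrete_compatible_iff.1 (elementMod_componentIso Γ c)
      rw [h₀, ← indiscrete_compatible_iff.1 (elementMod_componentIso Γ' c)] at e
      exact natTrans_indiscrete_ext _ e
    apply ObjectProperty.hom_ext
    apply Pseudofunctor.StrongTrans.homCategory.ext
    rintro ⟨c | _⟩
    · exact congrArg NatTrans.toCatHom₂ (h₁ c)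
    · exact congrArg NatTrans.toCatHom₂ h₀

/-- The same propagation constructs a modification: extend `g` along the invertible arrow, then over
each indiscrete category from the value at `some 0` dictated by compatibility. -/
theorem evalStar_full (hQ : JointlyConservative Q) : (evalStar Q Y).Full where
  map_surjective {θ κ} g := by
    have hθ : ∀ x, IsIso ((starComponent θ).map (fromZero x)) := fun x =>
      isIso_starComponent_map θ hQ (fromZero x)
    change (starComponent θ).obj ⟨0⟩ ⟶ (starComponent κ).obj ⟨0⟩ at g
    let γ₀ : starComponent θ ⟶ starComponent κ := natTransOfAppZero g
    let γ₁ : ∀ c, elementComponent θ c ⟶ elementComponent κ c := fun c =>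
      natTransOfApp (some (⟨0⟩ : ULift.{u} (Fin 2))) ((componentIso θ c).hom.app ⟨0⟩ ≫
        (postcomp Y (Q.map (toElement c))).map (γ₀.app ⟨0⟩) ≫ (componentIso κ c).inv.app ⟨0⟩)
    have hγ : ∀ c x, (γ₁ c).app (arrowInclusion.obj x) ≫ (componentIso κ c).hom.app x =
        (componentIso θ c).hom.app x ≫ (postcomp Y (Q.map (toElement c))).map (γ₀.app x) :=
      fun c => indiscrete_compatible_iff.2 (natTransOfApp_app _ _)
    let γ : ∀ a, θ.obj.app a ⟶ κ.obj.app a := fun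
      | ⟨.star⟩ => NatTrans.toCatHom₂ γ₀
      | ⟨.of c⟩ => NatTrans.toCatHom₂ (γ₁ c)
    refine ⟨ObjectProperty.homMk ⟨{ app := γ, naturality := ?_ }⟩, ?_⟩
    · rintro ⟨⟨⟨a⟩⟩ | _⟩ ⟨⟨⟨b⟩⟩ | _⟩ φ
      · obtain ⟨⟨⟨rfl : a = b⟩⟩⟩ := φ
        exact modNat_id γ _
      · exact φ.as.elim
      · ext x
        exact hγ _ x
      · exact modNat_id γ _
    · exact natTransOfAppZero_app g

/-- The weighted cone given by a morphism at the initial object which becomes invertible at all the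
elements. -/
noncomputable def arrowCone (A : ULift.{u} (Fin 2) ⥤ (Y ⟶ Q.obj ⟨.star⟩))
    (hA : ∀ c x, IsIso ((A ⋙ postcomp Y (Q.map (toElement c))).map (fromZero x))) :
    TwoNat (ofFunctor (conservativeWeight X)) (homTo Y Q) :=
  TwoNat.ofLocallyDiscrete (fun
    | ⟨.star⟩ => A.toCatHom
    | ⟨.of c⟩ => (cylinderFunctor _ (hA c)).toCatHom) (by
      rintro ⟨⟨⟨a⟩⟩ | _⟩ ⟨⟨⟨b⟩⟩ | _⟩ φ
      · obtain ⟨⟨⟨rfl : a = b⟩⟩⟩ := φ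
        exact comp_eq_comp_of_eq_id ((ofFunctor (conservativeWeight X)).map_id _)
          ((homTo Y Q).map_id _) _
      · exact φ.as.elim
      · exact congrArg Functor.toCatHom (arrowInclusion_comp_cylinderFunctor _ (hA ⟨b⟩))
      · exact comp_eq_comp_of_eq_id ((ofFunctor (conservativeWeight X)).map_id _)
          ((homTo Y Q).map_id _) _)

/-- A morphism `f` inverted at all elements, regarded as a transformation between functors on the
terminal category, is the arrow of some weighted cone. -/
theorem jointlyConservative_of_isIso_starComponent
    (h : ∀ θ : TwoNat (ofFunctor (conservativeWeight X))
        (homTo (Cat.of (Discrete PUnit.{u + 1})) Q),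
      IsIso ((starComponent θ).map (fromZero ⟨1⟩))) : JointlyConservative Q := by
  intro x y f hf
  let cx : Cat.of (Discrete PUnit.{u + 1}) ⟶ Q.obj ⟨.star⟩ := ((Functor.const _).obj x).toCatHom
  let cy : Cat.of (Discrete PUnit.{u + 1}) ⟶ Q.obj ⟨.star⟩ := ((Functor.const _).obj y).toCatHom
  let g : cx ⟶ cy := NatTrans.toCatHom₂ ((Functor.const _).map f)
  have hg : ∀ c x, IsIso
      ((arrowFunctor g ⋙ postcomp _ (Q.map (toElement c))).map (fromZero x)) := by
    rintro c ⟨z⟩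
    -- The map from `0` to `0` is an identity; the map from `0` to `1` is sent to `g`, whose image
    -- is inverted by `hf`.
    fin_cases z
    · exact inferInstanceAs (IsIso ((arrowFunctor g ⋙ postcomp _ (Q.map (toElement c))).map (𝟙 _)))
    · exact isIso_of_isIso_app _ fun _ => hf c
  have hi : IsIso g := h (arrowCone (arrowFunctor g) hg)
  exact isIso_app g hi ⟨PUnit.unit⟩

end ConservativeCones

/-! ### Homotopy models are the extensions of right derivators -/

section

open DiagramCategory

variable {𝔇 : DiagramCategory.{u}} (M : StrictPseudofunctor (SketchCat 𝔇) Cat.{u, u}) (i : 𝔇.Obj)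

/-- The image under a 2-functor of the diagram of the cone `conservativeCone`. -/
abbrev conservativeDiagram :
    StrictPseudofunctor (LocallyDiscrete (WithInitial (Discrete (𝔇.cat i)))) Cat.{u, u} :=
  (conservativeCone 𝔇 i).diagram.comp M

/-- The leg at the initial object is an identity, so this composite is postcomposition with the
image of an identity. -/
theorem isEquivalence_coneComparison_comp_evalStar (Y : Cat.{u, u}) :
    (coneComparison (mapCone M (conservativeCone 𝔇 i).legs) Y ⋙
      evalStar (conservativeDiagram M i) Y).IsEquivalence := by
  have h : (postcomp Y (M.map (𝟙 (conservativeCone 𝔇 i).vertex))).IsEquivalence := by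
    rw [M.map_id]
    exact isEquivalence_postcomp_id _ _
  exact h

/-- If the comparison is essentially surjective on the point, every cone is isomorphic to one whose
arrow is an identity, so its arrow is invertible. Conversely, conservativity makes `evalStar` an
equivalence, and two-out-of-three applies. -/
theorem isHomotopyLimitCone_conservativeCone_iff :
    IsHomotopyLimitCone (mapCone M (conservativeCone 𝔇 i).legs) ↔
      JointlyConservative (conservativeDiagram M i) := by
  constructor
  · intro h
    apply jointlyConservative_of_isIso_starComponent
    intro θ
    obtain ⟨g, ⟨e⟩⟩ := (h (Cat.of (Discrete PUnit.{u + 1}))).essSurj.mem_essImage θ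
    let e' : starComponent _ ≅ starComponent θ :=
      { hom := starMod e.hom
        inv := starMod e.inv
        hom_inv_id := congrArg starMod e.hom_inv_id
        inv_hom_id := congrArg starMod e.inv_hom_id }
    refine (NatIso.isIso_map_iff e' _).1 ?_
    -- The cone in the sketch is constant, so its comparison image has as arrow the image of an
    -- identity 2-cell.
    exact inferInstanceAs (IsIso ((precomp _ g).map ((M.mapFunctor _ _).map
      (𝟙 (𝟙 (conservativeCone 𝔇 i).vertex)))))
  · intro h Y
    have h₁ := isEquivalence_coneComparison_comp_evalStar M i Y
    have h₂ := evalStar_faithful (Y := Y) h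
    have h₃ := evalStar_full (Y := Y) h
    -- Essential surjectivity is inherited from the composite equivalence.
    have h₄ : (evalStar (conservativeDiagram M i) Y).EssSurj := ⟨fun y => by
      obtain ⟨x, e⟩ := h₁.essSurj.mem_essImage y
      exact ⟨(coneComparison (mapCone M (conservativeCone 𝔇 i).legs) Y).obj x, e⟩⟩
    have h₅ : (evalStar (conservativeDiagram M i) Y).IsEquivalence := {}
    exact (isEquivalence_comp_iff _ (evalStar (conservativeDiagram M i) Y)).1 h₁

/-- The cones account for axioms 1 and 2; axioms 3 and 4 hold for every 2-functor on the sketch. -/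
theorem isRightDerivator_restrict_iff :
    IsRightDerivator (restrict 𝔇 M) ↔ (derivatorSketch 𝔇).IsHomotopyModel M := by
  constructor
  · rintro h (⟨i, j⟩ | _ | i)
    · exact (isHomotopyLimitCone_coprodCone_iff M i j).2 (h.coprod i j)
    · exact (isHomotopyLimitCone_emptyCone_iff M).2 h.empty
    · exact (isHomotopyLimitCone_conservativeCone_iff M i).2
        fun x y f hf => (h.isIso_iff i f).2 fun c => hf ⟨c⟩
  · intro h
    exact
      { coprod := fun i j => (isHomotopyLimitCone_coprodCone_iff M i j).1 (h (.coprod i j))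
        empty := (isHomotopyLimitCone_emptyCone_iff M).1 (h .empty)
        isIso_iff := fun i x y f => ⟨fun _ _ => inferInstance, fun hf =>
          (isHomotopyLimitCone_conservativeCone_iff M i).1 (h (.conservative i)) f
            fun c => hf c.as⟩
        isRightAdjoint := fun v => isRightAdjoint_res M v
        isIso_beckChevalley := fun v d _ adju _ adjt => isIso_beckChevalley_res M v d adju adjt }

end

/-! ### Coherence identities for the restriction pseudofunctor -/

section

variable {B : Type u₁} [Bicategory.{w₁, v₁} B] {a b c d : B}

/-- Restriction preserves identities and composites of transformations definitionally, so its
coherence axioms reduce to this identity and the three after it. -/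
theorem eq_id_comp_comp_id {f g : a ⟶ b} (η : f ⟶ g) : η = 𝟙 _ ≫ η ≫ 𝟙 _ := by simp

theorem associator_eq_id_comp (f : a ⟶ b) (g : b ⟶ c) (h : c ⟶ d) :
    (α_ f g h).hom = 𝟙 _ ≫ 𝟙 (f ≫ g) ▷ h ≫ (α_ f g h).hom ≫ f ◁ 𝟙 (g ≫ h) ≫ 𝟙 _ := by simp

theorem leftUnitor_eq_id_comp (f : a ⟶ b) : (λ_ f).hom = 𝟙 _ ≫ 𝟙 (𝟙 a) ▷ f ≫ (λ_ f).hom := by simp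

theorem rightUnitor_eq_id_comp (f : a ⟶ b) : (ρ_ f).hom = 𝟙 _ ≫ f ◁ 𝟙 (𝟙 b) ≫ (ρ_ f).hom := by
  simp

end

/-! ### The biequivalence -/

section Restriction

open Adjoined

variable {𝔇 : DiagramCategory.{u}}

theorem isHomotopySketch_derivatorSketch : (derivatorSketch 𝔇).IsHomotopySketch := by
  rintro (⟨i, j⟩ | _ | i)
  · exact isCofibrant_discrete _
  · exact isCofibrant_discrete _
  · exact isCofibrant_conservativeWeight _

theorem RightDer.eq_of_toPrederivator_eq {D E : RightDer 𝔇}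
    (h : D.toPrederivator = E.toPrederivator) : D = E := by
  cases D
  cases E
  cases h
  rfl

variable (𝔇) in
/-- Restriction of homotopy models to `Dia^coop`. -/
def restriction : Pseudofunctor (derivatorSketch 𝔇).HMod (RightDer 𝔇) where
  obj M := ⟨restrict 𝔇 M.1, (isRightDerivator_restrict_iff M.1).2 M.2⟩
  map θ := ⟨resTrans (sq := squares 𝔇) θ.hom,
    isCocontinuous_of_hasInvertibleMates (hasInvertibleMates_resTrans θ.hom)⟩
  map₂ Γ := ⟨resMod (sq := squares 𝔇) Γ.hom⟩
  map₂_id _ := rfl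
  map₂_comp _ _ := rfl
  mapId M := RightDer.isoMk (Iso.refl (𝟙 (restrict 𝔇 M.1).toPseudofunctor))
  mapComp θ κ := RightDer.isoMk (Iso.refl (resTrans (sq := squares 𝔇) θ.hom ≫
    resTrans (sq := squares 𝔇) κ.hom))
  map₂_whisker_left θ _ _ Γ := RightDer.Hom₂.ext (eq_id_comp_comp_id
    (resTrans (sq := squares 𝔇) θ.hom ◁ resMod (sq := squares 𝔇) Γ.hom))
  map₂_whisker_right Γ θ := RightDer.Hom₂.ext (eq_id_comp_comp_id
    (resMod (sq := squares 𝔇) Γ.hom ▷ resTrans (sq := squares 𝔇) θ.hom))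
  map₂_associator θ κ μ := RightDer.Hom₂.ext (associator_eq_id_comp
    (resTrans (sq := squares 𝔇) θ.hom) (resTrans (sq := squares 𝔇) κ.hom)
    (resTrans (sq := squares 𝔇) μ.hom))
  map₂_left_unitor θ := RightDer.Hom₂.ext (leftUnitor_eq_id_comp
    (resTrans (sq := squares 𝔇) θ.hom))
  map₂_right_unitor θ := RightDer.Hom₂.ext (rightUnitor_eq_id_comp
    (resTrans (sq := squares 𝔇) θ.hom))

/-- More than required holds: restriction is surjective on objects and on 1-cells up to equality,
and bijective on 2-cells, with inverse `extMod`. -/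
theorem isBiequivalence_restriction : IsBiequivalence (restriction 𝔇) where
  essSurj D := by
    obtain ⟨D, hD⟩ := D
    let M := (derivatorExtensionData hD).extension
    have e : restrict 𝔇 M = D := (derivatorExtensionData hD).res_extension
    have hM : (derivatorSketch 𝔇).IsHomotopyModel M :=
      (isRightDerivator_restrict_iff M).1 (e.symm ▸ hD)
    refine ⟨⟨M, hM⟩, ?_⟩
    have e' : (restriction 𝔇).obj ⟨M, hM⟩ = ⟨D, hD⟩ := RightDer.eq_of_toPrederivator_eq e
    rw [e']
    exact ⟨Bicategory.Equivalence.id _⟩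
  isEquivalence M N :=
    { faithful := ⟨fun {θ κ Γ Γ'} h => by
        have h' : resMod (sq := squares 𝔇) Γ.hom = resMod (sq := squares 𝔇) Γ'.hom :=
          congrArg RightDer.Hom₂.hom h
        exact InducedBicategory.Hom₂.ext (congrArg extMod h')⟩
      full := ⟨fun {θ κ} Γ => ⟨⟨extMod (sq := squares 𝔇) Γ.hom⟩, rfl⟩⟩
      -- The extended transformation has the same components as `θ` and the same squares at 1-cells
      -- of $\mathfrak{Dia}^{coop}$, so its restriction is `θ` by definition.
      essSurj := ⟨fun θ => ⟨InducedBicategory.mkHom (extend (sq := squares 𝔇)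
        (hasInvertibleMates_of_isCocontinuous θ.isCocontinuous)), ⟨Iso.refl _⟩⟩⟩ }

end Restriction

end DerivatorSketch

theorem theorem4p1 (𝔇 : DerivatorSketch.DiagramCategory.{u}) :
    (DerivatorSketch.derivatorSketch 𝔇).IsHomotopySketch ∧
      ∃ Φ : Pseudofunctor (DerivatorSketch.derivatorSketch 𝔇).HMod (DerivatorSketch.RightDer 𝔇),
        DerivatorSketch.IsBiequivalence Φ ∧
          ∀ M : (DerivatorSketch.derivatorSketch 𝔇).HModel,
            (Φ.obj M).toPrederivator = DerivatorSketch.restrict 𝔇 M.1 := by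
  exact ⟨DerivatorSketch.isHomotopySketch_derivatorSketch, DerivatorSketch.restriction 𝔇,
    DerivatorSketch.isBiequivalence_restriction, fun _ => rfl⟩
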